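/- **Setting.** All random variables are defined on a complete probability space $(\Omega,\mathcal F,\mathsf P)$, and $\sigma(\cdot)$ denotes a generated $\sigma$-algebra. For a real Hilbert space $\mathsf E$, $\Gamma_0(\mathsf E)$ is the class of lower semicontinuous convex functions $\varphi\colon\mathsf E\to\,]-\infty,+\infty]$ that are not identically $+\infty$; $\partial\varphi(x)=\{u\mid(\forall z)\ \langle z-x,u\rangle+\varphi(x)\le\varphi(z)\}$ and $\operatorname{prox}_\varphi x=\operatorname{argmin}_z\big(\varphi(z)+\tfrac12\|x-z\|^2\big)$; $\rightharpoonup$ denotes weak convergence. Let $p\ge 0$ be an integer, $\mathsf H,\mathsf G_1,\dots,\mathsf G_p$ separable real Hilbert spaces, $\mathsf f\in\Gamma_0(\mathsf H)$ and, for $k=1,\dots,p$, $\mathsf g_k\in\Gamma_0(\mathsf G_k)$ and $0\ne \mathsf L_k\colon\mathsf H\to\mathsf G_k$ linear and bounded. Assume that there is $x\in\mathsf H$ with $0\in\partial\mathsf f(x)+\sum_{k=1}^p\mathsf L_k^*\big(\partial\mathsf g_k(\mathsf L_kx)\big)$, and set $\mathsf F=\operatorname{Argmin}\big(\mathsf f+\sum_{k=1}^p\mathsf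 g_k\circ\mathsf L_k\big)$. Let $\mathsf G=\mathsf G_1\oplus\dots\oplus\mathsf G_p$ (Hilbert direct sum), let $\gamma>0$, let $(\lambda_n)_{n\in\mathbb N}$ be a sequence in $]0,2[$ with $\inf_n\lambda_n>0$ and $\sup_n\lambda_n<2$, and let $\mathsf Q=(\mathrm{Id}+\sum_{k=1}^p\mathsf L_k^*\mathsf L_k)^{-1}$. For an integer $m\ge1$ and a sequence $(\mathcal S_n)_{n\in\mathbb N}$ of $\sigma$-algebras, call random variables $\varepsilon_n=(\varepsilon_{1,n},\dots,\varepsilon_{m,n})$, $n\in\mathbb N$, with values in $\{0,1\}^m\smallsetminus\{0\}$ *admissible* if they are identically distributed and pairwise independent, if $\sigma(\varepsilon_n)$ and $\mathcal S_n$ are independent for every $n$, and if $\mathsf P[\varepsilon_{l,0}=1]>0$ for every $l\in\{1,\dots,m\}$. Call a sequence $(c_n)$ of Hilbert-space valued random variables *$(\mathcal S_n)$-summable* if $\sum_n\sqrt{\mathsf E(\|c_n\|^2\mid\mathcal S_n)}<+\infty$ $\mathsf P$-a.s. All iterations below are for $n=0,1,\dots$ **Algorithm 1.** Let $x_{1,0},z_{1,0},(c_{1,n}),(e_n)$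 be $\mathsf H$-valued and $y_0,w_0,(d_n)$ be $\mathsf G$-valued random variables, and iterate $$\begin{aligned} s_n&=\mathsf Q\big(z_{1,n}+\textstyle\sum_{k=1}^p\mathsf L_k^*w_{k,n}\big)+e_n,\\ x_{1,n+1}&=x_{1,n}+\varepsilon_{1,n}(s_n-x_{1,n}),\\ z_{1,n+1}&=z_{1,n}+\varepsilon_{1,n}\lambda_n\big(\operatorname{prox}_{\gamma\mathsf f}(2x_{1,n+1}-z_{1,n})+c_{1,n}-x_{1,n+1}\big), \end{aligned}$$ and, for $k=1,\dots,p$, $$\begin{aligned} y_{k,n+1}&=y_{k,n}+\varepsilon_{1+k,n}(\mathsf L_ks_n-y_{k,n}),\\ w_{k,n+1}&=w_{k,n}+\varepsilon_{1+k,n}\lambda_n\big(\operatorname{prox}_{\gamma\mathsf g_k}(2y_{k,n+1}-w_{k,n})+d_{k,n}-y_{k,n+1}\big). \end{aligned}$$ With $\mathcal S_n=\sigma\big((z_{1,l},w_l)_{0\le l\le n}\big)$, assume that $(\varepsilon_n)$ is admissible with $m=p+1$, that $(c_{1,n}),(d_n),(e_n)$ are $(\mathcal S_n)$-summable, and that $e_n\rightharpoonup0$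 $\mathsf P$-a.s. **Algorithm 2.** Let $x_0,z_0,u_0,v_0,(c_n)$ be $\mathsf H\oplus\mathsf G$-valued and $(e_n)$ be $\mathsf H$-valued random variables; elements of $\mathsf H\oplus\mathsf G$ have components $1,\dots,p+1$. Iterate, for $i=1,\dots,p+1$ and $k=1,\dots,p$, $$\begin{aligned} x_{i,n+1}&=x_{i,n}+\varepsilon_{i,n}\big(\tfrac12(z_{i,n}+v_{i,n})-x_{i,n}\big),\\ z_{1,n+1}&=z_{1,n}+\varepsilon_{1,n}\lambda_n\big(\operatorname{prox}_{\gamma\mathsf f}(2x_{1,n+1}-z_{1,n})+c_{1,n}-x_{1,n+1}\big),\\ z_{k+1,n+1}&=z_{k+1,n}+\varepsilon_{k+1,n}\lambda_n\big(\operatorname{prox}_{\gamma\mathsf g_k}(2x_{k+1,n+1}-z_{k+1,n})+c_{k+1,n}-x_{k+1,n+1}\big),\\ u_{i,n+1}&=u_{i,n}+\varepsilon_{p+2,n}\big(\tfrac12(z_{i,n}+v_{i,n})-u_{i,n}\big),\\ s_n&=\varepsilon_{p+2,n}\Big(\mathsf Q\big(2u_{1,n+1}-v_{1,n}+\textstyle\sum_{k=1}^p\mathsf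 L_k^*(2u_{k+1,n+1}-v_{k+1,n})\big)+e_n\Big),\\ v_{1,n+1}&=v_{1,n}+\varepsilon_{p+2,n}\lambda_n(s_n-u_{1,n+1}),\\ v_{k+1,n+1}&=v_{k+1,n}+\varepsilon_{p+2,n}\lambda_n(\mathsf L_ks_n-u_{k+1,n+1}). \end{aligned}$$ With $\mathcal S_n=\sigma\big((z_l,v_l)_{0\le l\le n}\big)$, assume that $(\varepsilon_n)$ is admissible with $m=p+2$ and that $(c_n),(e_n)$ are $(\mathcal S_n)$-summable. **Algorithm 3.** Let $r\ge0$ be an integer, $\mathsf K_1,\dots,\mathsf K_r$ separable real Hilbert spaces, $\mathsf K=\mathsf K_1\oplus\dots\oplus\mathsf K_r$, and let $\mathsf E\colon\mathsf H\oplus\mathsf G\to\mathsf K$ be linear and bounded, with closed range and with $\ker\mathsf E=\{(x,\mathsf L_1x,\dots,\mathsf L_px)\mid x\in\mathsf H\}$. Let $\mathsf R_1,\dots,\mathsf R_{p+1+r}$ be the components of the orthogonal projector of $\mathsf H\oplus\mathsf G\oplus\mathsf K$ onto $\{(x,y)\mid y=\mathsf Ex\}$. Let $x_0,z_0,(a_n),(c_n)$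 be $\mathsf H\oplus\mathsf G$-valued and $y_0,w_0,(b_n)$ be $\mathsf K$-valued random variables, and iterate, for $i=1,\dots,p+1$, $k=1,\dots,p$ and $j=1,\dots,r$, $$\begin{aligned} x_{i,n+1}&=x_{i,n}+\varepsilon_{i,n}\big(\mathsf R_i(z_n,w_n)+a_{i,n}-x_{i,n}\big),\\ z_{1,n+1}&=z_{1,n}+\varepsilon_{1,n}\lambda_n\big(\operatorname{prox}_{\gamma\mathsf f}(2x_{1,n+1}-z_{1,n})+c_{1,n}-x_{1,n+1}\big),\\ z_{k+1,n+1}&=z_{k+1,n}+\varepsilon_{k+1,n}\lambda_n\big(\operatorname{prox}_{\gamma\mathsf g_k}(2x_{k+1,n+1}-z_{k+1,n})+c_{k+1,n}-x_{k+1,n+1}\big),\\ y_{j,n+1}&=y_{j,n}+\varepsilon_{p+1+j,n}\big(\mathsf R_{p+1+j}(z_n,w_n)+b_{j,n}-y_{j,n}\big),\\ w_{j,n+1}&=w_{j,n}-\varepsilon_{p+1+j,n}\lambda_n\,y_{j,n+1}. \end{aligned}$$ With $\mathcal S_n=\sigma\big((z_l,w_l)_{0\le l\le n}\big)$, assume that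 $(\varepsilon_n)$ is admissible with $m=p+1+r$, that $(a_n),(b_n),(c_n)$ are $(\mathcal S_n)$-summable, and that $a_n\rightharpoonup0$ and $b_n\rightharpoonup0$ $\mathsf P$-a.s. **Conclusion.** For each of the three algorithms, the sequence $(x_{1,n})_{n\in\mathbb N}$ converges weakly $\mathsf P$-a.s. to an $\mathsf F$-valued random variable. -/

import Mathlib

open MeasureTheory ProbabilityTheory Filter Topology
open scoped ENNReal Pointwise

noncomputable section

/-! ### Convex analysis -/

/-- The class of proper lower semicontinuous convex functions `f : E → ]-∞, +∞]`. -/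
structure IsGammaZero {E : Type*} [NormedAddCommGroup E] [InnerProductSpace ℝ E]
    (f : E → EReal) : Prop where
  lsc : LowerSemicontinuous f
  ne_bot : ∀ x, f x ≠ ⊥
  proper : ∃ x, f x ≠ ⊤
  convex : ∀ x y : E, ∀ a : ℝ, 0 < a → a < 1 →
    f (a • x + (1 - a) • y) ≤ (a : EReal) * f x + ((1 - a : ℝ) : EReal) * f y

/-- The (set-valued) subdifferential of `f`. -/
def subdiff {E : Type*} [NormedAddCommGroup E] [InnerProductSpace ℝ E]
    (f : E → EReal) (x : E) : Set E :=
  {u | ∀ z, ((inner ℝ (z - x) u : ℝ) : EReal) + f x ≤ f z}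

/-- The set of global minimizers of `φ`. -/
def argminSet {E : Type*} (φ : E → EReal) : Set E := {x | ∀ z, φ x ≤ φ z}

/-- The proximity operator of `f`: it maps `x` to the minimizer of `z ↦ f z + ‖x - z‖² / 2`
(which exists and is unique for a proper lower semicontinuous convex function on a
Hilbert space). -/
def prox {E : Type*} [NormedAddCommGroup E] [InnerProductSpace ℝ E]
    (f : E → EReal) (x : E) : E :=
  Classical.epsilon fun q : E =>
    q ∈ argminSet fun z => f z + ((‖x - z‖ ^ 2 / 2 : ℝ) : EReal)

/-- The function `γ f`. -/
def scaled {E : Type*} (γ : ℝ) (f : E → EReal) : E → EReal := fun x => (γ : EReal) * f x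

/-- The zeros of `∂f + ∑ k, L k* ∘ ∂(g k) ∘ L k`. -/
def zerComposite {p : ℕ} {H : Type*} [NormedAddCommGroup H] [InnerProductSpace ℝ H]
    [CompleteSpace H] {G : Fin p → Type*} [∀ k, NormedAddCommGroup (G k)]
    [∀ k, InnerProductSpace ℝ (G k)] [∀ k, CompleteSpace (G k)]
    (f : H → EReal) (g : ∀ k, G k → EReal) (L : ∀ k, H →L[ℝ] G k) : Set H :=
  {x | (0 : H) ∈ subdiff f x +
    ∑ k, (ContinuousLinearMap.adjoint (L k)) '' subdiff (g k) (L k x)}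

/-! ### Hilbert direct sums and projections -/

/-- The Hilbert direct sum `H ⊕ G 1 ⊕ ⋯ ⊕ G p`; the components of `x` are `x.fst` and
`x.snd k`. -/
abbrev DirectSumHG {p : ℕ} (H : Type*) (G : Fin p → Type*) : Type _ :=
  WithLp 2 (H × PiLp 2 G)

/-- The subspace of all `(x, L 1 x, …, L p x)`. -/
def consensus {p : ℕ} {H : Type*} [NormedAddCommGroup H] [InnerProductSpace ℝ H]
    {G : Fin p → Type*} [∀ k, NormedAddCommGroup (G k)] [∀ k, InnerProductSpace ℝ (G k)]
    (L : ∀ k, H →L[ℝ] G k) : Set (DirectSumHG H G) :=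
  {x | ∀ k, x.snd k = L k x.fst}

/-- The graph `{(x, y) | y = M x}` of a bounded linear operator, as a subspace of the Hilbert
direct sum `X ⊕ Y`. -/
def graphSubspace {X Y : Type*} [NormedAddCommGroup X] [InnerProductSpace ℝ X]
    [NormedAddCommGroup Y] [InnerProductSpace ℝ Y] (M : X →L[ℝ] Y) :
    Submodule ℝ (WithLp 2 (X × Y)) where
  carrier := {v | v.snd = M v.fst}
  add_mem' {a b} ha hb := by
    simp only [Set.mem_ofPred_eq, WithLp.add_snd, WithLp.add_fst, map_add] at *
    rw [ha, hb]
  zero_mem' := by simp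
  smul_mem' c a ha := by
    simp only [Set.mem_ofPred_eq, WithLp.smul_snd, WithLp.smul_fst, map_smul] at *
    rw [ha]

instance graphSubspace_hasOrthogonalProjection {X Y : Type*} [NormedAddCommGroup X]
    [InnerProductSpace ℝ X] [CompleteSpace X] [NormedAddCommGroup Y] [InnerProductSpace ℝ Y]
    [CompleteSpace Y] (M : X →L[ℝ] Y) : (graphSubspace M).HasOrthogonalProjection := by
  have hc : IsClosed (graphSubspace M : Set (WithLp 2 (X × Y))) := by
    have h1 : Continuous fun v : WithLp 2 (X × Y) => v.fst :=
      continuous_fst.comp (WithLp.prod_continuous_ofLp 2 X Y)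
    have h2 : Continuous fun v : WithLp 2 (X × Y) => v.snd :=
      continuous_snd.comp (WithLp.prod_continuous_ofLp 2 X Y)
    exact isClosed_eq h2 (M.continuous.comp h1)
  have : CompleteSpace (graphSubspace M) := hc.completeSpace_coe
  infer_instance

/-- The orthogonal projection of `(x, y)` onto the graph of `M`. -/
def projGraph {X Y : Type*} [NormedAddCommGroup X] [InnerProductSpace ℝ X] [CompleteSpace X]
    [NormedAddCommGroup Y] [InnerProductSpace ℝ Y] [CompleteSpace Y] (M : X →L[ℝ] Y)
    (x : X) (y : Y) : WithLp 2 (X × Y) :=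
  (graphSubspace M).starProjection (WithLp.toLp 2 (x, y))

/-- The operator `(Id + ∑ k, L k* ∘ L k)⁻¹` (the inverted operator is always invertible). -/
def resolventQ {p : ℕ} {H : Type*} [NormedAddCommGroup H] [InnerProductSpace ℝ H]
    [CompleteSpace H] {G : Fin p → Type*} [∀ k, NormedAddCommGroup (G k)]
    [∀ k, InnerProductSpace ℝ (G k)] [∀ k, CompleteSpace (G k)]
    (L : ∀ k, H →L[ℝ] G k) : H →L[ℝ] H :=
  ContinuousLinearMap.inverse
    (ContinuousLinearMap.id ℝ H + ∑ k, (ContinuousLinearMap.adjoint (L k)).comp (L k))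

/-! ### Probabilistic vocabulary -/

/-- Weak convergence of a sequence in a Hilbert space. -/
def ConvergesWeakly {E : Type*} [NormedAddCommGroup E] [InnerProductSpace ℝ E]
    (x : ℕ → E) (l : E) : Prop :=
  Tendsto (fun n => toWeakSpace ℝ E (x n)) atTop (𝓝 (toWeakSpace ℝ E l))

/-- `x n` converges weakly, almost surely, to some random variable with values in `S`. -/
def ConvergesWeaklyAsTo {Ω : Type*} [MeasurableSpace Ω] (P : Measure Ω) {E : Type*}
    [NormedAddCommGroup E] [InnerProductSpace ℝ E] [MeasurableSpace E]
    (x : ℕ → Ω → E) (S : Set E) : Prop :=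
  ∃ X : Ω → E, Measurable X ∧ (∀ ω, X ω ∈ S) ∧
    ∀ᵐ ω ∂P, ConvergesWeakly (fun n => x n ω) (X ω)

/-- The σ-algebra generated by `(z l, w l)` for `0 ≤ l ≤ n`. -/
@[reducible] def historySigma {Ω E F : Type*} [MeasurableSpace E] [MeasurableSpace F]
    (z : ℕ → Ω → E) (w : ℕ → Ω → F) (n : ℕ) : MeasurableSpace Ω :=
  ⨆ l ∈ Set.Iic n, (MeasurableSpace.comap (z l) inferInstance ⊔
    MeasurableSpace.comap (w l) inferInstance)

/-- `∑ₙ √E(‖c n‖² | 𝓢 n) < +∞` almost surely. The conditional expectation is that of a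
nonnegative, possibly nonintegrable, random variable. -/
def SummableErrors {Ω : Type*} [mΩ : MeasurableSpace Ω] (P : Measure Ω) {E : Type*}
    [NormedAddCommGroup E] (𝓢 : ℕ → MeasurableSpace Ω) (c : ℕ → Ω → E) : Prop :=
  ∀ᵐ ω ∂P, ∑' n, (condLExp (𝓢 n) P (fun ω' => ‖c n ω'‖ₑ ^ 2) ω) ^ (1 / 2 : ℝ) < ∞

/-- The set `{0,1}^m ∖ {0}` of activation patterns. -/
abbrev Activation (m : ℕ) : Type := {e : Fin m → Fin 2 // e ≠ 0}

/-- The `i`-th entry, `0` or `1`, of an activation pattern as a real number. -/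
def Activation.coeff {m : ℕ} (e : Activation m) (i : Fin m) : ℝ := ((e.1 i : ℕ) : ℝ)

/-- The hypotheses on the activation variables: they are random variables, identically
distributed, pairwise independent, each component is activated with positive probability,
and `ε n` is independent of the past `𝓢 n`. -/
structure ActivationRule {Ω : Type*} [mΩ : MeasurableSpace Ω] (P : Measure Ω) {m : ℕ}
    (ε : ℕ → Ω → Activation m) (𝓢 : ℕ → MeasurableSpace Ω) : Prop where
  measurable : ∀ n, Measurable (ε n)
  identDistrib : ∀ n, IdentDistrib (ε n) (ε 0) P P
  pairwise_indep : Pairwise fun m n => IndepFun (ε m) (ε n) P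
  indep_past : ∀ n, Indep (MeasurableSpace.comap (ε n) inferInstance) (𝓢 n) P
  pos : ∀ l, 0 < P {ω | (ε 0 ω).coeff l = 1}

/-- The relaxation parameters: a sequence in `]0,2[` with positive infimum and with
supremum less than `2`. -/
structure RelaxationSeq (lam : ℕ → ℝ) : Prop where
  mem : ∀ n, lam n ∈ Set.Ioo (0 : ℝ) 2
  inf_pos : 0 < ⨅ n, lam n
  sup_lt : ⨆ n, lam n < 2

/-! ### The three algorithms -/

section Algorithms

variable {Ω : Type*} [mΩ : MeasurableSpace Ω]
  {p : ℕ} {H : Type*} [NormedAddCommGroup H] [InnerProductSpace ℝ H] [CompleteSpace H]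
  [MeasurableSpace H] [BorelSpace H]
  {G : Fin p → Type*} [∀ k, NormedAddCommGroup (G k)] [∀ k, InnerProductSpace ℝ (G k)]
  [∀ k, CompleteSpace (G k)] [∀ k, MeasurableSpace (G k)] [∀ k, BorelSpace (G k)]

/-- First algorithm, with its hypotheses. The activation index set is `{0, …, p}`:
`0` is attached to `f` and `k.succ` to `g k`. -/
structure Framework1 (P : Measure Ω) (f : H → EReal) (g : ∀ k, G k → EReal)
    (L : ∀ k, H →L[ℝ] G k) (γ : ℝ) (lam : ℕ → ℝ)
    (x z s c e : ℕ → Ω → H) (y w d : ℕ → Ω → PiLp 2 G)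
    (ε : ℕ → Ω → Activation (p + 1)) : Prop where
  meas_x : Measurable (x 0)
  meas_z : Measurable (z 0)
  meas_y : Measurable (y 0)
  meas_w : Measurable (w 0)
  meas_c : ∀ n, Measurable (c n)
  meas_e : ∀ n, Measurable (e n)
  meas_d : ∀ n, Measurable (d n)
  step_s : ∀ n ω, s n ω = resolventQ L
    (z n ω + ∑ k, ContinuousLinearMap.adjoint (L k) (w n ω k)) + e n ω
  step_x : ∀ n ω, x (n + 1) ω = x n ω + (ε n ω).coeff 0 • (s n ω - x n ω)
  step_z : ∀ n ω, z (n + 1) ω = z n ω + ((ε n ω).coeff 0 * lam n) •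
    (prox (scaled γ f) ((2 : ℝ) • x (n + 1) ω - z n ω) + c n ω - x (n + 1) ω)
  step_y : ∀ n ω k, y (n + 1) ω k =
    y n ω k + (ε n ω).coeff k.succ • (L k (s n ω) - y n ω k)
  step_w : ∀ n ω k, w (n + 1) ω k = w n ω k + ((ε n ω).coeff k.succ * lam n) •
    (prox (scaled γ (g k)) ((2 : ℝ) • y (n + 1) ω k - w n ω k) + d n ω k - y (n + 1) ω k)
  err_c : SummableErrors P (historySigma z w) c
  err_d : SummableErrors P (historySigma z w) d
  err_e : SummableErrors P (historySigma z w) e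
  weak_e : ∀ᵐ ω ∂P, ConvergesWeakly (fun n => e n ω) 0
  activation : ActivationRule P ε (historySigma z w)

/-- Second algorithm, with its hypotheses. The activation index set is `{0, …, p + 1}`:
`0` is attached to `f`, `k.succ.castSucc` to `g k`, and the last index to the linear
operators. -/
structure Framework2 (P : Measure Ω) (f : H → EReal) (g : ∀ k, G k → EReal)
    (L : ∀ k, H →L[ℝ] G k) (γ : ℝ) (lam : ℕ → ℝ)
    (x z u v c : ℕ → Ω → DirectSumHG H G) (s e : ℕ → Ω → H)
    (ε : ℕ → Ω → Activation (p + 2)) : Prop where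
  meas_x : Measurable (x 0)
  meas_z : Measurable (z 0)
  meas_u : Measurable (u 0)
  meas_v : Measurable (v 0)
  meas_c : ∀ n, Measurable (c n)
  meas_e : ∀ n, Measurable (e n)
  step_x_fst : ∀ n ω, (x (n + 1) ω).fst = (x n ω).fst +
    (ε n ω).coeff 0 • ((1 / 2 : ℝ) • ((z n ω).fst + (v n ω).fst) - (x n ω).fst)
  step_x_snd : ∀ n ω k, (x (n + 1) ω).snd k = (x n ω).snd k +
    (ε n ω).coeff k.succ.castSucc •
      ((1 / 2 : ℝ) • ((z n ω).snd k + (v n ω).snd k) - (x n ω).snd k)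
  step_z_fst : ∀ n ω, (z (n + 1) ω).fst = (z n ω).fst + ((ε n ω).coeff 0 * lam n) •
    (prox (scaled γ f) ((2 : ℝ) • (x (n + 1) ω).fst - (z n ω).fst) + (c n ω).fst
      - (x (n + 1) ω).fst)
  step_z_snd : ∀ n ω k, (z (n + 1) ω).snd k = (z n ω).snd k +
    ((ε n ω).coeff k.succ.castSucc * lam n) •
    (prox (scaled γ (g k)) ((2 : ℝ) • (x (n + 1) ω).snd k - (z n ω).snd k) + (c n ω).snd k
      - (x (n + 1) ω).snd k)
  step_u : ∀ n ω, u (n + 1) ω = u n ω + (ε n ω).coeff (Fin.last (p + 1)) •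
    ((1 / 2 : ℝ) • (z n ω + v n ω) - u n ω)
  step_s : ∀ n ω, s n ω = (ε n ω).coeff (Fin.last (p + 1)) •
    (resolventQ L ((2 : ℝ) • (u (n + 1) ω).fst - (v n ω).fst +
      ∑ k, ContinuousLinearMap.adjoint (L k)
        ((2 : ℝ) • (u (n + 1) ω).snd k - (v n ω).snd k)) + e n ω)
  step_v_fst : ∀ n ω, (v (n + 1) ω).fst = (v n ω).fst +
    ((ε n ω).coeff (Fin.last (p + 1)) * lam n) • (s n ω - (u (n + 1) ω).fst)
  step_v_snd : ∀ n ω k, (v (n + 1) ω).snd k = (v n ω).snd k +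
    ((ε n ω).coeff (Fin.last (p + 1)) * lam n) • (L k (s n ω) - (u (n + 1) ω).snd k)
  err_c : SummableErrors P (historySigma z v) c
  err_e : SummableErrors P (historySigma z v) e
  activation : ActivationRule P ε (historySigma z v)

/-- Third algorithm, with its hypotheses. The coupling operator `E` has closed range and its
kernel is the subspace of all `(x, L 1 x, …, L p x)`. The first `p + 1` activation indices are
attached to `f` and the `g k`, and the last `r` ones to the components of the range of `E`. -/
structure Framework3 {r : ℕ} {K : Fin r → Type*} [∀ j, NormedAddCommGroup (K j)]
    [∀ j, InnerProductSpace ℝ (K j)] [∀ j, CompleteSpace (K j)] [∀ j, MeasurableSpace (K j)]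
    [∀ j, BorelSpace (K j)]
    (P : Measure Ω) (f : H → EReal) (g : ∀ k, G k → EReal)
    (L : ∀ k, H →L[ℝ] G k) (E : DirectSumHG H G →L[ℝ] PiLp 2 K) (γ : ℝ) (lam : ℕ → ℝ)
    (x z a c : ℕ → Ω → DirectSumHG H G) (y w b : ℕ → Ω → PiLp 2 K)
    (ε : ℕ → Ω → Activation (p + 1 + r)) : Prop where
  ker_E : {v | E v = 0} = consensus L
  closed_range_E : IsClosed (Set.range E)
  meas_x : Measurable (x 0)
  meas_z : Measurable (z 0)
  meas_y : Measurable (y 0)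
  meas_w : Measurable (w 0)
  meas_a : ∀ n, Measurable (a n)
  meas_b : ∀ n, Measurable (b n)
  meas_c : ∀ n, Measurable (c n)
  step_x_fst : ∀ n ω, (x (n + 1) ω).fst = (x n ω).fst +
    (ε n ω).coeff (Fin.castAdd r 0) •
      ((projGraph E (z n ω) (w n ω)).fst.fst + (a n ω).fst - (x n ω).fst)
  step_z_fst : ∀ n ω, (z (n + 1) ω).fst = (z n ω).fst +
    ((ε n ω).coeff (Fin.castAdd r 0) * lam n) •
    (prox (scaled γ f) ((2 : ℝ) • (x (n + 1) ω).fst - (z n ω).fst) + (c n ω).fst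
      - (x (n + 1) ω).fst)
  step_x_snd : ∀ n ω k, (x (n + 1) ω).snd k = (x n ω).snd k +
    (ε n ω).coeff (Fin.castAdd r k.succ) •
      ((projGraph E (z n ω) (w n ω)).fst.snd k + (a n ω).snd k - (x n ω).snd k)
  step_z_snd : ∀ n ω k, (z (n + 1) ω).snd k = (z n ω).snd k +
    ((ε n ω).coeff (Fin.castAdd r k.succ) * lam n) •
    (prox (scaled γ (g k)) ((2 : ℝ) • (x (n + 1) ω).snd k - (z n ω).snd k) + (c n ω).snd k
      - (x (n + 1) ω).snd k)
  step_y : ∀ n ω j, y (n + 1) ω j = y n ω j + (ε n ω).coeff (Fin.natAdd (p + 1) j) •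
    ((projGraph E (z n ω) (w n ω)).snd j + b n ω j - y n ω j)
  step_w : ∀ n ω j, w (n + 1) ω j = w n ω j -
    ((ε n ω).coeff (Fin.natAdd (p + 1) j) * lam n) • y (n + 1) ω j
  err_a : SummableErrors P (historySigma z w) a
  err_b : SummableErrors P (historySigma z w) b
  err_c : SummableErrors P (historySigma z w) c
  weak_a : ∀ᵐ ω ∂P, ConvergesWeakly (fun n => a n ω) 0
  weak_b : ∀ᵐ ω ∂P, ConvergesWeakly (fun n => b n ω) 0
  activation : ActivationRule P ε (historySigma z w)

end Algorithms

end

/-! All three algorithms are one random block Douglas-Rachford iteration, on different product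
spaces. Given firmly nonexpansive `J` and a linear firmly nonexpansive `T`, put `R x = J (2 T x - x)
- T x`. Then `-R` is cocoercive (`drDisplacement_cocoercive`), and the state `Z` moves by `λ (R Z +
error)` on the activated blocks only. A memory variable is refreshed whenever its block is
activated, so an outdated value never enters an update.

Let `q i` be the probability that block `i` is activated, and weight that block by `1 / q i` in the
squared norm. The mean effect of a step is then that of a full step, and the mean squared distance
to a zero `a` of `R` drops by `λ (2 - λ) ‖R Z‖²`. The errors are controlled only through conditional
expectations of their norms, so this estimate is turned into one for the distance itself
(`IsBlockDecomposition.sum_norm_step_add_le`), to which errors add linearly. A localized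
Robbins-Siegmund argument (`ae_tendsto_of_almost_supermartingale`) shows that almost surely the
weighted distances converge and `R Z → 0`. A dense sequence of zeros gives one null set for all
zeros, and an Opial argument (`exists_weak_limit_of_fejer`) yields `Z ⇀ a` with `R a = 0`. Since `T`
is linear and bounded, `T Z ⇀ T a`. Every block is activated infinitely often by the strong law of
large numbers, so the stored values have the same weak limit as the fresh ones.

The choices are as follows. In the first algorithm, `T` projects onto `{(x, L x)}` and `J` is the
separable proximity operator. In the second, `T` averages two copies of `H ⊕ G`, and `J` applies the
proximity operator to one copy and the projector to the other. In the third, `T` projects onto the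
graph of `E`, and `J` is the proximity operator paired with `0`. In each case, zeros of `R` encode a
point of `{(x, L x)}` and a multiple of a subgradient of the separable function orthogonal to that
subspace. `exists_blockProx_eq` supplies such a pair and `fst_mem_argminSet` turns it into a
minimizer. -/

noncomputable section

/-! ### Weak convergence and memory variables -/

section Weak
variable {X : Type*} [NormedAddCommGroup X] [InnerProductSpace ℝ X]

theorem convergesWeakly_iff [CompleteSpace X] {x : ℕ → X} {l : X} :
    ConvergesWeakly x l ↔ ∀ y, Tendsto (fun n => inner ℝ (x n) y) atTop (𝓝 (inner ℝ l y)) := by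
  unfold ConvergesWeakly
  have h : Function.Injective ⇑((topDualPairing ℝ X).flip) := by
    intro a b hab
    refine ext_inner_left ℝ fun v => ?_
    exact congrArg (fun φ => φ (InnerProductSpace.toDual ℝ X v)) hab
  refine (WeakBilin.tendsto_iff_forall_eval_tendsto (topDualPairing ℝ X).flip h).trans ?_
  constructor
  · intro H y
    have := H (InnerProductSpace.toDual ℝ X y)
    simp only [real_inner_comm y]
    exact this
  · intro H φ
    obtain ⟨y, rfl⟩ := (InnerProductSpace.toDual ℝ X).surjective φ
    have := H y
    simp only [real_inner_comm y] at this
    exact this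

/-- Bounded sequences have weak limits along ultrafilters. -/
theorem exists_weak_limit_ultrafilter [CompleteSpace X] {z : ℕ → X} {C : ℝ} (hz : ∀ n, ‖z n‖ ≤ C)
    (U : Ultrafilter ℕ) :
    ∃ a, ∀ y, Tendsto (fun n => inner ℝ (z n) y) U (𝓝 (inner ℝ a y)) := by
  -- Banach-Alaoglu in the dual; the Riesz isomorphism carries the limit functional back to the
  -- space.
  have hc := WeakDual.isCompact_closedBall (𝕜 := ℝ) (E := X) 0 C
  obtain ⟨φ, -, hφ⟩ := hc.ultrafilter_le_nhds
    (U.map fun n => StrongDual.toWeakDual (InnerProductSpace.toDual ℝ X (z n))) (by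
      rw [Ultrafilter.coe_map, le_principal_iff, mem_map]
      refine Filter.mem_of_superset univ_mem fun n _ => ?_
      simpa using hz n)
  obtain ⟨a, ha⟩ := (InnerProductSpace.toDual ℝ X).surjective (WeakDual.toStrongDual φ)
  refine ⟨a, fun y => ?_⟩
  have h1 : Tendsto (fun n => StrongDual.toWeakDual (InnerProductSpace.toDual ℝ X (z n))) U
      (𝓝 φ) := hφ
  have h2 := ((WeakDual.eval_continuous y).tendsto φ).comp h1
  have h3 : φ y = inner ℝ a y := by
    rw [← InnerProductSpace.toDual_apply_apply, ha]; rfl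
  rw [h3] at h2
  exact h2

/-- Once an activation has occurred at a time where `b` is already close to `l`, each later value of
`a` is either inherited or a fresh, equally close value of `b`. -/
theorem tendsto_of_memory {a b : ℕ → ℝ} {l : ℝ} {τ : ℕ → ℝ}
    (h01 : ∀ n, τ n = 0 ∨ τ n = 1) (hinf : ∃ᶠ n in atTop, τ n = 1)
    (hrec : ∀ n, a (n + 1) = a n + τ n * (b n - a n)) (hb : Tendsto b atTop (𝓝 l)) :
    Tendsto a atTop (𝓝 l) := by
  rw [Metric.tendsto_atTop] at hb ⊢
  intro δ hδ
  obtain ⟨N, hN⟩ := hb δ hδ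
  obtain ⟨m, hm, hτ⟩ := (frequently_atTop.1 hinf) N
  refine ⟨m + 1, fun n hn => ?_⟩
  induction n, hn using Nat.le_induction with
  | base => rw [hrec, hτ]; simpa using hN m hm
  | succ n hn ih =>
    rcases h01 n with h | h
    · rw [hrec, h]; simpa using ih
    · rw [hrec, h]; simpa using hN n (by omega)

theorem ConvergesWeakly.of_memory [CompleteSpace X] {x s : ℕ → X} {l : X} {τ : ℕ → ℝ}
    (h01 : ∀ n, τ n = 0 ∨ τ n = 1) (hinf : ∃ᶠ n in atTop, τ n = 1)
    (hrec : ∀ n, x (n + 1) = x n + τ n • (s n - x n)) (hs : ConvergesWeakly s l) :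
    ConvergesWeakly x l := by
  rw [convergesWeakly_iff] at hs ⊢
  intro y
  refine tendsto_of_memory h01 hinf (fun n => ?_) (hs y)
  rw [hrec, inner_add_left, real_inner_smul_left, inner_sub_left]

theorem ConvergesWeakly.add [CompleteSpace X] {x y : ℕ → X} {a b : X}
    (hx : ConvergesWeakly x a) (hy : ConvergesWeakly y b) :
    ConvergesWeakly (fun n => x n + y n) (a + b) := by
  rw [convergesWeakly_iff] at *
  intro v
  simpa only [inner_add_left] using (hx v).add (hy v)

theorem ConvergesWeakly.map {Y : Type*} [NormedAddCommGroup Y] [InnerProductSpace ℝ Y]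
    [CompleteSpace X] [CompleteSpace Y] {x : ℕ → X} {a : X} (hx : ConvergesWeakly x a)
    (T : X →L[ℝ] Y) : ConvergesWeakly (fun n => T (x n)) (T a) := by
  rw [convergesWeakly_iff] at *
  intro v
  simpa only [ContinuousLinearMap.adjoint_inner_right] using hx (ContinuousLinearMap.adjoint T v)

end Weak

/-! ### Firm nonexpansiveness, cocoercivity and Opial's argument -/

section Cocoercive
variable {X : Type*} [NormedAddCommGroup X] [InnerProductSpace ℝ X]

/-- Firmly nonexpansive operators. -/
def FirmlyNonexpansive (J : X → X) : Prop :=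
  ∀ x y, ‖J x - J y‖ ^ 2 ≤ inner ℝ (J x - J y) (x - y)

theorem FirmlyNonexpansive.norm_sub_le {J : X → X} (hJ : FirmlyNonexpansive J) (x y : X) :
    ‖J x - J y‖ ≤ ‖x - y‖ := by
  have h1 := hJ x y
  have h2 := real_inner_le_norm (J x - J y) (x - y)
  by_contra! h
  nlinarith [norm_nonneg (x - y), norm_nonneg (J x - J y)]

theorem FirmlyNonexpansive.continuous {J : X → X} (hJ : FirmlyNonexpansive J) : Continuous J := by
  refine (LipschitzWith.of_dist_le_mul (K := 1) fun x y => ?_).continuous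
  simpa [dist_eq_norm] using hJ.norm_sub_le x y

theorem firmlyNonexpansive_starProjection [CompleteSpace X] (V : Submodule ℝ X)
    [V.HasOrthogonalProjection] : FirmlyNonexpansive V.starProjection := by
  intro x y
  rw [← map_sub]
  have := V.starProjection_inner_eq_zero (x - y) (V.starProjection (x - y))
    (V.starProjection_apply_mem _)
  rw [inner_sub_left, sub_eq_zero, real_inner_self_eq_norm_sq, real_inner_comm] at this
  exact this.ge

/-- The displacement `x ↦ J (2 P x - x) - P x` of the Douglas-Rachford operator. -/
def drDisplacement (J P : X → X) (x : X) : X := J ((2 : ℝ) • P x - x) - P x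

/-- Let `j` and `p` be the differences of the values of `J` and `P`. Firm nonexpansiveness of `J`
gives `‖j‖² ≤ 2⟨j, p⟩ - ⟨j, x - y⟩`, that of `P` gives `‖p‖² ≤ ⟨p, x - y⟩`, and the sum of the two
is the claim. -/
theorem drDisplacement_cocoercive {J P : X → X} (hJ : FirmlyNonexpansive J)
    (hP : FirmlyNonexpansive P) (x y : X) :
    ‖drDisplacement J P x - drDisplacement J P y‖ ^ 2 ≤
      -inner ℝ (drDisplacement J P x - drDisplacement J P y) (x - y) := by
  have h1 := hJ ((2 : ℝ) • P x - x) ((2 : ℝ) • P y - y)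
  have h2 := hP x y
  unfold drDisplacement
  set j := J ((2 : ℝ) • P x - x) - J ((2 : ℝ) • P y - y) with hj
  set p := P x - P y with hp
  have e1 : J ((2 : ℝ) • P x - x) - P x - (J ((2 : ℝ) • P y - y) - P y) = j - p := by
    rw [hj, hp]; abel
  have e2 : (2 : ℝ) • P x - x - ((2 : ℝ) • P y - y) = (2 : ℝ) • p - (x - y) := by
    rw [hp, smul_sub]; abel
  rw [e1, norm_sub_sq_real, inner_sub_left j p]
  rw [e2, inner_sub_right, real_inner_smul_right] at h1
  linarith

/-- Opial-type argument for the zeros of a cocoercive operator, for a renorming of the space. -/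
theorem exists_weak_limit_of_fejer [CompleteSpace X] {R : X → X}
    (hR : ∀ x y, ‖R x - R y‖ ^ 2 ≤ -inner ℝ (R x - R y) (x - y)) (S : X →L[ℝ] X)
    (hS : ∀ x, ‖x‖ ≤ ‖S x‖) {z : ℕ → X} (hz : Tendsto (fun n => R (z n)) atTop (𝓝 0))
    (hne : ∃ a, R a = 0)
    (hfejer : ∀ a, R a = 0 → ∃ l, Tendsto (fun n => ‖S (z n - a)‖) atTop (𝓝 l)) :
    ∃ a, R a = 0 ∧ ConvergesWeakly z a := by
  obtain ⟨C, hC⟩ : ∃ C, ∀ n, ‖z n‖ ≤ C := by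
    obtain ⟨a, ha⟩ := hne
    obtain ⟨l, hl⟩ := hfejer a ha
    obtain ⟨C, hC⟩ := hl.bddAbove_range
    refine ⟨C + ‖a‖, fun n => ?_⟩
    have h1 : ‖S (z n - a)‖ ≤ C := hC ⟨n, rfl⟩
    have h2 := hS (z n - a)
    have h3 := norm_le_norm_add_norm_sub' (z n) a
    linarith
  -- Demiclosedness. Along `U`, `R (z n) → 0` strongly while `z n - a` is bounded and tends weakly
  -- to `0`, so the right-hand side of the cocoercivity inequality for `z n` and `a` vanishes in the
  -- limit, leaving `‖R a‖² ≤ 0`.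
  have key : ∀ U : Ultrafilter ℕ, (U : Filter ℕ) ≤ atTop →
      ∃ a, R a = 0 ∧ ∀ y, Tendsto (fun n => inner ℝ (z n) y) U (𝓝 (inner ℝ a y)) := by
    intro U hU
    obtain ⟨a, ha⟩ := exists_weak_limit_ultrafilter hC U
    refine ⟨a, ?_, ha⟩
    have hzU := hz.mono_left hU
    have t1 : Tendsto (fun n => ‖R (z n) - R a‖ ^ 2) U (𝓝 (‖0 - R a‖ ^ 2)) :=
      ((hzU.sub_const _).norm).pow 2
    have t2 : Tendsto (fun n => inner ℝ (R (z n)) (z n - a)) U (𝓝 0) := by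
      refine squeeze_zero_norm (a := fun n => ‖R (z n)‖ * (C + ‖a‖)) (fun n => ?_) ?_
      · refine (norm_inner_le_norm _ _).trans ?_
        gcongr
        exact (norm_sub_le _ _).trans (by gcongr; exact hC n)
      · simpa using hzU.norm.mul_const (C + ‖a‖)
    have t3 : Tendsto (fun n => inner ℝ (R a) (z n - a)) U (𝓝 0) := by
      have := (ha (R a)).sub_const (inner ℝ a (R a))
      rw [sub_self] at this
      refine this.congr fun n => ?_
      rw [inner_sub_right, real_inner_comm (z n), real_inner_comm a]
    have t4 : Tendsto (fun n => -inner ℝ (R (z n) - R a) (z n - a)) U (𝓝 0) := by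
      have := (t2.sub t3).neg
      simpa only [inner_sub_left, sub_zero, neg_zero] using this
    have h0 := le_of_tendsto_of_tendsto' t1 t4 fun n => hR (z n) a
    rw [zero_sub, norm_neg] at h0
    exact norm_eq_zero.1 (pow_eq_zero_iff two_ne_zero |>.1 (le_antisymm h0 (by positivity)))
  obtain ⟨a, ha0, ha⟩ := key (Ultrafilter.of atTop) (Ultrafilter.of_le _)
  refine ⟨a, ha0, convergesWeakly_iff.2 fun y => tendsto_iff_ultrafilter _ _ _ |>.2 fun U hU => ?_⟩
  obtain ⟨b, hb0, hb⟩ := key U hU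
  suffices a = b by rw [this]; exact hb y
  obtain ⟨la, hla⟩ := hfejer a ha0
  obtain ⟨lb, hlb⟩ := hfejer b hb0
  -- Uniqueness of the cluster point. Up to a constant, `⟨z n, v⟩` is half of `‖S (z n - b)‖² - ‖S
  -- (z n - a)‖²`, so it converges. Hence `⟨a, v⟩ = ⟨b, v⟩`, that is, `‖S (a - b)‖² = 0`.
  set v := ContinuousLinearMap.adjoint S (S (a - b)) with hv
  have hinner : ∀ x, inner ℝ x v = inner ℝ (S x) (S (a - b)) := fun x => by
    rw [hv, ContinuousLinearMap.adjoint_inner_right]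
  have hconv : ∃ l, Tendsto (fun n => inner ℝ (z n) v) atTop (𝓝 l) := by
    refine ⟨_, ((((hlb.pow 2).sub (hla.pow 2)).const_mul (1 / 2)).add_const
      ((1 / 2) * (‖S a‖ ^ 2 - ‖S b‖ ^ 2))).congr fun n => ?_⟩
    rw [hinner, map_sub, map_sub, map_sub, norm_sub_sq_real, norm_sub_sq_real, inner_sub_right]
    ring
  obtain ⟨l, hl⟩ := hconv
  have e1 := tendsto_nhds_unique (ha v) (hl.mono_left (Ultrafilter.of_le _))
  have e2 := tendsto_nhds_unique (hb v) (hl.mono_left hU)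
  have e3 : inner ℝ (a - b) v = 0 := by rw [inner_sub_left, e1, e2, sub_self]
  rw [hinner, inner_self_eq_zero] at e3
  have := hS (a - b)
  rw [e3, norm_zero] at this
  exact sub_eq_zero.1 (norm_le_zero_iff.1 this)

end Cocoercive

/-! ### Block decompositions and the mean decrease of a random step -/

section Blocks
variable {X : Type*} [NormedAddCommGroup X] [InnerProductSpace ℝ X] {ι : Type*} [Fintype ι]

/-- A finite family of orthogonal projectors onto mutually orthogonal subspaces with sum the whole
space. -/
structure IsBlockDecomposition (pr : ι → X →L[ℝ] X) : Prop where
  sum_apply : ∀ x, ∑ i, pr i x = x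
  inner_eq_zero : ∀ i j x y, i ≠ j → inner ℝ (pr i x) (pr j y) = 0

/-- The operator that multiplies the block `i` by `τ i`. -/
def blockScale (pr : ι → X →L[ℝ] X) (τ : ι → ℝ) : X →L[ℝ] X := ∑ i, τ i • pr i

theorem blockScale_apply (pr : ι → X →L[ℝ] X) (τ : ι → ℝ) (x : X) :
    blockScale pr τ x = ∑ i, τ i • pr i x := by
  simp [blockScale]

namespace IsBlockDecomposition
variable {pr : ι → X →L[ℝ] X} (h : IsBlockDecomposition pr)
include h

/-- Expanding `x` into its blocks leaves only the `i`-th term. Self-adjointness and idempotence of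
the projectors follow from this, which is why the structure does not list them. -/
theorem inner_apply_right (i : ι) (x y : X) :
    inner ℝ x (pr i y) = inner ℝ (pr i x) (pr i y) := by
  classical
  conv_lhs => rw [← h.sum_apply x]
  rw [sum_inner, Finset.sum_eq_single i (fun j _ hj => h.inner_eq_zero _ _ _ _ hj) (by simp)]

theorem inner_apply_left (i : ι) (x y : X) :
    inner ℝ (pr i x) y = inner ℝ (pr i x) (pr i y) := by
  rw [real_inner_comm, h.inner_apply_right, real_inner_comm]

theorem apply_apply_of_ne {i j : ι} (hij : i ≠ j) (x : X) : pr i (pr j x) = 0 := by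
  refine ext_inner_right ℝ fun y => ?_
  rw [h.inner_apply_left, ← h.inner_apply_right, h.inner_eq_zero _ _ _ _ hij.symm, inner_zero_left]

theorem apply_apply_self (i : ι) (x : X) : pr i (pr i x) = pr i x := by
  classical
  conv_rhs => rw [← h.sum_apply x, map_sum]
  rw [Finset.sum_eq_single i (fun j _ hj => h.apply_apply_of_ne hj.symm x) (by simp)]

theorem apply_blockScale (τ : ι → ℝ) (i : ι) (x : X) :
    pr i (blockScale pr τ x) = τ i • pr i x := by
  classical
  rw [blockScale_apply, map_sum, Finset.sum_eq_single i, map_smul, h.apply_apply_self]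
  · intro j _ hj
    rw [map_smul, h.apply_apply_of_ne hj.symm, smul_zero]
  · simp

theorem inner_eq_sum (x y : X) : inner ℝ x y = ∑ i, inner ℝ (pr i x) (pr i y) := by
  conv_lhs => rw [← h.sum_apply y]
  rw [inner_sum]
  exact Finset.sum_congr rfl fun i _ => h.inner_apply_right i x y

theorem norm_sq_eq_sum (x : X) : ‖x‖ ^ 2 = ∑ i, ‖pr i x‖ ^ 2 := by
  simp only [← real_inner_self_eq_norm_sq]
  exact h.inner_eq_sum x x

theorem norm_sq_blockScale (τ : ι → ℝ) (x : X) :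
    ‖blockScale pr τ x‖ ^ 2 = ∑ i, τ i ^ 2 * ‖pr i x‖ ^ 2 := by
  rw [h.norm_sq_eq_sum]
  refine Finset.sum_congr rfl fun i _ => ?_
  rw [h.apply_blockScale, norm_smul, mul_pow, Real.norm_eq_abs, sq_abs]

theorem norm_blockScale_le {τ : ι → ℝ} {c : ℝ} (hc : 0 ≤ c) (hτ : ∀ i, |τ i| ≤ c) (x : X) :
    ‖blockScale pr τ x‖ ≤ c * ‖x‖ := by
  rw [← sq_le_sq₀ (norm_nonneg _) (by positivity), h.norm_sq_blockScale, mul_pow, h.norm_sq_eq_sum x,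
    Finset.mul_sum]
  refine Finset.sum_le_sum fun i _ => mul_le_mul_of_nonneg_right ?_ (by positivity)
  rw [← sq_abs]
  exact pow_le_pow_left₀ (abs_nonneg _) (hτ i) 2

theorem le_norm_blockScale {τ : ι → ℝ} (hτ : ∀ i, 1 ≤ τ i) (x : X) :
    ‖x‖ ≤ ‖blockScale pr τ x‖ := by
  rw [← sq_le_sq₀ (norm_nonneg _) (norm_nonneg _), h.norm_sq_blockScale, h.norm_sq_eq_sum]
  refine Finset.sum_le_sum fun i _ => le_mul_of_one_le_left (by positivity) ?_
  exact one_le_pow₀ (hτ i)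

/-- Mean square decrease of a randomly activated relaxed step in the weighted norm. -/
theorem sum_norm_sq_step_le {A : Type*} [Fintype A] {π : A → ℝ} {act : A → ι → ℝ} {q : ι → ℝ}
    (hπ1 : ∑ e, π e = 1) (hact : ∀ e i, act e i = 0 ∨ act e i = 1)
    (hq : ∀ i, ∑ e, π e * act e i = q i) (hq0 : ∀ i, 0 < q i) {lam : ℝ} (hlam0 : 0 ≤ lam)
    {x r : X} (hxr : ‖r‖ ^ 2 ≤ -inner ℝ r x) :
    ∑ e, π e * ‖blockScale pr (fun i => (√(q i))⁻¹)
        (x + blockScale pr (fun i => act e i * lam) r)‖ ^ 2 ≤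
      ‖blockScale pr (fun i => (√(q i))⁻¹) x‖ ^ 2 - lam * (2 - lam) * ‖r‖ ^ 2 := by
  have hτ : ∀ i, ((√(q i))⁻¹) ^ 2 = (q i)⁻¹ := fun i => by
    rw [inv_pow, Real.sq_sqrt (hq0 i).le]
  -- Since `act e i` is `0` or `1`, it equals its square, so the quadratic term is also linear in
  -- `act e i`. Averaging over `e` then produces the factor `q i`, which cancels the weight `(q
  -- i)⁻¹`.
  have hterm : ∀ e i, π e * ((q i)⁻¹ * ‖pr i (x + blockScale pr (fun i => act e i * lam) r)‖ ^ 2) =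
      π e * ((q i)⁻¹ * ‖pr i x‖ ^ 2) + (q i)⁻¹ * (π e * act e i) *
        (2 * lam * inner ℝ (pr i r) (pr i x) + lam ^ 2 * ‖pr i r‖ ^ 2) := by
    intro e i
    rw [map_add, h.apply_blockScale, norm_add_sq_real, real_inner_smul_right, norm_smul, mul_pow,
      Real.norm_eq_abs, sq_abs, real_inner_comm (pr i x)]
    rcases hact e i with h0 | h0 <;> rw [h0] <;> ring
  have hsum : ∑ e, π e * ‖blockScale pr (fun i => (√(q i))⁻¹)
        (x + blockScale pr (fun i => act e i * lam) r)‖ ^ 2 =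
      ∑ i, ((q i)⁻¹ * ‖pr i x‖ ^ 2 +
        (2 * lam * inner ℝ (pr i r) (pr i x) + lam ^ 2 * ‖pr i r‖ ^ 2)) := by
    simp only [h.norm_sq_blockScale, hτ, Finset.mul_sum]
    rw [Finset.sum_comm]
    refine Finset.sum_congr rfl fun i _ => ?_
    simp only [hterm]
    rw [Finset.sum_add_distrib, ← Finset.sum_mul, hπ1, one_mul, ← Finset.sum_mul,
      ← Finset.mul_sum, hq, inv_mul_cancel₀ (hq0 i).ne', one_mul]
  rw [hsum, Finset.sum_add_distrib, Finset.sum_add_distrib, ← Finset.mul_sum, ← Finset.mul_sum,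
    ← h.inner_eq_sum, ← h.norm_sq_eq_sum, h.norm_sq_blockScale]
  simp only [hτ]
  -- By `hxr`, `2 λ ⟨r, x⟩ + λ² ‖r‖² ≤ -λ (2 - λ) ‖r‖²`.
  nlinarith

/-- The unsquared version, needed because the errors are controlled in norm. With `m` the mean norm
after the step, `D` the norm before it and `b` the squared decrease, Jensen gives `m² ≤ D² - b`, and
`2 D m ≤ D² + m²` then gives `m + b / (2 D) ≤ D`. If `D = 0`, the quotient is `0` by convention and
`m = 0`. -/
theorem sum_norm_step_add_le {A : Type*} [Fintype A] {π : A → ℝ} {act : A → ι → ℝ} {q : ι → ℝ}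
    (hπ0 : ∀ e, 0 ≤ π e) (hπ1 : ∑ e, π e = 1) (hact : ∀ e i, act e i = 0 ∨ act e i = 1)
    (hq : ∀ i, ∑ e, π e * act e i = q i) (hq0 : ∀ i, 0 < q i) {lam : ℝ} (hlam0 : 0 ≤ lam)
    (hlam2 : lam ≤ 2) {x r : X} (hxr : ‖r‖ ^ 2 ≤ -inner ℝ r x) :
    ∑ e, π e * ‖blockScale pr (fun i => (√(q i))⁻¹)
        (x + blockScale pr (fun i => act e i * lam) r)‖ +
      lam * (2 - lam) * ‖r‖ ^ 2 / (2 * ‖blockScale pr (fun i => (√(q i))⁻¹) x‖) ≤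
      ‖blockScale pr (fun i => (√(q i))⁻¹) x‖ := by
  have h1 := h.sum_norm_sq_step_le hπ1 hact hq hq0 hlam0 hxr
  have h2 := Real.pow_arith_mean_le_arith_mean_pow Finset.univ π
    (fun e => ‖blockScale pr (fun i => (√(q i))⁻¹)
        (x + blockScale pr (fun i => act e i * lam) r)‖) (fun e _ => hπ0 e) hπ1
        (fun e _ => norm_nonneg _) 2
  have hm0 : 0 ≤ ∑ e, π e * ‖blockScale pr (fun i => (√(q i))⁻¹)
        (x + blockScale pr (fun i => act e i * lam) r)‖ :=
    Finset.sum_nonneg fun e _ => mul_nonneg (hπ0 e) (norm_nonneg _)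
  have h3 := h2.trans h1
  set m := ∑ e, π e * ‖blockScale pr (fun i => (√(q i))⁻¹)
        (x + blockScale pr (fun i => act e i * lam) r)‖
  set D := ‖blockScale pr (fun i => (√(q i))⁻¹) x‖
  have hD0 : 0 ≤ D := norm_nonneg _
  have hb : 0 ≤ lam * (2 - lam) * ‖r‖ ^ 2 :=
    mul_nonneg (mul_nonneg hlam0 (by linarith)) (by positivity)
  set b := lam * (2 - lam) * ‖r‖ ^ 2
  rcases hD0.eq_or_lt with hD | hD
  · rw [← hD] at h3 ⊢
    simp only [mul_zero, div_zero, add_zero]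
    nlinarith
  · rw [← le_sub_iff_add_le', div_le_iff₀ (by positivity)]
    nlinarith [sq_nonneg (D - m)]

end IsBlockDecomposition

theorem isBlockDecomposition_id :
    IsBlockDecomposition fun _ : Unit => ContinuousLinearMap.id ℝ X where
  sum_apply := by simp
  inner_eq_zero := by simp

section Pi
variable {p : ℕ} {G : Fin p → Type*} [∀ k, NormedAddCommGroup (G k)]
  [∀ k, InnerProductSpace ℝ (G k)]

/-- The projectors of a Hilbert direct sum onto its summands. -/
def piBlock (k : Fin p) : PiLp 2 G →L[ℝ] PiLp 2 G :=
  (PiLp.continuousLinearEquiv 2 ℝ G).symm.toContinuousLinearMap ∘L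
    (ContinuousLinearMap.single ℝ G k ∘L ContinuousLinearMap.proj k) ∘L
      (PiLp.continuousLinearEquiv 2 ℝ G).toContinuousLinearMap

theorem piBlock_apply (k : Fin p) (x : PiLp 2 G) (j : Fin p) :
    piBlock k x j = (Pi.single k (x k) : ∀ j, G j) j := rfl

theorem isBlockDecomposition_piBlock : IsBlockDecomposition (piBlock (G := G)) where
  sum_apply x := by
    ext j
    rw [WithLp.ofLp_sum, Finset.sum_apply]
    simp only [piBlock_apply]
    rw [← Finset.sum_apply, Finset.univ_sum_single]
  inner_eq_zero i j x y hij := by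
    rw [PiLp.inner_apply]
    refine Finset.sum_eq_zero fun k _ => ?_
    simp only [piBlock_apply]
    by_cases hk : k = i
    · subst hk
      rw [Pi.single_eq_of_ne hij, inner_zero_right]
    · rw [Pi.single_eq_of_ne hk, inner_zero_left]

theorem blockScale_piBlock_apply (τ : Fin p → ℝ) (x : PiLp 2 G) (k : Fin p) :
    blockScale piBlock τ x k = τ k • x k := by
  have := isBlockDecomposition_piBlock.apply_blockScale τ k x
  have h2 := congrArg (fun v : PiLp 2 G => v k) this
  simpa [piBlock_apply] using h2

end Pi

section Prod
variable {Y : Type*} [NormedAddCommGroup Y] [InnerProductSpace ℝ Y] {κ : Type*} [Fintype κ]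

/-- The blocks of a direct sum of two spaces with given blocks. -/
def prodBlock (pr : ι → X →L[ℝ] X) (pr' : κ → Y →L[ℝ] Y) :
    ι ⊕ κ → WithLp 2 (X × Y) →L[ℝ] WithLp 2 (X × Y) := fun i =>
  (WithLp.prodContinuousLinearEquiv 2 ℝ X Y).symm.toContinuousLinearMap ∘L
    (Sum.elim (fun i => (pr i).prodMap 0) (fun j => (0 : X →L[ℝ] X).prodMap (pr' j)) i) ∘L
      (WithLp.prodContinuousLinearEquiv 2 ℝ X Y).toContinuousLinearMap

omit [Fintype ι] [Fintype κ] in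
theorem prodBlock_inl (pr : ι → X →L[ℝ] X) (pr' : κ → Y →L[ℝ] Y) (i : ι) (x : WithLp 2 (X × Y)) :
    prodBlock pr pr' (Sum.inl i) x = WithLp.toLp 2 (pr i x.fst, 0) := rfl

omit [Fintype ι] [Fintype κ] in
theorem prodBlock_inr (pr : ι → X →L[ℝ] X) (pr' : κ → Y →L[ℝ] Y) (i : κ) (x : WithLp 2 (X × Y)) :
    prodBlock pr pr' (Sum.inr i) x = WithLp.toLp 2 (0, pr' i x.snd) := rfl

theorem blockScale_prodBlock (pr : ι → X →L[ℝ] X) (pr' : κ → Y →L[ℝ] Y) (τ : ι ⊕ κ → ℝ)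
    (x : WithLp 2 (X × Y)) :
    blockScale (prodBlock pr pr') τ x = WithLp.toLp 2
      (blockScale pr (τ ∘ Sum.inl) x.fst, blockScale pr' (τ ∘ Sum.inr) x.snd) := by
  simp only [blockScale_apply, Fintype.sum_sum_type, prodBlock_inl, prodBlock_inr,
    ← WithLp.toLp_smul, ← WithLp.toLp_sum]
  congr 1
  ext <;> simp [Prod.fst_sum, Prod.snd_sum]

theorem IsBlockDecomposition.prod {pr : ι → X →L[ℝ] X} {pr' : κ → Y →L[ℝ] Y}
    (h : IsBlockDecomposition pr) (h' : IsBlockDecomposition pr') :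
    IsBlockDecomposition (prodBlock pr pr') where
  sum_apply x := by
    have h1 := blockScale_prodBlock pr pr' (fun _ => 1) x
    simp only [blockScale_apply, one_smul, Function.comp_apply, h.sum_apply, h'.sum_apply] at h1
    exact h1
  inner_eq_zero i j x y hij := by
    rcases i with i | i <;> rcases j with j | j <;>
      simp only [prodBlock_inl, prodBlock_inr, WithLp.prod_inner_apply, inner_zero_left,
        inner_zero_right, add_zero, zero_add]
    · exact h.inner_eq_zero _ _ _ _ (by simpa using hij)
    · exact h'.inner_eq_zero _ _ _ _ (by simpa using hij)

/-- The direct sum of two operators. -/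
def prodOp (J : X → X) (J' : Y → Y) (x : WithLp 2 (X × Y)) : WithLp 2 (X × Y) :=
  WithLp.toLp 2 (J x.fst, J' x.snd)

theorem FirmlyNonexpansive.prod {J : X → X} {J' : Y → Y} (h : FirmlyNonexpansive J)
    (h' : FirmlyNonexpansive J') : FirmlyNonexpansive (prodOp J J') := by
  intro x y
  rw [WithLp.prod_norm_sq_eq_of_L2, WithLp.prod_inner_apply]
  exact add_le_add (h _ _) (h' _ _)

theorem FirmlyNonexpansive.pi {p : ℕ} {G : Fin p → Type*} [∀ k, NormedAddCommGroup (G k)]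
    [∀ k, InnerProductSpace ℝ (G k)] {J : ∀ k, G k → G k} (h : ∀ k, FirmlyNonexpansive (J k)) :
    FirmlyNonexpansive fun x : PiLp 2 G => WithLp.toLp 2 fun k => J k (x k) := by
  intro x y
  rw [PiLp.norm_sq_eq_of_L2, PiLp.inner_apply]
  exact Finset.sum_le_sum fun k _ => h k _ _

end Prod
end Blocks

/-! ### Subdifferentials and proximity operators -/

section Prox
variable {E : Type*} [NormedAddCommGroup E] [InnerProductSpace ℝ E] {f : E → EReal}

theorem IsGammaZero.coe_toReal (hf : IsGammaZero f) {x : E} (hx : f x ≠ ⊤) :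
    ((f x).toReal : EReal) = f x := EReal.coe_toReal hx (hf.ne_bot x)

theorem IsGammaZero.toReal_le_of_le (hf : IsGammaZero f) {x : E} {c : ℝ} (h : f x ≤ c) :
    f x ≠ ⊤ ∧ (f x).toReal ≤ c := by
  have hx : f x ≠ ⊤ := ne_top_of_le_ne_top (EReal.coe_ne_top c) h
  refine ⟨hx, ?_⟩
  rwa [← hf.coe_toReal hx, EReal.coe_le_coe_iff] at h

theorem IsGammaZero.ne_top_of_mem_subdiff (hf : IsGammaZero f) {x u : E} (hu : u ∈ subdiff f x) :
    f x ≠ ⊤ := by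
  intro hx
  obtain ⟨z, hz⟩ := hf.proper
  have := hu z
  rw [hx, EReal.coe_add_top, top_le_iff] at this
  exact hz this

theorem IsGammaZero.le_toReal_of_mem_subdiff (hf : IsGammaZero f) {x u : E}
    (hu : u ∈ subdiff f x) {z : E} (hz : f z ≠ ⊤) :
    inner ℝ (z - x) u + (f x).toReal ≤ (f z).toReal := by
  have := hu z
  rw [← hf.coe_toReal hz, ← hf.coe_toReal (hf.ne_top_of_mem_subdiff hu)] at this
  exact_mod_cast this

theorem IsGammaZero.mem_subdiff_of_forall (hf : IsGammaZero f) {x u : E} (hx : f x ≠ ⊤)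
    (h : ∀ z, f z ≠ ⊤ → inner ℝ (z - x) u + (f x).toReal ≤ (f z).toReal) : u ∈ subdiff f x := by
  intro z
  by_cases hz : f z = ⊤
  · rw [hz]; exact le_top
  · rw [← hf.coe_toReal hz, ← hf.coe_toReal hx]
    exact_mod_cast h z hz

theorem IsGammaZero.convex_toReal (hf : IsGammaZero f) {x y : E} (hx : f x ≠ ⊤) (hy : f y ≠ ⊤)
    {a : ℝ} (ha0 : 0 < a) (ha1 : a < 1) :
    f (a • x + (1 - a) • y) ≠ ⊤ ∧
      (f (a • x + (1 - a) • y)).toReal ≤ a * (f x).toReal + (1 - a) * (f y).toReal := by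
  refine hf.toReal_le_of_le ((hf.convex x y a ha0 ha1).trans_eq ?_)
  rw [← hf.coe_toReal hx, ← hf.coe_toReal hy]
  push_cast
  rfl

theorem IsGammaZero.subdiff_monotone (hf : IsGammaZero f) {x y u v : E} (hu : u ∈ subdiff f x)
    (hv : v ∈ subdiff f y) : 0 ≤ inner ℝ (x - y) (u - v) := by
  have h1 := hf.le_toReal_of_mem_subdiff hu (hf.ne_top_of_mem_subdiff hv)
  have h2 := hf.le_toReal_of_mem_subdiff hv (hf.ne_top_of_mem_subdiff hu)
  rw [← neg_sub x y, inner_neg_left] at h1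
  rw [inner_sub_right]
  linarith

/-- A proper lower semicontinuous convex function plus half the squared distance to a point has a
minimizer as soon as the function has a continuous affine minorant. -/
theorem IsGammaZero.exists_sub_mem_subdiff [CompleteSpace E] (hf : IsGammaZero f)
    (hsub : ∃ x, (subdiff f x).Nonempty) (x : E) : ∃ q, x - q ∈ subdiff f q := by
  obtain ⟨xb, u, hu⟩ := hsub
  set V : E → ℝ := fun z => (f z).toReal + ‖x - z‖ ^ 2 / 2 with hV
  set I : Set ℝ := V '' {z | f z ≠ ⊤} with hI
  have hIne : I.Nonempty := (show {z | f z ≠ ⊤}.Nonempty from hf.proper).image V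
  -- The affine minorant given by the subgradient `u`, plus the quadratic term, is bounded below by
  -- completing the square `‖x - z - u‖²`.
  have hbdd : BddBelow I := by
    refine ⟨(f xb).toReal + inner ℝ (x - xb) u - ‖u‖ ^ 2 / 2, ?_⟩
    rintro _ ⟨z, hz, rfl⟩
    have h1 := hf.le_toReal_of_mem_subdiff hu hz
    have h2 : z - xb = (x - xb) - (x - z) := by abel
    rw [h2, inner_sub_left] at h1
    have h3 := norm_sub_sq_real (x - z) u
    have h4 := sq_nonneg ‖x - z - u‖
    simp only [hV]
    linarith
  have hm : ∀ z, f z ≠ ⊤ → sInf I ≤ V z := fun z hz => csInf_le hbdd ⟨z, hz, rfl⟩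
  set m := sInf I with hm_def
  have hseq : ∀ n : ℕ, ∃ z, f z ≠ ⊤ ∧ V z < m + 1 / ((n : ℝ) + 1) := by
    intro n
    obtain ⟨_, ⟨z, hz, rfl⟩, h⟩ := exists_lt_of_csInf_lt hIne
      (show sInf I < m + 1 / ((n : ℝ) + 1) by
        rw [← hm_def]
        linarith [Nat.one_div_pos_of_nat (α := ℝ) (n := n)])
    exact ⟨z, hz, h⟩
  choose z hz hVz using hseq
  -- Convexity at the midpoint together with the parallelogram identity; this makes the minimizing
  -- sequence `z` Cauchy.
  have hpar : ∀ a b, f a ≠ ⊤ → f b ≠ ⊤ → ‖a - b‖ ^ 2 ≤ 4 * ((V a - m) + (V b - m)) := by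
    intro a b ha hb
    obtain ⟨h1, h2⟩ := hf.convex_toReal ha hb (a := 1 / 2) (by norm_num) (by norm_num)
    have h3 := hm _ h1
    have h4 : x - ((1 / 2 : ℝ) • a + (1 - 1 / 2 : ℝ) • b) =
        (1 / 2 : ℝ) • ((x - a) + (x - b)) := by module
    have h5 : a - b = (x - b) - (x - a) := by abel
    simp only [hV] at h3 ⊢
    rw [h4, norm_smul, mul_pow, norm_add_sq_real] at h3
    rw [h5, norm_sub_sq_real, real_inner_comm]
    norm_num at h3 h2
    linarith
  have hzero : Tendsto (fun n : ℕ => 1 / ((n : ℝ) + 1)) atTop (𝓝 0) :=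
    tendsto_one_div_add_atTop_nhds_zero_nat
  have hcauchy : CauchySeq z := by
    rw [Metric.cauchySeq_iff']
    intro δ hδ
    have := hzero.eventually (gt_mem_nhds (show (0 : ℝ) < δ ^ 2 / 8 by positivity))
    obtain ⟨N, hN⟩ := eventually_atTop.1 this
    refine ⟨N, fun n hn => ?_⟩
    have h1 := hpar _ _ (hz n) (hz N)
    have h2 := hN n hn
    have h3 := hN N le_rfl
    rw [dist_eq_norm]
    refine lt_of_pow_lt_pow_left₀ 2 hδ.le ?_
    linarith [hVz n, hVz N]
  obtain ⟨q, hq⟩ := cauchySeq_tendsto_of_complete hcauchy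
  have hlim : Tendsto (fun n : ℕ => m + 1 / ((n : ℝ) + 1) - ‖x - z n‖ ^ 2 / 2) atTop
      (𝓝 (m - ‖x - q‖ ^ 2 / 2)) := by
    have := (hzero.const_add m).sub (((hq.const_sub x).norm.pow 2).div_const 2)
    simpa using this
  have hfq : f q ≤ ((m - ‖x - q‖ ^ 2 / 2 : ℝ) : EReal) := by
    refine le_of_forall_lt fun c hc => ?_
    obtain ⟨c', hc1, hc2⟩ := EReal.exists_between_coe_real hc
    refine hc1.trans_le (EReal.coe_le_coe_iff.2 (ge_of_tendsto hlim ?_))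
    filter_upwards [hq.eventually (hf.lsc q _ hc2)] with n hn
    rw [← hf.coe_toReal (hz n), gt_iff_lt, EReal.coe_lt_coe_iff] at hn
    have := hVz n
    simp only [hV] at this
    linarith
  obtain ⟨hq1, hq2⟩ := hf.toReal_le_of_le hfq
  refine ⟨q, hf.mem_subdiff_of_forall hq1 fun y hy => ?_⟩
  -- Optimality of `q` is tested at the point `t • y + (1 - t) • q` of the segment towards `y`.
  -- After division by `t`, the remainder vanishes as `t` tends to `0` and the subgradient
  -- inequality is left.
  have hstep : ∀ t : ℝ, 0 < t → t < 1 →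
      inner ℝ (y - q) (x - q) + (f q).toReal ≤ (f y).toReal + t * (‖y - q‖ ^ 2 / 2) := by
    intro t ht0 ht1
    obtain ⟨h1, h2⟩ := hf.convex_toReal hy hq1 ht0 ht1
    have h3 := hm _ h1
    have h4 : x - (t • y + (1 - t) • q) = (x - q) - t • (y - q) := by module
    simp only [hV] at h3
    rw [h4, norm_sub_sq_real, real_inner_smul_right, norm_smul, mul_pow, Real.norm_eq_abs, sq_abs,
      real_inner_comm] at h3
    refine le_of_mul_le_mul_left ?_ ht0
    linarith
  have hlim2 : Tendsto (fun t : ℝ => (f y).toReal + t * (‖y - q‖ ^ 2 / 2)) (𝓝[>] 0)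
      (𝓝 ((f y).toReal)) := by
    have : Tendsto (fun t : ℝ => (f y).toReal + t * (‖y - q‖ ^ 2 / 2)) (𝓝 0)
      (𝓝 ((f y).toReal + 0 * (‖y - q‖ ^ 2 / 2))) := by
      exact Continuous.tendsto (by fun_prop) 0
    rw [zero_mul, add_zero] at this
    exact this.mono_left nhdsWithin_le_nhds
  refine ge_of_tendsto hlim2 ?_
  filter_upwards [Ioo_mem_nhdsGT (zero_lt_one (α := ℝ))] with t ht
  exact hstep t ht.1 ht.2

/-- The subgradient inequality makes the objective at `z` exceed its value at `q` by at least `‖z -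
q‖² / 2`. So `q` is a minimizer, and whichever minimizer `Classical.epsilon` picks must coincide
with it. -/
theorem IsGammaZero.prox_eq (hf : IsGammaZero f) {x q : E} (hq : x - q ∈ subdiff f q) :
    prox f x = q := by
  have hq1 := hf.ne_top_of_mem_subdiff hq
  have hval : ∀ z, f z ≠ ⊤ → (f q).toReal + ‖x - q‖ ^ 2 / 2 + ‖z - q‖ ^ 2 / 2 ≤
      (f z).toReal + ‖x - z‖ ^ 2 / 2 := by
    intro z hz
    have h1 := hf.le_toReal_of_mem_subdiff hq hz
    have h2 : x - z = (x - q) - (z - q) := by abel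
    rw [h2, norm_sub_sq_real (x - q), real_inner_comm]
    linarith
  have hmem : q ∈ argminSet fun z => f z + ((‖x - z‖ ^ 2 / 2 : ℝ) : EReal) := by
    intro z
    by_cases hz : f z = ⊤
    · simp [hz]
    · simp only
      rw [← hf.coe_toReal hz, ← hf.coe_toReal hq1]
      have := hval z hz
      exact_mod_cast (by linarith [sq_nonneg ‖z - q‖] :
        (f q).toReal + ‖x - q‖ ^ 2 / 2 ≤ (f z).toReal + ‖x - z‖ ^ 2 / 2)
  have hprox : prox f x ∈ argminSet fun z => f z + ((‖x - z‖ ^ 2 / 2 : ℝ) : EReal) :=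
    Classical.epsilon_spec (p := fun q => q ∈ argminSet fun z =>
      f z + ((‖x - z‖ ^ 2 / 2 : ℝ) : EReal)) ⟨q, hmem⟩
  have h1 := hprox q
  simp only at h1
  have htop : f (prox f x) ≠ ⊤ := by
    intro h
    rw [h, EReal.top_add_coe, ← hf.coe_toReal hq1, ← EReal.coe_add, top_le_iff] at h1
    exact EReal.coe_ne_top _ h1
  have h2 := hval _ htop
  rw [← hf.coe_toReal htop, ← hf.coe_toReal hq1] at h1
  have h3 : (f (prox f x)).toReal + ‖x - prox f x‖ ^ 2 / 2 ≤ (f q).toReal + ‖x - q‖ ^ 2 / 2 := by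
    exact_mod_cast h1
  have h4 : ‖prox f x - q‖ ^ 2 = 0 := le_antisymm (by linarith) (sq_nonneg _)
  exact sub_eq_zero.1 (norm_eq_zero.1 (pow_eq_zero_iff two_ne_zero |>.1 h4))

theorem IsGammaZero.sub_prox_mem_subdiff [CompleteSpace E] (hf : IsGammaZero f)
    (hsub : ∃ x, (subdiff f x).Nonempty) (x : E) : x - prox f x ∈ subdiff f (prox f x) := by
  obtain ⟨q, hq⟩ := hf.exists_sub_mem_subdiff hsub x
  rwa [hf.prox_eq hq]

theorem IsGammaZero.firmlyNonexpansive_prox [CompleteSpace E] (hf : IsGammaZero f)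
    (hsub : ∃ x, (subdiff f x).Nonempty) : FirmlyNonexpansive (prox f) := by
  intro x y
  have h := hf.subdiff_monotone (hf.sub_prox_mem_subdiff hsub x) (hf.sub_prox_mem_subdiff hsub y)
  have e : x - prox f x - (y - prox f y) = (x - y) - (prox f x - prox f y) := by abel
  rw [e, inner_sub_right, real_inner_self_eq_norm_sq] at h
  linarith

theorem IsGammaZero.scaled (hf : IsGammaZero f) {γ : ℝ} (hγ : 0 < γ) :
    IsGammaZero (scaled γ f) where
  lsc := by
    have hmono : Monotone fun r : EReal => (γ : EReal) * r := fun a b hab =>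
      mul_le_mul_of_nonneg_left hab (EReal.coe_nonneg.2 hγ.le)
    have hcont : Continuous fun r : EReal => (γ : EReal) * r :=
      continuous_iff_continuousAt.2 fun r =>
        (EReal.continuousAt_mul (p := ((γ : EReal), r)) (Or.inl (EReal.coe_ne_zero.2 hγ.ne'))
          (Or.inl (EReal.coe_ne_zero.2 hγ.ne')) (Or.inl (EReal.coe_ne_bot _))
          (Or.inl (EReal.coe_ne_top _))).comp (Continuous.prodMk_right _).continuousAt
    exact hcont.comp_lowerSemicontinuous hf.lsc hmono
  ne_bot x := by
    by_cases hx : f x = ⊤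
    · simp [_root_.scaled, hx, EReal.coe_mul_top_of_pos hγ]
    · simp only [_root_.scaled]
      rw [← hf.coe_toReal hx, ← EReal.coe_mul]
      exact EReal.coe_ne_bot _
  proper := by
    obtain ⟨x, hx⟩ := hf.proper
    refine ⟨x, ?_⟩
    simp only [_root_.scaled]
    rw [← hf.coe_toReal hx, ← EReal.coe_mul]
    exact EReal.coe_ne_top _
  convex x y a ha0 ha1 := by
    simp only [_root_.scaled]
    by_cases hx : f x = ⊤
    · by_cases hy : f y = ⊤
      · rw [hx, hy, EReal.coe_mul_top_of_pos hγ, EReal.coe_mul_top_of_pos ha0,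
          EReal.coe_mul_top_of_pos (sub_pos.2 ha1), EReal.top_add_top]
        exact le_top
      · rw [hx, ← hf.coe_toReal hy, EReal.coe_mul_top_of_pos hγ, EReal.coe_mul_top_of_pos ha0,
          ← EReal.coe_mul, ← EReal.coe_mul, EReal.top_add_coe]
        exact le_top
    · by_cases hy : f y = ⊤
      · rw [hy, ← hf.coe_toReal hx, EReal.coe_mul_top_of_pos hγ,
          EReal.coe_mul_top_of_pos (sub_pos.2 ha1), ← EReal.coe_mul, ← EReal.coe_mul,
          EReal.coe_add_top]
        exact le_top
      · obtain ⟨h1, h2⟩ := hf.convex_toReal hx hy ha0 ha1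
        rw [← hf.coe_toReal hx, ← hf.coe_toReal hy, ← hf.coe_toReal h1]
        have : γ * (f (a • x + (1 - a) • y)).toReal ≤
            a * (γ * (f x).toReal) + (1 - a) * (γ * (f y).toReal) := by
          nlinarith
        exact_mod_cast this

theorem IsGammaZero.mem_subdiff_scaled_iff (hf : IsGammaZero f) {γ : ℝ} (hγ : 0 < γ) {x u : E} :
    γ • u ∈ subdiff (_root_.scaled γ f) x ↔ u ∈ subdiff f x := by
  have hfs := hf.scaled hγ
  have htop : ∀ z, _root_.scaled γ f z ≠ ⊤ ↔ f z ≠ ⊤ := fun z => by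
    by_cases hz : f z = ⊤
    · simp [_root_.scaled, hz, EReal.coe_mul_top_of_pos hγ]
    · simp only [_root_.scaled]
      rw [← hf.coe_toReal hz, ← EReal.coe_mul]
      exact iff_of_true (EReal.coe_ne_top _) (EReal.coe_ne_top _)
  have hval : ∀ z, (_root_.scaled γ f z).toReal = γ * (f z).toReal := fun z => by
    simp [_root_.scaled, EReal.toReal_mul]
  constructor
  · intro h
    refine hf.mem_subdiff_of_forall ((htop x).1 (hfs.ne_top_of_mem_subdiff h)) fun z hz => ?_
    have := hfs.le_toReal_of_mem_subdiff h ((htop z).2 hz)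
    rw [hval, hval, real_inner_smul_right] at this
    exact le_of_mul_le_mul_left (by linarith) hγ
  · intro h
    refine hfs.mem_subdiff_of_forall ((htop x).2 (hf.ne_top_of_mem_subdiff h)) fun z hz => ?_
    have := hf.le_toReal_of_mem_subdiff h ((htop z).1 hz)
    rw [hval, hval, real_inner_smul_right]
    nlinarith

/-- Scaled version of the characterization of the proximity operator. -/
theorem IsGammaZero.prox_scaled_eq_iff [CompleteSpace E] (hf : IsGammaZero f)
    (hsub : ∃ x, (subdiff f x).Nonempty) {γ : ℝ} (hγ : 0 < γ) {x q : E} :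
    prox (_root_.scaled γ f) x = q ↔ γ⁻¹ • (x - q) ∈ subdiff f q := by
  have hsub' : ∃ x, (subdiff (_root_.scaled γ f) x).Nonempty := by
    obtain ⟨x, u, hu⟩ := hsub
    exact ⟨x, γ • u, (hf.mem_subdiff_scaled_iff hγ).2 hu⟩
  rw [← hf.mem_subdiff_scaled_iff hγ, smul_inv_smul₀ hγ.ne']
  constructor
  · rintro rfl
    exact (hf.scaled hγ).sub_prox_mem_subdiff hsub' x
  · exact (hf.scaled hγ).prox_eq

theorem IsGammaZero.firmlyNonexpansive_prox_scaled [CompleteSpace E] (hf : IsGammaZero f)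
    (hsub : ∃ x, (subdiff f x).Nonempty) {γ : ℝ} (hγ : 0 < γ) :
    FirmlyNonexpansive (prox (_root_.scaled γ f)) := by
  obtain ⟨x, u, hu⟩ := hsub
  exact (hf.scaled hγ).firmlyNonexpansive_prox ⟨x, γ • u, (hf.mem_subdiff_scaled_iff hγ).2 hu⟩

end Prox

/-! ### Conditional summability, independence and nonnegative supermartingales -/

section Probability
variable {Ω : Type*} [mΩ : MeasurableSpace Ω] {P : Measure Ω}

/-- `∑ₙ E(φ n | 𝓢 n) < ∞` almost surely, up to a domination of the conditional expectations. -/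
def CondSummable (P : Measure Ω) (𝓢 : ℕ → MeasurableSpace Ω) (φ : ℕ → Ω → ℝ≥0∞) : Prop :=
  ∃ η : ℕ → Ω → ℝ≥0∞, (∀ n, Measurable[𝓢 n] (η n)) ∧ (∀ᵐ ω ∂P, ∑' n, η n ω < ∞) ∧
    ∀ n s, MeasurableSet[𝓢 n] s → ∫⁻ ω in s, φ n ω ∂P ≤ ∫⁻ ω in s, η n ω ∂P

theorem CondSummable.mono {𝓢 : ℕ → MeasurableSpace Ω} {φ ψ : ℕ → Ω → ℝ≥0∞}
    (h : CondSummable P 𝓢 φ) (hle : ∀ n ω, ψ n ω ≤ φ n ω) : CondSummable P 𝓢 ψ := by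
  obtain ⟨η, h1, h2, h3⟩ := h
  exact ⟨η, h1, h2, fun n s hs => (lintegral_mono fun ω => hle n ω).trans (h3 n s hs)⟩

theorem CondSummable.add {𝓢 : ℕ → MeasurableSpace Ω} (h𝓢 : ∀ n, 𝓢 n ≤ mΩ)
    {φ ψ : ℕ → Ω → ℝ≥0∞} (hφ : ∀ n, Measurable (φ n))
    (h : CondSummable P 𝓢 φ) (h' : CondSummable P 𝓢 ψ) :
    CondSummable P 𝓢 fun n ω => φ n ω + ψ n ω := by
  obtain ⟨η, h1, h2, h3⟩ := h
  obtain ⟨η', h1', h2', h3'⟩ := h'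
  refine ⟨fun n ω => η n ω + η' n ω, fun n => Measurable.add (h1 n) (h1' n), ?_, fun n s hs => ?_⟩
  · filter_upwards [h2, h2'] with ω a b
    rw [ENNReal.tsum_add]
    exact ENNReal.add_lt_top.2 ⟨a, b⟩
  · rw [lintegral_add_left (hφ n), lintegral_add_left ((h1 n).mono (h𝓢 n) le_rfl)]
    exact add_le_add (h3 n s hs) (h3' n s hs)

theorem CondSummable.const_mul {𝓢 : ℕ → MeasurableSpace Ω} {φ : ℕ → Ω → ℝ≥0∞}
    (h : CondSummable P 𝓢 φ) {C : ℝ≥0∞} (hC : C ≠ ∞) :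
    CondSummable P 𝓢 fun n ω => C * φ n ω := by
  obtain ⟨η, h1, h2, h3⟩ := h
  refine ⟨fun n ω => C * η n ω, fun n => (h1 n).const_mul C, ?_, fun n s hs => ?_⟩
  · filter_upwards [h2] with ω a
    rw [ENNReal.tsum_mul_left]
    exact ENNReal.mul_lt_top hC.lt_top a
  · rw [lintegral_const_mul' _ _ hC, lintegral_const_mul' _ _ hC]
    exact mul_le_mul_right (h3 n s hs) C

/-- The measures with densities `E(X | m)` and `X` have the same restriction to `m`, hence the same
integrals of `m`-measurable functions. No integrability of `X` is needed. -/
theorem setLIntegral_condLExp_mul [IsFiniteMeasure P] {m : MeasurableSpace Ω} (hm : m ≤ mΩ)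
    {X g : Ω → ℝ≥0∞} (hX : Measurable[mΩ] X) (hg : Measurable[m] g) {s : Set Ω}
    (hs : MeasurableSet[m] s) :
    ∫⁻ ω in s, condLExp m P X ω * g ω ∂P = ∫⁻ ω in s, X ω * g ω ∂P := by
  have hmeas : (P.withDensity (condLExp m P X)).trim hm = (P.withDensity X).trim hm := by
    refine @Measure.ext Ω m _ _ fun t ht => ?_
    rw [trim_measurableSet_eq hm ht, trim_measurableSet_eq hm ht, withDensity_apply _ (hm t ht),
      withDensity_apply _ (hm t ht), setLIntegral_condLExp hm P X ht]
  have h1 : ∀ Y : Ω → ℝ≥0∞, Measurable[mΩ] Y →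
      ∫⁻ ω in s, g ω ∂((P.withDensity Y).trim hm) = ∫⁻ ω in s, Y ω * g ω ∂P := by
    intro Y hY
    rw [setLIntegral_trim hm hg hs]
    exact setLIntegral_withDensity_eq_setLIntegral_mul P hY (hg.mono hm le_rfl) (hm s hs)
  rw [← h1 X hX, ← h1 _ (measurable_condLExp' m P X), hmeas]

/-- A substitute for conditional Jensen that tolerates infinite expectations. With `K` the
conditional second moment and `t = √K + δ n`, which is measurable for the past, one has `‖c‖ ≤ ‖c‖²
/ t + t` and `K / t ≤ √K`. This gives the dominating sequence `2 √K + δ n`; the summable `δ n > 0`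
keeps `t` away from `0`. -/
theorem SummableErrors.condSummable [IsFiniteMeasure P] {E : Type*} [NormedAddCommGroup E]
    [MeasurableSpace E] [OpensMeasurableSpace E] {𝓢 : ℕ → MeasurableSpace Ω} (h𝓢 : ∀ n, 𝓢 n ≤ mΩ)
    {c : ℕ → Ω → E} (hc : ∀ n, Measurable (c n)) (h : SummableErrors P 𝓢 c) :
    CondSummable P 𝓢 fun n ω => ‖c n ω‖ₑ := by
  set K : ℕ → Ω → ℝ≥0∞ := fun n => condLExp (𝓢 n) P (fun ω' => ‖c n ω'‖ₑ ^ 2) with hK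
  have hKm : ∀ n, Measurable[𝓢 n] (K n) := fun n => measurable_condLExp _ _ _
  obtain ⟨δ, hδ0, hδ⟩ := ENNReal.exists_pos_sum_of_countable' (ε := 1) one_ne_zero ℕ
  have hηm : ∀ n, Measurable[𝓢 n] fun ω => K n ω ^ (1 / 2 : ℝ) := fun n => (hKm n).pow_const _
  have hhm : ∀ n, Measurable[𝓢 n] fun ω => K n ω ^ (1 / 2 : ℝ) + δ n :=
    fun n => (hηm n).add_const _
  refine ⟨fun n ω => K n ω ^ (1 / 2 : ℝ) + (K n ω ^ (1 / 2 : ℝ) + δ n),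
    fun n => Measurable.add (hηm n) (hhm n), ?_, fun n s hs => ?_⟩
  · filter_upwards [h] with ω hω
    rw [ENNReal.tsum_add, ENNReal.tsum_add]
    exact ENNReal.add_lt_top.2 ⟨hω, ENNReal.add_lt_top.2 ⟨hω, hδ.trans ENNReal.one_lt_top⟩⟩
  · have hyoung : ∀ ω, ‖c n ω‖ₑ ≤
        ‖c n ω‖ₑ ^ 2 * (K n ω ^ (1 / 2 : ℝ) + δ n)⁻¹ + (K n ω ^ (1 / 2 : ℝ) + δ n) := by
      intro ω
      set t := K n ω ^ (1 / 2 : ℝ) + δ n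
      have ht0 : t ≠ 0 := (lt_of_lt_of_le (hδ0 n) le_add_self).ne'
      by_cases hle : ‖c n ω‖ₑ ≤ t
      · exact hle.trans le_add_self
      · push Not at hle
        refine le_trans ?_ le_self_add
        have : 1 ≤ ‖c n ω‖ₑ * t⁻¹ := by
          rw [← div_eq_mul_inv, ENNReal.le_div_iff_mul_le (Or.inl ht0) (Or.inl hle.ne_top), one_mul]
          exact hle.le
        rw [sq, mul_assoc]
        exact le_mul_of_one_le_right' this
    have hKle : ∀ ω, K n ω * (K n ω ^ (1 / 2 : ℝ) + δ n)⁻¹ ≤ K n ω ^ (1 / 2 : ℝ) := by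
      intro ω
      have hsq : K n ω = K n ω ^ (1 / 2 : ℝ) * K n ω ^ (1 / 2 : ℝ) := by
        rw [← ENNReal.rpow_add_of_nonneg _ _ (by norm_num) (by norm_num)]
        norm_num
      set t := K n ω ^ (1 / 2 : ℝ)
      rw [hsq, mul_assoc]
      refine mul_le_of_le_one_right' ?_
      rw [← div_eq_mul_inv]
      refine ENNReal.div_le_of_le_mul ?_
      rw [one_mul]
      exact le_self_add
    have hm2 : Measurable fun ω' => ‖c n ω'‖ₑ ^ 2 := (hc n).enorm.pow_const 2
    calc ∫⁻ ω in s, ‖c n ω‖ₑ ∂P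
        ≤ ∫⁻ ω in s, ‖c n ω‖ₑ ^ 2 * (K n ω ^ (1 / 2 : ℝ) + δ n)⁻¹ +
            (K n ω ^ (1 / 2 : ℝ) + δ n) ∂P := lintegral_mono hyoung
      _ = ∫⁻ ω in s, ‖c n ω‖ₑ ^ 2 * (K n ω ^ (1 / 2 : ℝ) + δ n)⁻¹ ∂P +
            ∫⁻ ω in s, (K n ω ^ (1 / 2 : ℝ) + δ n) ∂P :=
          lintegral_add_right _ ((hhm n).mono (h𝓢 n) le_rfl)
      _ = ∫⁻ ω in s, K n ω * (K n ω ^ (1 / 2 : ℝ) + δ n)⁻¹ ∂P +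
            ∫⁻ ω in s, (K n ω ^ (1 / 2 : ℝ) + δ n) ∂P := by
          congr 1
          exact (setLIntegral_condLExp_mul (h𝓢 n) hm2 (hhm n).inv hs).symm
      _ ≤ ∫⁻ ω in s, K n ω ^ (1 / 2 : ℝ) ∂P + ∫⁻ ω in s, (K n ω ^ (1 / 2 : ℝ) + δ n) ∂P :=
          add_le_add (lintegral_mono hKle) le_rfl
      _ = _ := (lintegral_add_left ((hηm n).mono (h𝓢 n) le_rfl) _).symm

/-- Integration of a function of a finite-valued random variable that is independent of a
σ-algebra. -/
theorem setLIntegral_apply_of_indep {A : Type*} [Fintype A] [MeasurableSpace A]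
    [MeasurableSingletonClass A] {m : MeasurableSpace Ω} (hm : m ≤ mΩ) {ε : Ω → A}
    (hε : Measurable[mΩ] ε) (hind : Indep (MeasurableSpace.comap ε inferInstance) m P)
    {F : A → Ω → ℝ≥0∞} (hF : ∀ e, Measurable[m] (F e)) {s : Set Ω} (hs : MeasurableSet[m] s) :
    ∫⁻ ω in s, F (ε ω) ω ∂P = ∫⁻ ω in s, ∑ e, P (ε ⁻¹' {e}) * F e ω ∂P := by
  classical
  have hFm : ∀ e, Measurable[mΩ] (F e) := fun e => (hF e).mono hm le_rfl
  have hT : ∀ e, MeasurableSet[mΩ] (ε ⁻¹' {e}) := fun e => hε (measurableSet_singleton e)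
  have hpt : ∀ ω, F (ε ω) ω = ∑ e, F e ω * (ε ⁻¹' {e}).indicator (fun _ => (1 : ℝ≥0∞)) ω := by
    intro ω
    rw [Finset.sum_eq_single (ε ω)]
    · simp
    · intro e _ he
      simp [Set.indicator, he.symm]
    · simp
  simp_rw [hpt]
  rw [lintegral_finsetSum (f := fun e ω => F e ω * (ε ⁻¹' {e}).indicator (fun _ => (1 : ℝ≥0∞)) ω)
      _ fun e _ => (hFm e).mul (measurable_const.indicator (hT e)),
    lintegral_finsetSum _ fun e _ => (hFm e).const_mul _]
  refine Finset.sum_congr rfl fun e _ => ?_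
  have h1 := lintegral_mul_indicator_eq_lintegral_mul_lintegral_indicator (μ := P) hm 1 (hT e)
    (f := s.indicator (F e)) (by
      refine indepSets_of_indepSets_of_le_right
        (s₂ := {t | MeasurableSet[MeasurableSpace.comap ε inferInstance] t}) hind.symm ?_
      rintro _ rfl
      exact ⟨{e}, measurableSet_singleton e, rfl⟩) ((hF e).indicator hs)
  have h2 : ∀ ω, s.indicator (F e) ω * (ε ⁻¹' {e}).indicator (fun _ => (1 : ℝ≥0∞)) ω =
      s.indicator (fun ω => F e ω * (ε ⁻¹' {e}).indicator (fun _ => (1 : ℝ≥0∞)) ω) ω := by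
    intro ω
    by_cases hω : ω ∈ s <;> simp [hω]
  simp_rw [h2] at h1
  rw [lintegral_indicator (hm s hs), lintegral_indicator (hm s hs), lintegral_indicator_const (hT e),
    one_mul]
    at h1
  rw [h1, lintegral_const_mul _ (hFm e), mul_comm]

/-- Nonnegative supermartingales converge almost surely. -/
theorem ae_exists_tendsto_of_setLIntegral_succ_le [IsFiniteMeasure P] (ℱ : Filtration ℕ mΩ)
    {V : ℕ → Ω → ℝ≥0∞} (hV : ∀ n, Measurable[ℱ n] (V n)) (h0 : ∫⁻ ω, V 0 ω ∂P ≠ ∞)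
    (hdec : ∀ n s, MeasurableSet[ℱ n] s → ∫⁻ ω in s, V (n + 1) ω ∂P ≤ ∫⁻ ω in s, V n ω ∂P) :
    ∀ᵐ ω ∂P, (∀ n, V n ω ≠ ∞) ∧ ∃ l, Tendsto (fun n => (V n ω).toReal) atTop (𝓝 l) := by
  have hVm : ∀ n, Measurable (V n) := fun n => (hV n).mono (ℱ.le n) le_rfl
  have hle : ∀ n, ∫⁻ ω, V n ω ∂P ≤ ∫⁻ ω, V 0 ω ∂P := by
    intro n
    induction n with
    | zero => exact le_rfl
    | succ n ih =>
      refine le_trans ?_ ih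
      simpa using hdec n Set.univ MeasurableSet.univ
  have hfin : ∀ n, ∫⁻ ω, V n ω ∂P ≠ ∞ := fun n => ne_top_of_le_ne_top h0 (hle n)
  have hae : ∀ n, ∀ᵐ ω ∂P, V n ω < ∞ := fun n => ae_lt_top (hVm n) (hfin n)
  have hint : ∀ n, Integrable (fun ω => (V n ω).toReal) P := fun n =>
    integrable_toReal_of_lintegral_ne_top (hVm n).aemeasurable (hfin n)
  have hsuper : Supermartingale (fun n ω => (V n ω).toReal) ℱ P := by
    refine supermartingale_of_setIntegral_succ_le
      (fun n => (Measurable.ennreal_toReal (hV n)).stronglyMeasurable) hint fun n s hs => ?_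
    rw [integral_toReal (hVm _).aemeasurable (ae_restrict_of_ae (hae _)),
      integral_toReal (hVm _).aemeasurable (ae_restrict_of_ae (hae _))]
    exact ENNReal.toReal_mono (ne_top_of_le_ne_top (hfin n) (setLIntegral_le_lintegral _ _))
      (hdec n s hs)
  have hbdd : ∀ n, eLpNorm ((-fun n ω => (V n ω).toReal) n) 1 P ≤
      (∫⁻ ω, V 0 ω ∂P).toNNReal := by
    intro n
    rw [ENNReal.coe_toNNReal h0, Pi.neg_apply, eLpNorm_neg, eLpNorm_one_eq_lintegral_enorm]
    refine le_trans (lintegral_mono fun ω => ?_) (hle n)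
    rw [Real.enorm_of_nonneg ENNReal.toReal_nonneg]
    exact ENNReal.ofReal_toReal_le
  filter_upwards [hsuper.neg.exists_ae_tendsto_of_bdd hbdd, ae_all_iff.2 hae] with ω h1 h2
  obtain ⟨l, hl⟩ := h1
  refine ⟨fun n => (h2 n).ne, -l, ?_⟩
  simpa using hl.neg

end Probability

/-! ### Almost supermartingales -/

section Supermartingale
variable {Ω : Type*} [mΩ : MeasurableSpace Ω] {P : Measure Ω}

theorem tendsto_toReal_sum_range {u : ℕ → ℝ≥0∞} (hu : ∑' n, u n ≠ ∞) :
    Tendsto (fun n => (∑ j ∈ Finset.range n, u j).toReal) atTop (𝓝 (∑' n, u n).toReal) :=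
  (ENNReal.tendsto_toReal hu).comp ENNReal.summable.hasSum.tendsto_sum_nat

/-- Robbins-Siegmund type convergence theorem, without integrability assumptions. -/
theorem ae_tendsto_of_almost_supermartingale [IsFiniteMeasure P] (ℱ : Filtration ℕ mΩ)
    {D θ η : ℕ → Ω → ℝ≥0∞} (hD : ∀ n, Measurable[ℱ n] (D n)) (hθ : ∀ n, Measurable[ℱ n] (θ n))
    (hη : ∀ n, Measurable[ℱ n] (η n)) (hD0 : ∀ ω, D 0 ω ≠ ∞)
    (hηs : ∀ᵐ ω ∂P, ∑' n, η n ω < ∞)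
    (hstep : ∀ n s, MeasurableSet[ℱ n] s →
      ∫⁻ ω in s, (D (n + 1) ω + θ n ω) ∂P ≤ ∫⁻ ω in s, (D n ω + η n ω) ∂P) :
    ∀ᵐ ω ∂P, ∑' n, θ n ω < ∞ ∧ ∃ l, Tendsto (fun n => (D n ω).toReal) atTop (𝓝 l) := by
  -- Localization. On `B k n`, the quantity `D n + ∑ θ + (k - ∑ η)` involves a genuine difference,
  -- because the partial sum of `η` is at most `k`. Cut off by `B k n`, it is a nonnegative
  -- supermartingale whose initial value is at most `2 k`, hence integrable.
  set B : ℕ → ℕ → Set Ω := fun k n => {ω | D 0 ω ≤ k ∧ ∑ j ∈ Finset.range n, η j ω ≤ k} with hB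
  set W : ℕ → ℕ → Ω → ℝ≥0∞ := fun k n ω =>
    ∑ j ∈ Finset.range n, θ j ω + (k - ∑ j ∈ Finset.range n, η j ω) with hW
  set V : ℕ → ℕ → Ω → ℝ≥0∞ := fun k n => (B k n).indicator fun ω => D n ω + W k n ω with hV
  have hsum : ∀ {u : ℕ → Ω → ℝ≥0∞}, (∀ n, Measurable[ℱ n] (u n)) → ∀ n m, (∀ j < n, j ≤ m) →
      Measurable[ℱ m] fun ω => ∑ j ∈ Finset.range n, u j ω := by
    intro u hu n m hnm
    exact Finset.measurable_fun_sum _ fun j hj =>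
      (hu j).mono (ℱ.mono (hnm j (Finset.mem_range.1 hj))) le_rfl
  have hBm : ∀ k n m, (∀ j < n, j ≤ m) → MeasurableSet[ℱ m] (B k n) := by
    intro k n m hnm
    have h1 : MeasurableSet[ℱ m] {ω | D 0 ω ≤ k} :=
      ((hD 0).mono (ℱ.mono (Nat.zero_le m)) le_rfl) measurableSet_Iic
    have h2 : MeasurableSet[ℱ m] {ω | ∑ j ∈ Finset.range n, η j ω ≤ k} :=
      (hsum hη n m hnm) measurableSet_Iic
    exact h1.inter h2
  have hWm : ∀ k n m, (∀ j < n, j ≤ m) → Measurable[ℱ m] (W k n) := fun k n m hnm =>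
    Measurable.add (hsum hθ n m hnm) (Measurable.const_sub (hsum hη n m hnm) _)
  have hconv : ∀ k, ∀ᵐ ω ∂P, (∀ n, V k n ω ≠ ∞) ∧
      ∃ l, Tendsto (fun n => (V k n ω).toReal) atTop (𝓝 l) := by
    intro k
    refine ae_exists_tendsto_of_setLIntegral_succ_le ℱ (fun n => ?_) ?_ fun n s hs => ?_
    · exact (Measurable.add (hD n) (hWm k n n fun j hj => hj.le)).indicator
        (hBm k n n fun j hj => hj.le)
    · refine ne_top_of_le_ne_top (b := ∫⁻ ω, ((k : ℝ≥0∞) + k) ∂P) ?_ (lintegral_mono fun ω => ?_)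
      · rw [lintegral_const]
        exact ENNReal.mul_ne_top (by simp) (measure_ne_top _ _)
      · simp only [hV, hW]
        by_cases hω : ω ∈ B k 0
        · rw [Set.indicator_of_mem hω]
          simpa using hω.1
        · rw [Set.indicator_of_notMem hω]
          exact zero_le
    -- `B k (n + 1)` involves `η j` only for `j ≤ n`, so it already belongs to `ℱ n` and the step
    -- inequality may be restricted to it.
    · have hB1 : MeasurableSet[ℱ n] (B k (n + 1)) := hBm k (n + 1) n fun j hj => by omega
      have hsub : B k (n + 1) ⊆ B k n := fun ω hω => ⟨hω.1, le_trans
        (Finset.sum_le_sum_of_subset (Finset.range_subset_range.2 n.le_succ)) hω.2⟩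
      have hrest : Measurable fun ω =>
          ∑ j ∈ Finset.range n, θ j ω + (k - ∑ j ∈ Finset.range (n + 1), η j ω) :=
        Measurable.mono (Measurable.add (hsum hθ n n fun j hj => hj.le)
          (Measurable.const_sub (hsum hη (n + 1) n fun j hj => by omega) (k : ℝ≥0∞)))
          (ℱ.le n) le_rfl
      calc ∫⁻ ω in s, V k (n + 1) ω ∂P
          = ∫⁻ ω in B k (n + 1) ∩ s, (D (n + 1) ω + W k (n + 1) ω) ∂P := by
            simp only [hV]
            rw [lintegral_indicator (ℱ.le n _ hB1), Measure.restrict_restrict (ℱ.le n _ hB1)]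
        _ = ∫⁻ ω in B k (n + 1) ∩ s, ((D (n + 1) ω + θ n ω) +
              (∑ j ∈ Finset.range n, θ j ω + (k - ∑ j ∈ Finset.range (n + 1), η j ω))) ∂P := by
            refine lintegral_congr fun ω => ?_
            simp only [hW]
            rw [Finset.sum_range_succ (fun j => θ j ω)]
            ring
        _ = ∫⁻ ω in B k (n + 1) ∩ s, (D (n + 1) ω + θ n ω) ∂P + ∫⁻ ω in B k (n + 1) ∩ s,
              (∑ j ∈ Finset.range n, θ j ω + (k - ∑ j ∈ Finset.range (n + 1), η j ω)) ∂P :=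
            lintegral_add_right _ hrest
        _ ≤ ∫⁻ ω in B k (n + 1) ∩ s, (D n ω + η n ω) ∂P + ∫⁻ ω in B k (n + 1) ∩ s,
              (∑ j ∈ Finset.range n, θ j ω + (k - ∑ j ∈ Finset.range (n + 1), η j ω)) ∂P :=
            add_le_add (hstep n _ (hB1.inter hs)) le_rfl
        _ = ∫⁻ ω in B k (n + 1) ∩ s, ((D n ω + η n ω) +
              (∑ j ∈ Finset.range n, θ j ω + (k - ∑ j ∈ Finset.range (n + 1), η j ω))) ∂P :=
            (lintegral_add_right _ hrest).symm
        _ = ∫⁻ ω in B k (n + 1) ∩ s, (D n ω + W k n ω) ∂P := by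
            refine setLIntegral_congr_fun (ℱ.le n _ (hB1.inter hs)) fun ω hω => ?_
            have hk : ∑ j ∈ Finset.range n, η j ω + η n ω ≤ k := by
              rw [← Finset.sum_range_succ (fun j => η j ω)]; exact hω.1.2
            simp only [hW]
            rw [Finset.sum_range_succ (fun j => η j ω), ← tsub_tsub]
            have : η n ω + (k - ∑ j ∈ Finset.range n, η j ω - η n ω) =
                k - ∑ j ∈ Finset.range n, η j ω := by
              refine add_tsub_cancel_of_le ?_
              refine ENNReal.le_sub_of_add_le_left ?_ hk
              exact ne_top_of_le_ne_top (ENNReal.natCast_ne_top k) (le_trans le_self_add hk)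
            conv_rhs => rw [← this]
            ring
        _ ≤ ∫⁻ ω in B k n ∩ s, (D n ω + W k n ω) ∂P :=
            lintegral_mono_set (Set.inter_subset_inter_left s hsub)
        _ = ∫⁻ ω in s, V k n ω ∂P := by
            simp only [hV]
            have hBn := ℱ.le n _ (hBm k n n fun j hj => hj.le)
            rw [lintegral_indicator hBn, Measure.restrict_restrict hBn]
  filter_upwards [ae_all_iff.2 hconv, hηs] with ω hω hη1
  -- For this `k`, the point `ω` lies in every `B k n`, so the cut-off is inactive along the whole
  -- trajectory.
  obtain ⟨k, hk⟩ : ∃ k : ℕ, D 0 ω + ∑' n, η n ω < k :=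
    ENNReal.exists_nat_gt (ENNReal.add_lt_top.2 ⟨(hD0 ω).lt_top, hη1⟩).ne
  have hsumle : ∀ n, ∑ j ∈ Finset.range n, η j ω ≤ k := fun n =>
    (ENNReal.sum_le_tsum _).trans (le_add_self.trans hk.le)
  have hmem : ∀ n, ω ∈ B k n := fun n => ⟨le_self_add.trans hk.le, hsumle n⟩
  obtain ⟨hfin, l, hl⟩ := hω k
  have hVeq : ∀ n, V k n ω = D n ω + W k n ω := fun n => Set.indicator_of_mem (hmem n) _
  simp only [hVeq, hW] at hfin hl
  have hDfin : ∀ n, D n ω ≠ ∞ := fun n => (ENNReal.add_ne_top.1 (hfin n)).1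
  have hθfin : ∀ n, ∑ j ∈ Finset.range n, θ j ω ≠ ∞ := fun n =>
    (ENNReal.add_ne_top.1 (ENNReal.add_ne_top.1 (hfin n)).2).1
  have hθs : ∑' n, θ n ω < ∞ := by
    obtain ⟨C, hC⟩ := hl.bddAbove_range
    refine lt_of_le_of_lt (ENNReal.tsum_le_of_sum_range_le fun n => ?_)
      (ENNReal.ofReal_lt_top (r := C))
    have h1 : ∑ j ∈ Finset.range n, θ j ω ≤
        D n ω + (∑ j ∈ Finset.range n, θ j ω + (k - ∑ j ∈ Finset.range n, η j ω)) :=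
      le_add_left le_self_add
    exact h1.trans ((ENNReal.le_ofReal_iff_toReal_le (hfin n)
      (ENNReal.toReal_nonneg.trans (hC ⟨n, rfl⟩))).2 (hC ⟨n, rfl⟩))
  refine ⟨hθs, l - (∑' n, θ n ω).toReal - ((k : ℝ) - (∑' n, η n ω).toReal), ?_⟩
  refine ((hl.sub (tendsto_toReal_sum_range hθs.ne)).sub
    ((tendsto_toReal_sum_range hη1.ne).const_sub (k : ℝ))).congr fun n => ?_
  have hkn : (k : ℝ≥0∞) - ∑ j ∈ Finset.range n, η j ω ≠ ∞ :=
    ENNReal.sub_ne_top (ENNReal.natCast_ne_top k)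
  rw [ENNReal.toReal_add (hDfin n) (ENNReal.add_ne_top.2 ⟨hθfin n, hkn⟩),
    ENNReal.toReal_add (hθfin n) hkn, ENNReal.toReal_sub_of_le (hsumle n)
      (ENNReal.natCast_ne_top k), ENNReal.toReal_natCast]
  ring

end Supermartingale

/-! ### Random activations -/

section Activations
variable {Ω : Type*} [mΩ : MeasurableSpace Ω] {P : Measure Ω} {m : ℕ}

theorem Activation.coeff_eq_zero_or_one (e : Activation m) (i : Fin m) :
    e.coeff i = 0 ∨ e.coeff i = 1 := by
  unfold Activation.coeff
  have : ((e.1 i : ℕ)) = 0 ∨ ((e.1 i : ℕ)) = 1 := by omega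
  rcases this with h | h <;> simp [h]

theorem Activation.measurable_coeff (i : Fin m) :
    Measurable fun e : Activation m => e.coeff i := measurable_of_countable _

theorem Activation.measurableSet_coeff_eq_one (i : Fin m) :
    MeasurableSet {e : Activation m | e.coeff i = 1} :=
  Activation.measurable_coeff i (measurableSet_singleton 1)

variable {ε : ℕ → Ω → Activation m} {𝓢 : ℕ → MeasurableSpace Ω}

theorem ActivationRule.measurable_coeff (h : ActivationRule P ε 𝓢) (n : ℕ) (i : Fin m) :
    Measurable fun ω => (ε n ω).coeff i := (Activation.measurable_coeff i).comp (h.measurable n)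

theorem integral_coeff [IsFiniteMeasure P] (h : ActivationRule P ε 𝓢) (n : ℕ) (i : Fin m) :
    ∫ ω, (ε n ω).coeff i ∂P = P.real {ω | (ε n ω).coeff i = 1} := by
  have hset : MeasurableSet {ω | (ε n ω).coeff i = 1} :=
    h.measurable_coeff n i (measurableSet_singleton 1)
  rw [← integral_indicator_one hset]
  refine integral_congr_ae (Eventually.of_forall fun ω => ?_)
  rcases (ε n ω).coeff_eq_zero_or_one i with h0 | h0 <;> simp [Set.indicator, h0]

/-- Every block is activated infinitely often. -/
theorem ActivationRule.ae_frequently [IsProbabilityMeasure P] (h : ActivationRule P ε 𝓢)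
    (i : Fin m) : ∀ᵐ ω ∂P, ∃ᶠ n in atTop, (ε n ω).coeff i = 1 := by
  have hint : Integrable (fun ω => (ε 0 ω).coeff i) P := by
    refine Integrable.of_bound (h.measurable_coeff 0 i).aestronglyMeasurable 1
      (Eventually.of_forall fun ω => ?_)
    rcases (ε 0 ω).coeff_eq_zero_or_one i with h0 | h0 <;> simp [h0]
  -- Etemadi's form of the strong law needs only pairwise independence. If the block were activated
  -- finitely often, the averages would tend to `0` instead of the positive activation probability.
  have hlln := strong_law_ae_real (fun n ω => (ε n ω).coeff i) hint
    (fun a b hab => (h.pairwise_indep hab).comp (Activation.measurable_coeff i)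
      (Activation.measurable_coeff i))
    (fun n => (h.identDistrib n).comp (Activation.measurable_coeff i))
  have hpos : 0 < ∫ ω, (ε 0 ω).coeff i ∂P := by
    rw [integral_coeff h]
    exact ENNReal.toReal_pos (h.pos i).ne' (measure_ne_top _ _)
  filter_upwards [hlln] with ω hω
  by_contra hcon
  rw [not_frequently] at hcon
  have h0 : Tendsto (fun n => (ε n ω).coeff i) atTop (𝓝 0) := by
    refine tendsto_const_nhds.congr' ?_
    filter_upwards [hcon] with n hn
    exact (((ε n ω).coeff_eq_zero_or_one i).resolve_right hn).symm
  have h1 := h0.cesaro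
  have h2 := tendsto_nhds_unique (hω.congr fun n => by rw [div_eq_inv_mul]) h1
  exact hpos.ne' h2

/-- Expectation of an activation coefficient under the law of `ε 0`; it identifies the weights `q i`
of the block estimate. -/
theorem ActivationRule.sum_mul_coeff [IsProbabilityMeasure P] (h : ActivationRule P ε 𝓢)
    (i : Fin m) : ∑ e, P.real (ε 0 ⁻¹' {e}) * e.coeff i = P.real {ω | (ε 0 ω).coeff i = 1} := by
  have h1 : P.real {ω | (ε 0 ω).coeff i = 1} =
      (P.map (ε 0)).real {e : Activation m | e.coeff i = 1} := by
    rw [map_measureReal_apply (h.measurable 0)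
      (Activation.measurableSet_coeff_eq_one i)]
    rfl
  have : IsProbabilityMeasure (P.map (ε 0)) :=
    Measure.isProbabilityMeasure_map (h.measurable 0).aemeasurable
  rw [h1, ← integral_indicator_one (Activation.measurableSet_coeff_eq_one i),
    integral_fintype (Integrable.of_finite)]
  refine Finset.sum_congr rfl fun e _ => ?_
  rw [map_measureReal_apply (h.measurable 0) (measurableSet_singleton e), smul_eq_mul]
  rcases e.coeff_eq_zero_or_one i with h0 | h0 <;> simp [Set.indicator, h0]

theorem ActivationRule.sum_measureReal [IsProbabilityMeasure P] (h : ActivationRule P ε 𝓢) :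
    ∑ e, P.real (ε 0 ⁻¹' {e}) = 1 := by
  have : IsProbabilityMeasure (P.map (ε 0)) :=
    Measure.isProbabilityMeasure_map (h.measurable 0).aemeasurable
  have h1 := integral_fintype (μ := P.map (ε 0)) (f := fun _ => (1 : ℝ)) (Integrable.of_finite)
  simp only [integral_const, probReal_univ, smul_eq_mul, mul_one] at h1
  rw [h1]
  exact Finset.sum_congr rfl fun e _ =>
    (map_measureReal_apply (h.measurable 0) (measurableSet_singleton e)).symm

theorem ActivationRule.measure_preimage (h : ActivationRule P ε 𝓢) (n : ℕ) (e : Activation m) :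
    P (ε n ⁻¹' {e}) = P (ε 0 ⁻¹' {e}) :=
  (h.identDistrib n).measure_mem_eq (measurableSet_singleton e)

end Activations

/-! ### Measurability of weak limits -/

section Measurability
variable {Ω : Type*} [mΩ : MeasurableSpace Ω] {P : Measure Ω}
  {X : Type*} [NormedAddCommGroup X] [InnerProductSpace ℝ X]
  [SecondCountableTopology X] [MeasurableSpace X] [BorelSpace X]

/-- Pettis' theorem in a separable Hilbert space. -/
theorem measurable_of_inner {x : Ω → X} (h : ∀ y, Measurable fun ω => inner ℝ (x ω) y) :
    Measurable x := by
  have hdist : ∀ y, Measurable fun ω => ‖x ω - y‖ := by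
    intro y
    refine measurable_of_Iic fun c => ?_
    rcases lt_or_ge c 0 with hc | hc
    · convert MeasurableSet.empty
      ext ω
      simpa using hc.trans_le (norm_nonneg _)
    -- By density and Cauchy-Schwarz, `‖x ω - y‖ ≤ c` amounts to countably many inequalities between
    -- inner products.
    · have heq : (fun ω => ‖x ω - y‖) ⁻¹' Set.Iic c = ⋂ k : ℕ, {ω | inner ℝ (x ω)
          (TopologicalSpace.denseSeq X k) - inner ℝ y (TopologicalSpace.denseSeq X k) ≤
            c * ‖TopologicalSpace.denseSeq X k‖} := by
        ext ω
        simp only [Set.mem_preimage, Set.mem_Iic, Set.mem_iInter, Set.mem_ofPred_eq,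
          ← inner_sub_left]
        constructor
        · intro hω k
          exact (real_inner_le_norm _ _).trans (by gcongr)
        · intro hω
          have hall : ∀ v, inner ℝ (x ω - y) v ≤ c * ‖v‖ := fun v =>
            (TopologicalSpace.denseRange_denseSeq X).induction_on v
              (isClosed_le (by fun_prop) (by fun_prop)) hω
          have h1 := hall (x ω - y)
          rw [real_inner_self_eq_norm_sq] at h1
          by_contra! hlt
          nlinarith [norm_nonneg (x ω - y)]
      rw [heq]
      exact MeasurableSet.iInter fun k => measurableSet_le ((h _).sub_const _) measurable_const
  have hbasis : TopologicalSpace.IsTopologicalBasis {s : Set X | ∃ y r, s = Metric.ball y r} := by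
    refine TopologicalSpace.isTopologicalBasis_of_isOpen_of_nhds ?_ ?_
    · rintro _ ⟨y, r, rfl⟩
      exact Metric.isOpen_ball
    · intro a u ha hu
      obtain ⟨r, hr, hsub⟩ := Metric.isOpen_iff.1 hu a ha
      exact ⟨_, ⟨a, r, rfl⟩, Metric.mem_ball_self hr, hsub⟩
  rw [BorelSpace.measurable_eq (α := X), hbasis.borel_eq_generateFrom]
  refine measurable_generateFrom ?_
  rintro _ ⟨y, r, rfl⟩
  have : x ⁻¹' Metric.ball y r = {ω | ‖x ω - y‖ < r} := by
    ext ω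
    simp [dist_eq_norm]
  rw [this]
  exact measurableSet_lt (hdist y) measurable_const

/-- The limit is chosen pointwise, with default `a₀` where there is no convergence, so its
measurability is not automatic. Its inner products are almost everywhere limits of measurable
functions, hence measurable by completeness of `P`, and Pettis' theorem concludes. -/
theorem convergesWeaklyAsTo_of_ae [CompleteSpace X] [P.IsComplete] {x : ℕ → Ω → X} {S : Set X}
    (hx : ∀ n, Measurable (x n)) (hS : S.Nonempty)
    (h : ∀ᵐ ω ∂P, ∃ a ∈ S, ConvergesWeakly (fun n => x n ω) a) : ConvergesWeaklyAsTo P x S := by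
  classical
  obtain ⟨a₀, ha₀⟩ := hS
  have hchoice : ∀ ω, ∃ a ∈ S, (∃ a ∈ S, ConvergesWeakly (fun n => x n ω) a) →
      ConvergesWeakly (fun n => x n ω) a := by
    intro ω
    by_cases hω : ∃ a ∈ S, ConvergesWeakly (fun n => x n ω) a
    · obtain ⟨a, ha, hc⟩ := hω
      exact ⟨a, ha, fun _ => hc⟩
    · exact ⟨a₀, ha₀, fun h => absurd h hω⟩
  choose Y hYS hY using hchoice
  have hconv : ∀ᵐ ω ∂P, ConvergesWeakly (fun n => x n ω) (Y ω) := by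
    filter_upwards [h] with ω hω using hY ω hω
  refine ⟨Y, measurable_of_inner fun y => ?_, hYS, hconv⟩
  refine NullMeasurable.measurable_of_complete (μ := P) (AEMeasurable.nullMeasurable ?_)
  refine aemeasurable_of_tendsto_metrizable_ae (f := fun n ω => inner ℝ (x n ω) y) atTop
    (fun n => ((hx n).inner_const).aemeasurable) ?_
  filter_upwards [hconv] with ω hω using convergesWeakly_iff.1 hω y

end Measurability

/-! ### Convergence of randomly activated iterations -/

section RandomBlocks
variable {Ω : Type*} [mΩ : MeasurableSpace Ω] {P : Measure Ω}
  {X : Type*} [NormedAddCommGroup X] [InnerProductSpace ℝ X]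

theorem RelaxationSeq.exists_bounds {lam : ℕ → ℝ} (h : RelaxationSeq lam) :
    ∃ κ, 0 < κ ∧ ∀ n, κ ≤ lam n * (2 - lam n) := by
  have h1 : ∀ n, ⨅ n, lam n ≤ lam n := fun n =>
    ciInf_le ⟨0, by rintro _ ⟨k, rfl⟩; exact (h.mem k).1.le⟩ n
  have h2 : ∀ n, lam n ≤ ⨆ n, lam n := fun n =>
    le_ciSup (f := lam) ⟨2, by rintro _ ⟨k, rfl⟩; exact (h.mem k).2.le⟩ n
  exact ⟨(⨅ n, lam n) * (2 - ⨆ n, lam n), mul_pos h.inf_pos (sub_pos.2 h.sup_lt), fun n =>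
    mul_le_mul (h1 n) (sub_le_sub_left (h2 n) 2) (sub_pos.2 h.sup_lt).le (h.mem n).1.le⟩

/-- The Cauchy property survives uniform approximation. This transfers convergence of distances from
a dense sequence of zeros to every zero. -/
theorem exists_tendsto_of_uniform_approx {u : ℕ → ℝ}
    (h : ∀ δ > 0, ∃ v : ℕ → ℝ, (∃ l, Tendsto v atTop (𝓝 l)) ∧ ∀ n, |u n - v n| ≤ δ) :
    ∃ l, Tendsto u atTop (𝓝 l) := by
  refine cauchySeq_tendsto_of_complete (Metric.cauchySeq_iff'.2 fun δ hδ => ?_)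
  obtain ⟨v, ⟨l, hl⟩, hv⟩ := h (δ / 4) (by positivity)
  obtain ⟨N, hN⟩ := Metric.cauchySeq_iff'.1 hl.cauchySeq (δ / 4) (by positivity)
  refine ⟨N, fun n hn => ?_⟩
  have h1 := hN n hn
  have h2 := hv n
  have h3 := hv N
  rw [Real.dist_eq] at h1 ⊢
  rw [abs_le] at h2 h3
  rw [abs_lt] at h1 ⊢
  constructor <;> linarith

theorem continuous_of_cocoercive {R : X → X}
    (hR : ∀ x y, ‖R x - R y‖ ^ 2 ≤ -inner ℝ (R x - R y) (x - y)) : Continuous R := by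
  have h : FirmlyNonexpansive fun x => -R x := fun x y => by
    have e : -R x - -R y = -(R x - R y) := by abel
    rw [e, norm_neg, inner_neg_left]
    exact hR x y
  exact h.continuous.neg.congr fun x => neg_neg _

/-- Fejér monotonicity in the mean of a randomly block-activated iteration. -/
theorem setLIntegral_norm_step_le [IsProbabilityMeasure P] [MeasurableSpace X] [BorelSpace X]
    (ℱ : Filtration ℕ mΩ) {m : ℕ} {ε : ℕ → Ω → Activation m} (hε : ActivationRule P ε ℱ)
    {ι : Type*} [Fintype ι] {pr : ι → X →L[ℝ] X} (hpr : IsBlockDecomposition pr)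
    (idx : ι → Fin m) {R : X → X}
    (hR : ∀ x y, ‖R x - R y‖ ^ 2 ≤ -inner ℝ (R x - R y) (x - y))
    {lam : ℕ → ℝ} (hlam : RelaxationSeq lam)
    {Z err : ℕ → Ω → X} (hZ : ∀ n, Measurable[ℱ n] (Z n)) (herr : ∀ n, Measurable (err n))
    (hrec : ∀ n ω, Z (n + 1) ω = Z n ω +
      blockScale pr (fun i => (ε n ω).coeff (idx i) * lam n) (R (Z n ω) + err n ω))
    {η : ℕ → Ω → ℝ≥0∞}
    (hη : ∀ n s, MeasurableSet[ℱ n] s → ∫⁻ ω in s, ‖err n ω‖ₑ ∂P ≤ ∫⁻ ω in s, η n ω ∂P)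
    (hηm : ∀ n, Measurable[ℱ n] (η n))
    {q : ι → ℝ} (hq : ∀ i, q i = P.real {ω | (ε 0 ω).coeff (idx i) = 1}) {S : X →L[ℝ] X}
    (hS : S = blockScale pr fun i => (√(q i))⁻¹) {a : X} (ha : R a = 0) (n : ℕ) (s : Set Ω)
    (hs : MeasurableSet[ℱ n] s) :
    ∫⁻ ω in s, (‖S (Z (n + 1) ω - a)‖ₑ + ENNReal.ofReal
        (lam n * (2 - lam n) * ‖R (Z n ω)‖ ^ 2 / (2 * ‖S (Z n ω - a)‖))) ∂P ≤
      ∫⁻ ω in s, (‖S (Z n ω - a)‖ₑ + ‖S‖ₑ * 2 * η n ω) ∂P := by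
  have hle := ℱ.le n
  have hlam0 := (hlam.mem n).1
  have hlam2 := (hlam.mem n).2
  have hRc := continuous_of_cocoercive hR
  have hSm : ∀ f : Ω → X, Measurable[ℱ n] f → Measurable[ℱ n] fun ω => S (f ω) := fun f hf =>
    S.continuous.measurable.comp hf
  have hZa : Measurable[ℱ n] fun ω => Z n ω - a :=
    (continuous_id.sub continuous_const).measurable.comp (hZ n)
  have hRZ : Measurable[ℱ n] fun ω => R (Z n ω) := hRc.measurable.comp (hZ n)
  set θ : Ω → ℝ≥0∞ := fun ω => ENNReal.ofReal
    (lam n * (2 - lam n) * ‖R (Z n ω)‖ ^ 2 / (2 * ‖S (Z n ω - a)‖)) with hθ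
  have hθm : Measurable[ℱ n] θ := by
    have h1 : Measurable[ℱ n] fun ω => ‖R (Z n ω)‖ := continuous_norm.measurable.comp hRZ
    have h2 : Measurable[ℱ n] fun ω => ‖S (Z n ω - a)‖ :=
      continuous_norm.measurable.comp (hSm _ hZa)
    exact ENNReal.measurable_ofReal.comp
      (((h1.pow_const 2).const_mul _).div (h2.const_mul 2))
  set F : Activation m → Ω → ℝ≥0∞ := fun e ω =>
    ‖S (Z n ω - a + blockScale pr (fun i => e.coeff (idx i) * lam n) (R (Z n ω)))‖ₑ with hF
  have hFm : ∀ e, Measurable[ℱ n] (F e) := by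
    intro e
    have hc : Continuous fun x : X =>
        ‖S (x - a + blockScale pr (fun i => e.coeff (idx i) * lam n) (R x))‖ₑ := by fun_prop
    exact hc.measurable.comp (hZ n)
  -- The error may depend on `ε n`, so it is split off by the triangle inequality and bounded
  -- pathwise, using only that every coefficient is at most `2`. Independence is applied to `F`
  -- alone.
  have hpt : ∀ ω, ‖S (Z (n + 1) ω - a)‖ₑ ≤ F (ε n ω) ω + ‖S‖ₑ * 2 * ‖err n ω‖ₑ := by
    intro ω
    have h1 : S (Z (n + 1) ω - a) =
        S (Z n ω - a + blockScale pr (fun i => (ε n ω).coeff (idx i) * lam n) (R (Z n ω))) +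
        S (blockScale pr (fun i => (ε n ω).coeff (idx i) * lam n) (err n ω)) := by
      rw [← map_add, hrec, map_add]
      congr 1
      abel
    rw [h1]
    refine (enorm_add_le _ _).trans (add_le_add le_rfl ?_)
    have h2 : ‖blockScale pr (fun i => (ε n ω).coeff (idx i) * lam n) (err n ω)‖ ≤
        2 * ‖err n ω‖ := by
      refine hpr.norm_blockScale_le zero_le_two (fun i => ?_) _
      rcases (ε n ω).coeff_eq_zero_or_one (idx i) with h0 | h0
      · simp [h0]
      · rw [h0, one_mul, abs_of_pos hlam0]
        exact hlam2.le
    have h3 : ‖S (blockScale pr (fun i => (ε n ω).coeff (idx i) * lam n) (err n ω))‖ ≤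
        ‖S‖ * 2 * ‖err n ω‖ := by
      rw [mul_assoc]
      exact (S.le_opNorm _).trans (by gcongr)
    rw [← ofReal_norm, ← ofReal_norm, ← ofReal_norm]
    have h4 : (2 : ℝ≥0∞) = ENNReal.ofReal 2 := by simp
    rw [h4, ← ENNReal.ofReal_mul (norm_nonneg _), ← ENNReal.ofReal_mul (by positivity)]
    exact ENNReal.ofReal_le_ofReal h3
  have hq0 : ∀ i, 0 < q i := fun i => by
    rw [hq]
    exact ENNReal.toReal_pos (hε.pos _).ne' (measure_ne_top _ _)
  have hmean : ∀ ω, ∑ e, P (ε n ⁻¹' {e}) * F e ω + θ ω ≤ ‖S (Z n ω - a)‖ₑ := by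
    intro ω
    have hxr := hR (Z n ω) a
    rw [ha, sub_zero] at hxr
    have h1 := hpr.sum_norm_step_add_le (π := fun e => P.real (ε 0 ⁻¹' {e}))
      (act := fun e i => e.coeff (idx i)) (q := q) (fun e => measureReal_nonneg)
      hε.sum_measureReal (fun e i => e.coeff_eq_zero_or_one _)
      (fun i => by rw [hq]; exact hε.sum_mul_coeff _) hq0 hlam0.le hlam2.le hxr
    rw [← hS] at h1
    have h2 : ∀ e, P (ε n ⁻¹' {e}) * F e ω = ENNReal.ofReal (P.real (ε 0 ⁻¹' {e}) *
        ‖S (Z n ω - a + blockScale pr (fun i => e.coeff (idx i) * lam n) (R (Z n ω)))‖) := by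
      intro e
      rw [ENNReal.ofReal_mul measureReal_nonneg, ofReal_measureReal, ofReal_norm,
        hε.measure_preimage]
    simp_rw [h2]
    rw [← ENNReal.ofReal_sum_of_nonneg fun e _ => mul_nonneg measureReal_nonneg (norm_nonneg _),
      hθ, ← ENNReal.ofReal_add, ← ofReal_norm]
    · exact ENNReal.ofReal_le_ofReal h1
    · exact Finset.sum_nonneg fun e _ => mul_nonneg measureReal_nonneg (norm_nonneg _)
    · have : 0 ≤ 2 - lam n := by linarith
      positivity
  have hSne : ‖S‖ₑ * 2 ≠ ∞ := ENNReal.mul_ne_top enorm_ne_top (by simp)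
  have hem : Measurable fun ω => ‖S‖ₑ * 2 * ‖err n ω‖ₑ := (herr n).enorm.const_mul _
  have hθm' : Measurable θ := hθm.mono hle le_rfl
  calc ∫⁻ ω in s, (‖S (Z (n + 1) ω - a)‖ₑ + θ ω) ∂P
      ≤ ∫⁻ ω in s, (F (ε n ω) ω + (θ ω + ‖S‖ₑ * 2 * ‖err n ω‖ₑ)) ∂P :=
        lintegral_mono fun ω => (add_le_add (hpt ω) le_rfl).trans_eq (by ring)
    _ = ∫⁻ ω in s, F (ε n ω) ω ∂P +
        (∫⁻ ω in s, θ ω ∂P + ∫⁻ ω in s, ‖S‖ₑ * 2 * ‖err n ω‖ₑ ∂P) := by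
        rw [← lintegral_add_right _ hem]
        exact lintegral_add_right _ (hθm'.add hem)
    _ ≤ ∫⁻ ω in s, ∑ e, P (ε n ⁻¹' {e}) * F e ω ∂P +
        (∫⁻ ω in s, θ ω ∂P + ∫⁻ ω in s, ‖S‖ₑ * 2 * η n ω ∂P) := by
        refine add_le_add (setLIntegral_apply_of_indep hle (hε.measurable n) (hε.indep_past n)
          hFm hs).le (add_le_add le_rfl ?_)
        rw [lintegral_const_mul' _ _ hSne, lintegral_const_mul' _ _ hSne]
        exact mul_le_mul_right (hη n s hs) _
    _ = ∫⁻ ω in s, (∑ e, P (ε n ⁻¹' {e}) * F e ω + θ ω) ∂P +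
        ∫⁻ ω in s, ‖S‖ₑ * 2 * η n ω ∂P := by
        rw [lintegral_add_right _ hθm', add_assoc]
    _ ≤ ∫⁻ ω in s, ‖S (Z n ω - a)‖ₑ ∂P + ∫⁻ ω in s, ‖S‖ₑ * 2 * η n ω ∂P :=
        add_le_add (lintegral_mono hmean) le_rfl
    _ = _ := (lintegral_add_right _ (((hηm n).mono hle le_rfl).const_mul _)).symm

/-- Almost sure weak convergence of randomly block-activated iterations. -/
theorem ae_convergesWeakly_of_block_iteration [IsProbabilityMeasure P] [CompleteSpace X]
    [SecondCountableTopology X] [MeasurableSpace X] [BorelSpace X]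
    (ℱ : Filtration ℕ mΩ) {m : ℕ} {ε : ℕ → Ω → Activation m} (hε : ActivationRule P ε ℱ)
    {ι : Type*} [Fintype ι] {pr : ι → X →L[ℝ] X} (hpr : IsBlockDecomposition pr)
    (idx : ι → Fin m) {R : X → X}
    (hR : ∀ x y, ‖R x - R y‖ ^ 2 ≤ -inner ℝ (R x - R y) (x - y)) (hzer : ∃ a, R a = 0)
    {lam : ℕ → ℝ} (hlam : RelaxationSeq lam)
    {Z err : ℕ → Ω → X} (hZ : ∀ n, Measurable[ℱ n] (Z n)) (herr : ∀ n, Measurable (err n))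
    (hrec : ∀ n ω, Z (n + 1) ω = Z n ω +
      blockScale pr (fun i => (ε n ω).coeff (idx i) * lam n) (R (Z n ω) + err n ω))
    (hsum : CondSummable P ℱ fun n ω => ‖err n ω‖ₑ) :
    ∀ᵐ ω ∂P, ∃ a, R a = 0 ∧ ConvergesWeakly (fun n => Z n ω) a := by
  obtain ⟨η, hηm, hηs, hη⟩ := hsum
  obtain ⟨κ, hκ, hκle⟩ := hlam.exists_bounds
  have hRc := continuous_of_cocoercive hR
  set q : ι → ℝ := fun i => P.real {ω | (ε 0 ω).coeff (idx i) = 1} with hq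
  set S : X →L[ℝ] X := blockScale pr fun i => (√(q i))⁻¹ with hS
  -- Probabilities are at most `1`, so every weight `1 / √q i` is at least `1`.
  have hScoer : ∀ x, ‖x‖ ≤ ‖S x‖ := by
    refine hpr.le_norm_blockScale fun i => (one_le_inv₀ ?_).2 ?_
    · exact Real.sqrt_pos.2 (ENNReal.toReal_pos (hε.pos _).ne' (measure_ne_top _ _))
    · exact Real.sqrt_le_one.2 measureReal_le_one
  have hone : ∀ a, R a = 0 → ∀ᵐ ω ∂P, Tendsto (fun n => R (Z n ω)) atTop (𝓝 0) ∧
      ∃ l, Tendsto (fun n => ‖S (Z n ω - a)‖) atTop (𝓝 l) := by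
    intro a ha
    have hconv := ae_tendsto_of_almost_supermartingale (P := P) ℱ
      (D := fun n ω => ‖S (Z n ω - a)‖ₑ)
      (θ := fun n ω => ENNReal.ofReal
        (lam n * (2 - lam n) * ‖R (Z n ω)‖ ^ 2 / (2 * ‖S (Z n ω - a)‖)))
      (η := fun n ω => ‖S‖ₑ * 2 * η n ω) (fun n => ?_) (fun n => ?_)
      (fun n => (hηm n).const_mul _) (fun ω => enorm_ne_top) ?_
      (setLIntegral_norm_step_le ℱ hε hpr idx hR hlam hZ herr hrec hη hηm (fun i => rfl) hS ha)
    · filter_upwards [hconv] with ω hω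
      obtain ⟨hθ, l, hl⟩ := hω
      simp only [toReal_enorm] at hl
      refine ⟨?_, l, hl⟩
      have hθ0 := (ENNReal.tendsto_toReal ENNReal.zero_ne_top).comp
        (ENNReal.tendsto_atTop_zero_of_tsum_ne_top hθ.ne)
      -- Summability sends the quotients to `0`; multiplying by the convergent denominators recovers
      -- `‖R (Z n ω)‖² → 0`.
      have hprod := (hθ0.mul (hl.const_mul 2)).div_const κ
      simp only [ENNReal.toReal_zero, zero_mul, zero_div] at hprod
      have hsq : Tendsto (fun n => ‖R (Z n ω)‖ ^ 2) atTop (𝓝 0) := by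
        refine squeeze_zero (fun n => sq_nonneg _) (fun n => ?_) hprod
        have hb : 0 < lam n * (2 - lam n) := hκ.trans_le (hκle n)
        simp only [Function.comp_apply]
        rw [ENNReal.toReal_ofReal (by positivity), le_div_iff₀ hκ]
        -- A zero denominator makes the quotient `0` by convention, but then `Z n ω = a` and `R`
        -- vanishes there.
        rcases (norm_nonneg (S (Z n ω - a))).eq_or_lt with h0 | h0
        · have h1 := hScoer (Z n ω - a)
          rw [← h0, norm_le_zero_iff, sub_eq_zero] at h1
          rw [h1, ha]
          simp
        · rw [div_mul_cancel₀ _ (by positivity), mul_comm]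
          exact mul_le_mul_of_nonneg_right (hκle n) (sq_nonneg _)
      rw [tendsto_zero_iff_norm_tendsto_zero]
      have := hsq.sqrt
      simpa using this
    · have hc : Continuous fun x : X => ‖S (x - a)‖ₑ := by fun_prop
      exact hc.measurable.comp (hZ n)
    · have h1 : Measurable[ℱ n] fun ω => ‖R (Z n ω)‖ := hRc.norm.measurable.comp (hZ n)
      have hc : Continuous fun x : X => ‖S (x - a)‖ := by fun_prop
      have h2 : Measurable[ℱ n] fun ω => ‖S (Z n ω - a)‖ := hc.measurable.comp (hZ n)
      exact ENNReal.measurable_ofReal.comp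
        (((h1.pow_const 2).const_mul _).div (h2.const_mul 2))
    · filter_upwards [hηs] with ω hω
      rw [ENNReal.tsum_mul_left]
      exact ENNReal.mul_lt_top (ENNReal.mul_ne_top enorm_ne_top (by simp)).lt_top hω
  -- The exceptional null set in `hone` depends on `a`. Separability of the zero set leaves
  -- countably many null sets to discard.
  have : Nonempty {a // R a = 0} := nonempty_subtype.2 hzer
  set d := TopologicalSpace.denseSeq {a // R a = 0} with hd
  have hall := ae_all_iff.2 fun k => hone (d k) (d k).2
  filter_upwards [hall] with ω hω
  refine exists_weak_limit_of_fejer hR S hScoer (hω 0).1 hzer fun a ha => ?_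
  refine exists_tendsto_of_uniform_approx fun δ hδ => ?_
  obtain ⟨k, hk⟩ := Metric.denseRange_iff.1 (TopologicalSpace.denseRange_denseSeq _)
    (⟨a, ha⟩ : {a // R a = 0}) (δ / (‖S‖ + 1)) (by positivity)
  refine ⟨_, (hω k).2, fun n => ?_⟩
  refine (abs_norm_sub_norm_le _ _).trans ?_
  rw [← map_sub, sub_sub_sub_cancel_left]
  refine (S.le_opNorm _).trans ?_
  have h1 : ‖(d k : X) - a‖ ≤ δ / (‖S‖ + 1) := by
    rw [← dist_eq_norm, dist_comm]
    exact hk.le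
  calc ‖S‖ * ‖(d k : X) - a‖ ≤ (‖S‖ + 1) * (δ / (‖S‖ + 1)) := by gcongr; linarith
    _ = δ := by field_simp

end RandomBlocks

/-! ### The natural filtration -/

section History
variable {Ω : Type*} [mΩ : MeasurableSpace Ω] {A B : Type*} [MeasurableSpace A] [MeasurableSpace B]

omit mΩ in
theorem historySigma_mono (z : ℕ → Ω → A) (w : ℕ → Ω → B) : Monotone (historySigma z w) := by
  intro m n hmn
  exact biSup_mono fun l hl => le_trans hl hmn

theorem historySigma_le {z : ℕ → Ω → A} {w : ℕ → Ω → B} (hz : ∀ n, Measurable (z n))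
    (hw : ∀ n, Measurable (w n)) (n : ℕ) : historySigma z w n ≤ mΩ :=
  iSup₂_le fun l _ => sup_le (hz l).comap_le (hw l).comap_le

/-- The natural filtration of a pair of processes. -/
def historyFiltration {z : ℕ → Ω → A} {w : ℕ → Ω → B} (hz : ∀ n, Measurable (z n))
    (hw : ∀ n, Measurable (w n)) : Filtration ℕ mΩ where
  seq := historySigma z w
  mono' := historySigma_mono z w
  le' := historySigma_le hz hw

omit mΩ in
theorem measurable_historySigma_left (z : ℕ → Ω → A) (w : ℕ → Ω → B) (n : ℕ) :
    Measurable[historySigma z w n] (z n) :=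
  Measurable.of_comap_le (le_trans le_sup_left
    (le_iSup₂ (f := fun l (_ : l ∈ Set.Iic n) => (MeasurableSpace.comap (z l) inferInstance ⊔
      MeasurableSpace.comap (w l) inferInstance)) n (Set.mem_Iic.2 le_rfl)))

omit mΩ in
theorem measurable_historySigma_right (z : ℕ → Ω → A) (w : ℕ → Ω → B) (n : ℕ) :
    Measurable[historySigma z w n] (w n) :=
  Measurable.of_comap_le (le_trans le_sup_right
    (le_iSup₂ (f := fun l (_ : l ∈ Set.Iic n) => (MeasurableSpace.comap (z l) inferInstance ⊔
      MeasurableSpace.comap (w l) inferInstance)) n (Set.mem_Iic.2 le_rfl)))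

end History

/-! ### The inexact random block Douglas-Rachford iteration -/

section DouglasRachford
variable {Ω : Type*} [mΩ : MeasurableSpace Ω] {P : Measure Ω}
  {A : Type*} [NormedAddCommGroup A] [InnerProductSpace ℝ A]
  [SecondCountableTopology A] [MeasurableSpace A] [BorelSpace A]
  {B : Type*} [NormedAddCommGroup B] [InnerProductSpace ℝ B]
  [SecondCountableTopology B] [MeasurableSpace B] [BorelSpace B]
  {m : ℕ} {ε : ℕ → Ω → Activation m} {ι : Type*} [Fintype ι] {idx : ι → Fin m}
  {pr : ι → WithLp 2 (A × B) →L[ℝ] WithLp 2 (A × B)}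
  {J : WithLp 2 (A × B) → WithLp 2 (A × B)}
  {T : WithLp 2 (A × B) →L[ℝ] WithLp 2 (A × B)} {lam : ℕ → ℝ}
  {z : ℕ → Ω → A} {w : ℕ → Ω → B} {a c : ℕ → Ω → WithLp 2 (A × B)}

/-- The Douglas-Rachford iteration with random activation of the blocks, relaxation parameters
`lam` and errors `a` and `c`. -/
def IsBlockDouglasRachford (pr : ι → WithLp 2 (A × B) →L[ℝ] WithLp 2 (A × B)) (idx : ι → Fin m)
    (ε : ℕ → Ω → Activation m) (J : WithLp 2 (A × B) → WithLp 2 (A × B))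
    (T : WithLp 2 (A × B) →L[ℝ] WithLp 2 (A × B)) (lam : ℕ → ℝ)
    (z : ℕ → Ω → A) (w : ℕ → Ω → B) (a c : ℕ → Ω → WithLp 2 (A × B)) : Prop :=
  ∀ n ω, WithLp.toLp 2 (z (n + 1) ω, w (n + 1) ω) = WithLp.toLp 2 (z n ω, w n ω) +
    blockScale pr (fun i => (ε n ω).coeff (idx i) * lam n)
      (J ((2 : ℝ) • (T (WithLp.toLp 2 (z n ω, w n ω)) + a n ω) - WithLp.toLp 2 (z n ω, w n ω)) +
        c n ω - (T (WithLp.toLp 2 (z n ω, w n ω)) + a n ω))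

theorem IsBlockDouglasRachford.measurable
    (h : IsBlockDouglasRachford pr idx ε J T lam z w a c) (hJ : Continuous J)
    (hε : ∀ n, Measurable (ε n)) (hz : Measurable (z 0)) (hw : Measurable (w 0))
    (ha : ∀ n, Measurable (a n)) (hc : ∀ n, Measurable (c n)) (n : ℕ) :
    Measurable (z n) ∧ Measurable (w n) := by
  induction n with
  | zero => exact ⟨hz, hw⟩
  | succ n ih =>
    have hZ : Measurable fun ω => WithLp.toLp 2 (z n ω, w n ω) :=
      (WithLp.measurable_toLp 2 (A × B)).comp (ih.1.prodMk ih.2)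
    have hTZ := (T.continuous.measurable.comp hZ).add (ha n)
    have hv : Measurable fun ω =>
        J ((2 : ℝ) • (T (WithLp.toLp 2 (z n ω, w n ω)) + a n ω) - WithLp.toLp 2 (z n ω, w n ω)) +
        c n ω - (T (WithLp.toLp 2 (z n ω, w n ω)) + a n ω) :=
      ((hJ.measurable.comp ((hTZ.const_smul (2 : ℝ)).sub hZ)).add (hc n)).sub hTZ
    have hnext : Measurable fun ω => WithLp.toLp 2 (z (n + 1) ω, w (n + 1) ω) := by
      simp_rw [h n, blockScale_apply]
      refine hZ.add (Finset.measurable_fun_sum _ fun i _ => ?_)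
      exact ((((Activation.measurable_coeff _).comp (hε n)).mul_const _)).smul
        ((pr i).continuous.measurable.comp hv)
    have hpair := (WithLp.measurable_ofLp 2 (A × B)).comp hnext
    exact ⟨measurable_fst.comp hpair, measurable_snd.comp hpair⟩

/-- The inexact update is the exact displacement plus `err`. As `J` is nonexpansive and `a` enters
its argument doubled, `‖err‖ ≤ 3 ‖a‖ + ‖c‖`: a factor `2` through `J` and `1` from the subtracted
`a`. -/
theorem IsBlockDouglasRachford.ae_convergesWeakly [IsProbabilityMeasure P] [CompleteSpace A]
    [CompleteSpace B] (h : IsBlockDouglasRachford pr idx ε J T lam z w a c)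
    (hpr : IsBlockDecomposition pr) (hJ : FirmlyNonexpansive J) (hT : FirmlyNonexpansive T)
    (hzer : ∃ x, drDisplacement J T x = 0) (hlam : RelaxationSeq lam)
    (hε : ActivationRule P ε (historySigma z w)) (hz : ∀ n, Measurable (z n))
    (hw : ∀ n, Measurable (w n)) (ha : ∀ n, Measurable (a n)) (hc : ∀ n, Measurable (c n))
    (hasum : CondSummable P (historySigma z w) fun n ω => ‖a n ω‖ₑ)
    (hcsum : CondSummable P (historySigma z w) fun n ω => ‖c n ω‖ₑ) :
    ∀ᵐ ω ∂P, ∃ x, drDisplacement J T x = 0 ∧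
      ConvergesWeakly (fun n => WithLp.toLp 2 (z n ω, w n ω)) x := by
  set Z : ℕ → Ω → WithLp 2 (A × B) := fun n ω => WithLp.toLp 2 (z n ω, w n ω) with hZ
  have hmk : Measurable fun v : A × B => WithLp.toLp 2 v := WithLp.measurable_toLp 2 (A × B)
  have hZm : ∀ n, Measurable (Z n) := fun n => hmk.comp ((hz n).prodMk (hw n))
  have hZℱ : ∀ n, Measurable[historySigma z w n] (Z n) := fun n =>
    hmk.comp ((measurable_historySigma_left z w n).prodMk (measurable_historySigma_right z w n))
  set err : ℕ → Ω → WithLp 2 (A × B) := fun n ω =>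
    J ((2 : ℝ) • (T (Z n ω) + a n ω) - Z n ω) + c n ω - (T (Z n ω) + a n ω) -
      drDisplacement J T (Z n ω) with herr
  have herrle : ∀ n ω, ‖err n ω‖ ≤ 3 * ‖a n ω‖ + ‖c n ω‖ := by
    intro n ω
    have e : err n ω = (J ((2 : ℝ) • (T (Z n ω) + a n ω) - Z n ω) - J ((2 : ℝ) • T (Z n ω) - Z n ω))
        - a n ω + c n ω := by
      simp only [herr, drDisplacement]; abel
    have h1 := hJ.norm_sub_le ((2 : ℝ) • (T (Z n ω) + a n ω) - Z n ω) ((2 : ℝ) • T (Z n ω) - Z n ω)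
    have h2 : (2 : ℝ) • (T (Z n ω) + a n ω) - Z n ω - ((2 : ℝ) • T (Z n ω) - Z n ω) =
        (2 : ℝ) • a n ω := by module
    rw [h2, norm_smul, Real.norm_ofNat] at h1
    rw [e]
    refine (norm_add_le _ _).trans (add_le_add ((norm_sub_le _ _).trans ?_) le_rfl)
    linarith
  have hTm : ∀ n, Measurable fun ω => T (Z n ω) := fun n => T.continuous.measurable.comp (hZm n)
  have herrm : ∀ n, Measurable (err n) := fun n =>
    (((hJ.continuous.measurable.comp ((((hTm n).add (ha n)).const_smul (2 : ℝ)).sub (hZm n))).add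
      (hc n)).sub ((hTm n).add (ha n))).sub
      ((continuous_of_cocoercive (drDisplacement_cocoercive hJ hT)).measurable.comp (hZm n))
  have hle := historySigma_le hz hw
  have hsum : CondSummable P (historySigma z w) fun n ω => ‖err n ω‖ₑ := by
    refine ((hasum.const_mul (C := 3) (by simp)).add hle (fun n => (ha n).enorm.const_mul 3)
      hcsum).mono fun n ω => ?_
    have h3 : (3 : ℝ≥0∞) = ENNReal.ofReal 3 := by simp
    rw [h3, ← ofReal_norm, ← ofReal_norm, ← ofReal_norm, ← ENNReal.ofReal_mul (by norm_num),
      ← ENNReal.ofReal_add (by positivity) (norm_nonneg _)]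
    exact ENNReal.ofReal_le_ofReal (herrle n ω)
  refine ae_convergesWeakly_of_block_iteration (historyFiltration hz hw) hε hpr idx
    (drDisplacement_cocoercive hJ hT) hzer hlam hZℱ herrm (fun n ω => ?_) hsum
  simp only [hZ, herr]
  rw [h n ω, add_sub_cancel]

end DouglasRachford

/-! ### Projections onto graphs and operators with closed range -/

section Graph
variable {X Y : Type*} [NormedAddCommGroup X] [InnerProductSpace ℝ X] [CompleteSpace X]
  [NormedAddCommGroup Y] [InnerProductSpace ℝ Y] [CompleteSpace Y] (M : X →L[ℝ] Y)

theorem snd_starProjection_graphSubspace (v : WithLp 2 (X × Y)) :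
    ((graphSubspace M).starProjection v).snd = M ((graphSubspace M).starProjection v).fst :=
  (graphSubspace M).starProjection_apply_mem v

theorem inner_sub_starProjection_graphSubspace (v : WithLp 2 (X × Y)) (h : X) :
    inner ℝ (v - (graphSubspace M).starProjection v) (WithLp.toLp 2 (h, M h)) = 0 :=
  (graphSubspace M).starProjection_inner_eq_zero v _ rfl

theorem starProjection_graphSubspace_eq {v x : WithLp 2 (X × Y)} (hx : x.snd = M x.fst)
    (h : ∀ h, inner ℝ (v - x) (WithLp.toLp 2 (h, M h)) = 0) :
    (graphSubspace M).starProjection v = x := by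
  refine (graphSubspace M).eq_starProjection_of_mem_of_inner_eq_zero hx fun y hy => ?_
  have : y = WithLp.toLp 2 (y.fst, M y.fst) := by
    have h1 : y.snd = M y.fst := hy
    rw [← h1]
    rfl
  rw [this]
  exact h _

/-- An operator with closed range: the orthogonal of the kernel is the range of the adjoint. -/
theorem exists_inner_eq_of_isClosed_range (hM : IsClosed (Set.range M)) {u : X}
    (hu : ∀ h, M h = 0 → inner ℝ u h = 0) : ∃ w, ∀ h, inner ℝ u h = inner ℝ w (M h) := by
  have hcl : IsClosed (M.range : Set Y) := by
    simpa [LinearMap.coe_range] using hM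
  have : CompleteSpace M.range := hcl.completeSpace_coe
  set M' : X →L[ℝ] M.range := M.rangeRestrict with hM'
  have hM'a : ∀ x, ((M' x : M.range) : Y) = M x := fun x => rfl
  have hsurj : Function.Surjective M' := by
    rintro ⟨_, x, rfl⟩
    exact ⟨x, rfl⟩
  -- The open mapping theorem for `M` onto its closed range. Preimages of controlled norm bound the
  -- adjoint from below, so its range is closed and the closure in `ker⊥ = closure (range of the
  -- adjoint)` can be dropped.
  obtain ⟨C, hC, hpre⟩ := M'.exists_preimage_norm_le hsurj
  have hanti : AntilipschitzWith ⟨C, hC.le⟩ (ContinuousLinearMap.adjoint M') := by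
    refine AddMonoidHomClass.antilipschitz_of_bound _ fun y => ?_
    obtain ⟨x, hx, hxy⟩ := hpre y
    have h1 : ‖y‖ * ‖y‖ ≤ ‖ContinuousLinearMap.adjoint M' y‖ * ‖x‖ := by
      rw [← real_inner_self_eq_norm_mul_norm]
      conv_lhs => rw [← hx]
      rw [← ContinuousLinearMap.adjoint_inner_right, real_inner_comm, hx]
      exact real_inner_le_norm _ _
    change ‖y‖ ≤ C * _
    rcases (norm_nonneg y).eq_or_lt with h0 | h0
    · rw [← h0]; positivity
    · refine le_of_mul_le_mul_right (h1.trans ?_) h0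
      calc _ ≤ ‖ContinuousLinearMap.adjoint M' y‖ * (C * ‖y‖) := by gcongr
        _ = _ := by ring
  have hclosed := hanti.isClosed_range (ContinuousLinearMap.adjoint M').uniformContinuous
  have humem : u ∈ M'.kerᗮ := by
    rw [Submodule.mem_orthogonal']
    intro h hh
    refine hu h ?_
    rw [← hM'a, show M' h = 0 from hh]
    rfl
  rw [M'.orthogonal_ker, IsClosed.submodule_topologicalClosure_eq (by
    simpa [LinearMap.coe_range] using hclosed)] at humem
  obtain ⟨y, rfl⟩ := humem
  refine ⟨y, fun h => ?_⟩
  exact ContinuousLinearMap.adjoint_inner_left M' h y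

end Graph

/-! ### The composite problem: consensus projector and optimality conditions -/

section Composite
variable {p : ℕ} {H : Type*} [NormedAddCommGroup H] [InnerProductSpace ℝ H] [CompleteSpace H]
  {G : Fin p → Type*} [∀ k, NormedAddCommGroup (G k)] [∀ k, InnerProductSpace ℝ (G k)]
  [∀ k, CompleteSpace (G k)]
  {f : H → EReal} {g : ∀ k, G k → EReal} (L : ∀ k, H →L[ℝ] G k) {γ : ℝ}

/-- The operator `x ↦ (L 1 x, …, L p x)`. -/
def stackedOp : H →L[ℝ] PiLp 2 G :=
  (PiLp.continuousLinearEquiv 2 ℝ G).symm.toContinuousLinearMap ∘L ContinuousLinearMap.pi L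

omit [CompleteSpace H] [∀ k, CompleteSpace (G k)] in
@[simp] theorem stackedOp_apply (x : H) (k : Fin p) : stackedOp L x k = L k x := rfl

omit [CompleteSpace H] [∀ k, CompleteSpace (G k)] in
theorem mem_consensus_iff (x : DirectSumHG H G) :
    x ∈ consensus L ↔ x.snd = stackedOp L x.fst := by
  constructor
  · intro h
    ext k
    exact h k
  · intro h k
    rw [h, stackedOp_apply]

omit [CompleteSpace H] [∀ k, CompleteSpace (G k)] in
theorem inner_toLp_stackedOp (v : DirectSumHG H G) (h : H) :
    inner ℝ v (WithLp.toLp 2 (h, stackedOp L h)) =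
      inner ℝ v.fst h + ∑ k, inner ℝ (v.snd k) (L k h) := by
  rw [WithLp.prod_inner_apply, PiLp.inner_apply]
  rfl

/-- The projector onto the subspace of all `(x, L 1 x, …, L p x)`. -/
def consensusProj : DirectSumHG H G →L[ℝ] DirectSumHG H G :=
  (graphSubspace (stackedOp L)).starProjection

theorem firmlyNonexpansive_consensusProj : FirmlyNonexpansive (consensusProj L) :=
  firmlyNonexpansive_starProjection _

/-- The normal equation of the projection: the residual of `v` is orthogonal to every `(h, L h)`.
Inverting it gives the formula with `resolventQ`. -/
theorem normalOp_fst_consensusProj (v : DirectSumHG H G) :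
    (ContinuousLinearMap.id ℝ H + ∑ k, (ContinuousLinearMap.adjoint (L k)).comp (L k))
      (consensusProj L v).fst = v.fst + ∑ k, ContinuousLinearMap.adjoint (L k) (v.snd k) := by
  refine ext_inner_right ℝ fun h => ?_
  have h1 := inner_sub_starProjection_graphSubspace (stackedOp L) v h
  have h2 := snd_starProjection_graphSubspace (stackedOp L) v
  change inner ℝ (v - consensusProj L v) _ = 0 at h1
  change (consensusProj L v).snd = _ at h2
  rw [inner_toLp_stackedOp, WithLp.sub_fst, WithLp.sub_snd, h2] at h1
  simp only [PiLp.sub_apply, inner_sub_left, Finset.sum_sub_distrib] at h1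
  simp only [add_apply, ContinuousLinearMap.coe_id', id_eq, inner_add_left,
    sum_apply, ContinuousLinearMap.comp_apply, sum_inner,
    ContinuousLinearMap.adjoint_inner_left]
  change inner ℝ v.fst h - inner ℝ (consensusProj L v).fst h + (∑ k, inner ℝ (v.snd k) (L k h) -
    ∑ k, inner ℝ (L k (consensusProj L v).fst) (L k h)) = 0 at h1
  linarith

/-- Injectivity comes from `⟨N x, x⟩ ≥ ‖x‖²`. For surjectivity, the normal equation for the
projection of `(x, 0)` exhibits a preimage of `x`. -/
theorem exists_equiv_normalOp : ∃ e : H ≃L[ℝ] H, (e : H →L[ℝ] H) =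
    ContinuousLinearMap.id ℝ H + ∑ k, (ContinuousLinearMap.adjoint (L k)).comp (L k) := by
  set N := ContinuousLinearMap.id ℝ H + ∑ k, (ContinuousLinearMap.adjoint (L k)).comp (L k) with hN
  refine ⟨ContinuousLinearEquiv.ofBijective N ?_ ?_, ContinuousLinearEquiv.coe_ofBijective _ _ _⟩
  · refine LinearMap.ker_eq_bot'.2 fun x hx => ?_
    have h1 : inner ℝ (N x) x = 0 := by
      rw [show N x = 0 from hx, inner_zero_left]
    simp only [hN, add_apply, ContinuousLinearMap.coe_id', id_eq,
      inner_add_left, sum_apply, ContinuousLinearMap.comp_apply, sum_inner,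
      ContinuousLinearMap.adjoint_inner_left, real_inner_self_eq_norm_sq] at h1
    have h2 : 0 ≤ ∑ k, ‖L k x‖ ^ 2 := Finset.sum_nonneg fun k _ => sq_nonneg _
    have h3 : ‖x‖ ^ 2 = 0 := le_antisymm (by linarith) (sq_nonneg _)
    exact norm_eq_zero.1 (pow_eq_zero_iff two_ne_zero |>.1 h3)
  · refine LinearMap.range_eq_top.2 fun x => ⟨(consensusProj L (WithLp.toLp 2 (x, 0))).fst, ?_⟩
    refine (normalOp_fst_consensusProj L _).trans ?_
    simp

theorem fst_consensusProj (v : DirectSumHG H G) : (consensusProj L v).fst =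
    resolventQ L (v.fst + ∑ k, ContinuousLinearMap.adjoint (L k) (v.snd k)) := by
  obtain ⟨e, he⟩ := exists_equiv_normalOp L
  rw [← normalOp_fst_consensusProj, resolventQ, ← he, ContinuousLinearMap.inverse_equiv]
  simp

theorem snd_consensusProj (v : DirectSumHG H G) :
    (consensusProj L v).snd = stackedOp L (consensusProj L v).fst :=
  snd_starProjection_graphSubspace _ v

/-- The proximity operator of the separable function `(x, y) ↦ γ f x + ∑ γ g k (y k)`. -/
def blockProx (f : H → EReal) (g : ∀ k, G k → EReal) (γ : ℝ) : DirectSumHG H G → DirectSumHG H G :=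
  prodOp (prox (scaled γ f)) fun y : PiLp 2 G => WithLp.toLp 2 fun k => prox (scaled γ (g k)) (y k)

theorem exists_subgradients (hzer : (zerComposite f g L).Nonempty) :
    ∃ x u, ∃ v : ∀ k, G k, u ∈ subdiff f x ∧ (∀ k, v k ∈ subdiff (g k) (L k x)) ∧
      u + ∑ k, ContinuousLinearMap.adjoint (L k) (v k) = 0 := by
  obtain ⟨x, hx⟩ := hzer
  obtain ⟨u, hu, s, hs, hus⟩ := Set.mem_add.1 (show (0 : H) ∈ subdiff f x + _ from hx)
  obtain ⟨t, ht, rfl⟩ := Set.mem_finsetSum _ _ _ |>.1 hs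
  choose v hv hvt using fun k => ht (Finset.mem_univ k)
  refine ⟨x, u, v, hu, hv, ?_⟩
  simp only [hvt]
  exact hus

variable (hf : IsGammaZero f) (hg : ∀ k, IsGammaZero (g k)) (hzer : (zerComposite f g L).Nonempty)
  (hγ : 0 < γ)
include hf hg hzer hγ

theorem firmlyNonexpansive_blockProx : FirmlyNonexpansive (blockProx f g γ) := by
  obtain ⟨x, u, v, hu, hv, -⟩ := exists_subgradients L hzer
  exact (hf.firmlyNonexpansive_prox_scaled ⟨x, u, hu⟩ hγ).prod
    (.pi fun k => (hg k).firmlyNonexpansive_prox_scaled ⟨_, v k, hv k⟩ hγ)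

/-- A primal-dual solution: `u` is `γ` times the subgradients that sum to zero in the inclusion, so
it is orthogonal to the consensus subspace. The zeros of the three displacements are all built from
`x` and `u`. -/
theorem exists_blockProx_eq : ∃ x u : DirectSumHG H G, x.snd = stackedOp L x.fst ∧
    (∀ h, inner ℝ u (WithLp.toLp 2 (h, stackedOp L h)) = 0) ∧ blockProx f g γ (x + u) = x := by
  obtain ⟨x, u, v, hu, hv, huv⟩ := exists_subgradients L hzer
  refine ⟨WithLp.toLp 2 (x, stackedOp L x), γ • WithLp.toLp 2 (u, WithLp.toLp 2 v), rfl,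
    fun h => ?_, ?_⟩
  · rw [real_inner_smul_left, inner_toLp_stackedOp]
    have h1 : inner ℝ (u + ∑ k, ContinuousLinearMap.adjoint (L k) (v k)) h = 0 := by
      rw [huv, inner_zero_left]
    simp only [inner_add_left, sum_inner, ContinuousLinearMap.adjoint_inner_left] at h1
    exact mul_eq_zero_of_right _ h1
  · have h1 : prox (scaled γ f) (x + γ • u) = x :=
      (hf.prox_scaled_eq_iff ⟨x, u, hu⟩ hγ).2 (by
        rwa [add_sub_cancel_left, inv_smul_smul₀ hγ.ne'])
    have h2 : ∀ k, prox (scaled γ (g k)) (L k x + γ • v k) = L k x := fun k =>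
      ((hg k).prox_scaled_eq_iff ⟨_, v k, hv k⟩ hγ).2 (by
        rw [add_sub_cancel_left, inv_smul_smul₀ hγ.ne']; exact hv k)
    change WithLp.toLp 2 (prox (scaled γ f) (x + γ • u),
      WithLp.toLp 2 fun k => prox (scaled γ (g k)) (L k x + γ • v k)) = _
    rw [h1]
    simp only [h2]
    rfl

/-- `γ⁻¹ • (v - x)` consists of subgradients of `f` and the `g k` at the components of `x`. When the
subgradient inequalities are added at a competitor `(h, L h)`, orthogonality cancels the inner
products. -/
theorem fst_mem_argminSet {x v : DirectSumHG H G} (hx : x.snd = stackedOp L x.fst)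
    (hv : blockProx f g γ v = x)
    (hort : ∀ h, inner ℝ (v - x) (WithLp.toLp 2 (h, stackedOp L h)) = 0) :
    x.fst ∈ argminSet fun h => f h + ∑ k, g k (L k h) := by
  obtain ⟨x', u', v', hu', hv', -⟩ := exists_subgradients L hzer
  have h1 : γ⁻¹ • (v.fst - x.fst) ∈ subdiff f x.fst :=
    (hf.prox_scaled_eq_iff ⟨x', u', hu'⟩ hγ).1 (congrArg (fun t => t.fst) hv)
  have h2 : ∀ k, γ⁻¹ • (v.snd k - L k x.fst) ∈ subdiff (g k) (L k x.fst) := fun k => by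
    have h3 := ((hg k).prox_scaled_eq_iff ⟨_, v' k, hv' k⟩ hγ).1
      (congrArg (fun t => t.snd k) hv)
    rwa [hx, stackedOp_apply] at h3
  intro h
  have h3 := hort (h - x.fst)
  rw [inner_toLp_stackedOp, WithLp.sub_fst, WithLp.sub_snd, hx] at h3
  have h4 : inner ℝ (h - x.fst) (γ⁻¹ • (v.fst - x.fst)) +
      ∑ k, inner ℝ (L k h - L k x.fst) (γ⁻¹ • (v.snd k - L k x.fst)) = 0 := by
    simp only [real_inner_smul_right, ← Finset.mul_sum, ← mul_add]
    refine mul_eq_zero_of_right _ ?_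
    rw [← h3, real_inner_comm]
    congr 1
    refine Finset.sum_congr rfl fun k _ => ?_
    rw [real_inner_comm, map_sub]
    rfl
  calc f x.fst + ∑ k, g k (L k x.fst)
      = ((inner ℝ (h - x.fst) (γ⁻¹ • (v.fst - x.fst)) +
          ∑ k, inner ℝ (L k h - L k x.fst) (γ⁻¹ • (v.snd k - L k x.fst)) : ℝ) : EReal) +
          (f x.fst + ∑ k, g k (L k x.fst)) := by rw [h4, EReal.coe_zero, zero_add]
    _ = ((inner ℝ (h - x.fst) (γ⁻¹ • (v.fst - x.fst)) : ℝ) + f x.fst) +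
          ∑ k, (((inner ℝ (L k h - L k x.fst) (γ⁻¹ • (v.snd k - L k x.fst)) : ℝ) : EReal) +
            g k (L k x.fst)) := by
        have hcoe : ∀ r : Fin p → ℝ, ((∑ k, r k : ℝ) : EReal) = ∑ k, (r k : EReal) := fun r =>
          map_sum (⟨⟨Real.toEReal, EReal.coe_zero⟩, EReal.coe_add⟩ : ℝ →+ EReal) r Finset.univ
        rw [EReal.coe_add, Finset.sum_add_distrib, hcoe, add_add_add_comm]
    _ ≤ f h + ∑ k, g k (L k h) :=
        add_le_add (h1 h) (Finset.sum_le_sum fun k _ => h2 k (L k h))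

theorem argminSet_nonempty : (argminSet fun h => f h + ∑ k, g k (L k h)).Nonempty := by
  obtain ⟨x, u, hx, hu, hxu⟩ := exists_blockProx_eq L hf hg hzer hγ
  exact ⟨x.fst, fst_mem_argminSet L hf hg hzer hγ hx hxu (by simpa using hu)⟩

end Composite

/-! ### Combination of errors; stored values -/

section ErrorSums
variable {Ω : Type*} [mΩ : MeasurableSpace Ω] {P : Measure Ω}
  {A B : Type*} [NormedAddCommGroup A] [InnerProductSpace ℝ A] [NormedAddCommGroup B]
  [InnerProductSpace ℝ B]

omit [InnerProductSpace ℝ A] [InnerProductSpace ℝ B] in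
theorem enorm_toLp_prod_le (a : A) (b : B) : ‖WithLp.toLp 2 (a, b)‖ₑ ≤ ‖a‖ₑ + ‖b‖ₑ := by
  have h : ‖WithLp.toLp 2 (a, b)‖ ≤ ‖a‖ + ‖b‖ := by
    have h1 := WithLp.prod_norm_sq_eq_of_L2 (WithLp.toLp 2 (a, b))
    refine le_of_sq_le_sq ?_ (by positivity)
    rw [h1]
    change ‖a‖ ^ 2 + ‖b‖ ^ 2 ≤ _
    nlinarith [norm_nonneg a, norm_nonneg b, mul_nonneg (norm_nonneg a) (norm_nonneg b)]
  rw [← ofReal_norm, ← ofReal_norm, ← ofReal_norm, ← ENNReal.ofReal_add (norm_nonneg _)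
    (norm_nonneg _)]
  exact ENNReal.ofReal_le_ofReal h

omit [InnerProductSpace ℝ A] [InnerProductSpace ℝ B] in
theorem CondSummable.enorm_toLp [MeasurableSpace A] [OpensMeasurableSpace A]
    {𝓢 : ℕ → MeasurableSpace Ω} (h𝓢 : ∀ n, 𝓢 n ≤ mΩ)
    {a : ℕ → Ω → A} {b : ℕ → Ω → B} (ham : ∀ n, Measurable (a n))
    (ha : CondSummable P 𝓢 fun n ω => ‖a n ω‖ₑ) (hb : CondSummable P 𝓢 fun n ω => ‖b n ω‖ₑ) :
    CondSummable P 𝓢 fun n ω => ‖WithLp.toLp 2 (a n ω, b n ω)‖ₑ :=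
  (ha.add h𝓢 (fun n => (ham n).enorm) hb).mono fun _ _ => enorm_toLp_prod_le _ _

theorem CondSummable.enorm_clm {𝓢 : ℕ → MeasurableSpace Ω} {a : ℕ → Ω → A}
    (ha : CondSummable P 𝓢 fun n ω => ‖a n ω‖ₑ) (T : A →L[ℝ] B) :
    CondSummable P 𝓢 fun n ω => ‖T (a n ω)‖ₑ :=
  (ha.const_mul (C := ‖T‖ₑ) enorm_ne_top).mono fun _ _ => T.le_opENorm _

omit [InnerProductSpace ℝ A] in
theorem condSummable_enorm_zero {𝓢 : ℕ → MeasurableSpace Ω} :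
    CondSummable P 𝓢 fun _ _ => ‖(0 : A)‖ₑ :=
  ⟨fun _ _ => 0, fun _ => measurable_const, by simp, by simp⟩

theorem measurable_of_memory [MeasurableSpace A] [BorelSpace A] [SecondCountableTopology A]
    {m : ℕ} {ε : ℕ → Ω → Activation m} (hε : ∀ n, Measurable (ε n)) (i : Fin m)
    {x s : ℕ → Ω → A} (hx : Measurable (x 0)) (hs : ∀ n, Measurable (s n))
    (hrec : ∀ n ω, x (n + 1) ω = x n ω + (ε n ω).coeff i • (s n ω - x n ω)) (n : ℕ) :
    Measurable (x n) := by
  induction n with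
  | zero => exact hx
  | succ n ih =>
    have h : x (n + 1) = fun ω => x n ω + (ε n ω).coeff i • (s n ω - x n ω) := funext (hrec n)
    rw [h]
    exact ih.add (((Activation.measurable_coeff i).comp (hε n)).smul ((hs n).sub ih))

/-- Almost sure weak convergence of a variable that stores the last activated value of a weakly
convergent process. -/
theorem convergesWeaklyAsTo_of_memory [MeasurableSpace A] [BorelSpace A]
    [SecondCountableTopology A] [CompleteSpace A] [IsProbabilityMeasure P] [P.IsComplete]
    {m : ℕ} {ε : ℕ → Ω → Activation m} {𝓢 : ℕ → MeasurableSpace Ω} (hε : ActivationRule P ε 𝓢)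
    (i : Fin m) {x s : ℕ → Ω → A} (hx : Measurable (x 0)) (hs : ∀ n, Measurable (s n))
    (hrec : ∀ n ω, x (n + 1) ω = x n ω + (ε n ω).coeff i • (s n ω - x n ω)) {S : Set A}
    (hS : S.Nonempty) (h : ∀ᵐ ω ∂P, ∃ l ∈ S, ConvergesWeakly (fun n => s n ω) l) :
    ConvergesWeaklyAsTo P x S := by
  refine convergesWeaklyAsTo_of_ae (measurable_of_memory hε.measurable i hx hs hrec) hS ?_
  filter_upwards [h, hε.ae_frequently i] with ω h1 h2
  obtain ⟨l, hl, hlim⟩ := h1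
  exact ⟨l, hl, hlim.of_memory (fun n => (ε n ω).coeff_eq_zero_or_one i) h2 fun n => hrec n ω⟩

end ErrorSums

/-! ### The blocks of `H ⊕ G` -/

section Coordinates
variable {p : ℕ} {H : Type*} [NormedAddCommGroup H] [InnerProductSpace ℝ H]
  {G : Fin p → Type*} [∀ k, NormedAddCommGroup (G k)] [∀ k, InnerProductSpace ℝ (G k)]

omit [NormedAddCommGroup H] [InnerProductSpace ℝ H] [∀ k, NormedAddCommGroup (G k)]
  [∀ k, InnerProductSpace ℝ (G k)] in
theorem DirectSumHG.ext {x y : DirectSumHG H G} (h1 : x.fst = y.fst)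
    (h2 : ∀ k, x.snd k = y.snd k) : x = y := by
  have h3 : x.snd = y.snd := by
    ext k
    exact h2 k
  have h4 : WithLp.toLp 2 (x.fst, x.snd) = WithLp.toLp 2 (y.fst, y.snd) := by rw [h1, h3]
  exact h4

/-- The blocks `H, G 1, …, G p` of the direct sum. -/
def directSumBlock : Unit ⊕ Fin p → DirectSumHG H G →L[ℝ] DirectSumHG H G :=
  prodBlock (fun _ => ContinuousLinearMap.id ℝ H) piBlock

theorem isBlockDecomposition_directSumBlock :
    IsBlockDecomposition (directSumBlock (H := H) (G := G)) :=
  isBlockDecomposition_id.prod isBlockDecomposition_piBlock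

theorem blockScale_directSumBlock_fst (τ : Unit ⊕ Fin p → ℝ) (x : DirectSumHG H G) :
    (blockScale directSumBlock τ x).fst = τ (Sum.inl ()) • x.fst := by
  rw [directSumBlock, blockScale_prodBlock]
  change blockScale (fun _ : Unit => ContinuousLinearMap.id ℝ H) _ x.fst = _
  rw [blockScale_apply]
  simp

theorem blockScale_directSumBlock_snd (τ : Unit ⊕ Fin p → ℝ) (x : DirectSumHG H G) (k : Fin p) :
    (blockScale directSumBlock τ x).snd k = τ (Sum.inr k) • x.snd k := by
  rw [directSumBlock, blockScale_prodBlock]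
  exact blockScale_piBlock_apply _ _ _

end Coordinates

/-! ### First algorithm: projection onto `{(x, L x)}` -/

section FirstAlgorithm
variable {Ω : Type*} [mΩ : MeasurableSpace Ω] {P : Measure Ω}
  {p : ℕ} {H : Type*} [NormedAddCommGroup H] [InnerProductSpace ℝ H] [CompleteSpace H]
  [SecondCountableTopology H] [MeasurableSpace H] [BorelSpace H]
  {G : Fin p → Type*} [∀ k, NormedAddCommGroup (G k)] [∀ k, InnerProductSpace ℝ (G k)]
  [∀ k, CompleteSpace (G k)] [∀ k, SecondCountableTopology (G k)] [∀ k, MeasurableSpace (G k)]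
  [∀ k, BorelSpace (G k)] {f : H → EReal} {g : ∀ k, G k → EReal} {L : ∀ k, H →L[ℝ] G k}
  {γ : ℝ} {lam : ℕ → ℝ} {x z s c e : ℕ → Ω → H} {y w d : ℕ → Ω → PiLp 2 G}
  {ε : ℕ → Ω → Activation (p + 1)}

omit [SecondCountableTopology H] [BorelSpace H] [∀ k, SecondCountableTopology (G k)]
  [∀ k, BorelSpace (G k)] in
theorem Framework1.eq_consensusProj (h : Framework1 P f g L γ lam x z s c e y w d ε) (n : ℕ)
    (ω : Ω) : s n ω = (consensusProj L (WithLp.toLp 2 (z n ω, w n ω))).fst + e n ω := by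
  rw [h.step_s, fst_consensusProj]
  rfl

-- In each block, a zero coefficient freezes `z` or `w`, and a unit coefficient makes the stored `x`
-- or `y` equal to the fresh `s n` or `L k (s n)`. The single error `e n` perturbs the projection by
-- `(e n, L (e n))`.
omit [SecondCountableTopology H] [BorelSpace H] [∀ k, SecondCountableTopology (G k)]
  [∀ k, BorelSpace (G k)] in
theorem Framework1.isBlockDouglasRachford (h : Framework1 P f g L γ lam x z s c e y w d ε) :
    IsBlockDouglasRachford (A := H) (B := PiLp 2 G) directSumBlock
      (Sum.elim (fun _ => (0 : Fin (p + 1))) Fin.succ) ε (blockProx f g γ)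
      (consensusProj L) lam z w (fun n ω => WithLp.toLp 2 (e n ω, stackedOp L (e n ω)))
      (fun n ω => WithLp.toLp 2 (c n ω, d n ω)) := by
  intro n ω
  have hs := h.eq_consensusProj n ω
  have hsL : ∀ k, L k (s n ω) =
      ((consensusProj L (WithLp.toLp 2 (z n ω, w n ω))).snd + stackedOp L (e n ω)) k := by
    intro k
    rw [hs, map_add, snd_consensusProj]
    rfl
  refine DirectSumHG.ext ?_ fun k => ?_
  · rw [WithLp.add_fst, blockScale_directSumBlock_fst]
    change z (n + 1) ω = z n ω + ((ε n ω).coeff 0 * lam n) • (prox (scaled γ f)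
      ((2 : ℝ) • ((consensusProj L (WithLp.toLp 2 (z n ω, w n ω))).fst + e n ω) - z n ω) + c n ω -
        ((consensusProj L (WithLp.toLp 2 (z n ω, w n ω))).fst + e n ω))
    rw [h.step_z, h.step_x, ← hs]
    rcases (ε n ω).coeff_eq_zero_or_one 0 with h0 | h0
    · simp [h0]
    · simp [h0]
  · rw [WithLp.add_snd, PiLp.add_apply, blockScale_directSumBlock_snd]
    change w (n + 1) ω k = w n ω k + ((ε n ω).coeff k.succ * lam n) • (prox (scaled γ (g k))
      ((2 : ℝ) • ((consensusProj L (WithLp.toLp 2 (z n ω, w n ω))).snd +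
        stackedOp L (e n ω)) k - w n ω k) + d n ω k -
        ((consensusProj L (WithLp.toLp 2 (z n ω, w n ω))).snd + stackedOp L (e n ω)) k)
    rw [h.step_w, h.step_y, ← hsL]
    rcases (ε n ω).coeff_eq_zero_or_one k.succ with h0 | h0
    · simp [h0]
    · simp [h0]

theorem Framework1.convergesWeaklyAsTo [IsProbabilityMeasure P] [P.IsComplete]
    (h : Framework1 P f g L γ lam x z s c e y w d ε) (hf : IsGammaZero f)
    (hg : ∀ k, IsGammaZero (g k)) (hzer : (zerComposite f g L).Nonempty) (hγ : 0 < γ)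
    (hlam : RelaxationSeq lam) :
    ConvergesWeaklyAsTo P x (argminSet fun h => f h + ∑ k, g k (L k h)) := by
  have hJ := firmlyNonexpansive_blockProx L hf hg hzer hγ
  have hT := firmlyNonexpansive_consensusProj L
  have hmk : Measurable fun v : H × PiLp 2 G => WithLp.toLp 2 v := WithLp.measurable_toLp 2 _
  have hem : ∀ n, Measurable fun ω => stackedOp L (e n ω) := fun n =>
    (stackedOp L).continuous.measurable.comp (h.meas_e n)
  have ha : ∀ n, Measurable fun ω => WithLp.toLp 2 (e n ω, stackedOp L (e n ω)) := fun n =>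
    hmk.comp ((h.meas_e n).prodMk (hem n))
  have hc : ∀ n, Measurable fun ω => WithLp.toLp 2 (c n ω, d n ω) := fun n =>
    hmk.comp ((h.meas_c n).prodMk (h.meas_d n))
  have hDR := h.isBlockDouglasRachford
  have hzw := hDR.measurable hJ.continuous h.activation.measurable h.meas_z h.meas_w ha hc
  have hle := historySigma_le (fun n => (hzw n).1) fun n => (hzw n).2
  have hesum := h.err_e.condSummable hle h.meas_e
  -- At `q - u` the projection is `q`, the reflected point is `q + u`, and the proximity operator
  -- sends it back to `q`.
  have hzero : ∃ v, drDisplacement (blockProx f g γ) (consensusProj L) v = 0 := by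
    obtain ⟨q, u, hq, hu, hqu⟩ := exists_blockProx_eq L hf hg hzer hγ
    have hproj : consensusProj L (q - u) = q := by
      refine starProjection_graphSubspace_eq _ hq fun h => ?_
      rw [sub_sub_cancel_left, inner_neg_left, hu, neg_zero]
    refine ⟨q - u, ?_⟩
    rw [drDisplacement, hproj, show (2 : ℝ) • q - (q - u) = q + u by module, hqu, sub_self]
  have hconv := hDR.ae_convergesWeakly isBlockDecomposition_directSumBlock hJ hT hzero hlam
    h.activation (fun n => (hzw n).1) (fun n => (hzw n).2) ha hc
    (hesum.enorm_toLp hle h.meas_e (hesum.enorm_clm _))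
    ((h.err_c.condSummable hle h.meas_c).enorm_toLp hle h.meas_c
      (h.err_d.condSummable hle h.meas_d))
  refine convergesWeaklyAsTo_of_memory h.activation 0 h.meas_x (fun n => ?_) h.step_x
    (argminSet_nonempty L hf hg hzer hγ) ?_
  · have : s n = fun ω =>
        WithLp.fstL 2 ℝ H (PiLp 2 G) (consensusProj L (WithLp.toLp 2 (z n ω, w n ω))) + e n ω :=
      funext (h.eq_consensusProj n)
    rw [this]
    exact (((WithLp.fstL 2 ℝ H (PiLp 2 G)).continuous.measurable.comp
      ((consensusProj L).continuous.measurable.comp (hmk.comp ((hzw n).1.prodMk (hzw n).2))))).add (h.meas_e n)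
  · filter_upwards [hconv, h.weak_e] with ω h1 h2
    obtain ⟨v, hv, hlim⟩ := h1
    refine ⟨(consensusProj L v).fst, ?_, ?_⟩
    · refine fst_mem_argminSet L hf hg hzer hγ (snd_consensusProj L v) (sub_eq_zero.1 hv)
        fun h => ?_
      rw [show (2 : ℝ) • consensusProj L v - v - consensusProj L v = -(v - consensusProj L v) by
        module, inner_neg_left]
      exact neg_eq_zero.2 (inner_sub_starProjection_graphSubspace _ v h)
    -- Bounded linear operators preserve weak limits, and the additive error `e` vanishes weakly.
    · have h3 := (hlim.map (WithLp.fstL 2 ℝ H (PiLp 2 G) ∘L consensusProj L)).add h2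
      rw [add_zero] at h3
      simp only [h.eq_consensusProj _ ω]
      exact h3

end FirstAlgorithm

/-! ### Projection onto the diagonal -/

section Averaging
variable {D : Type*} [NormedAddCommGroup D] [InnerProductSpace ℝ D]

/-- The projector `(z, v) ↦ ((z + v) / 2, (z + v) / 2)` onto the diagonal. -/
def diagonalProj (D : Type*) [NormedAddCommGroup D] [InnerProductSpace ℝ D] :
    WithLp 2 (D × D) →L[ℝ] WithLp 2 (D × D) :=
  (WithLp.prodContinuousLinearEquiv 2 ℝ D D).symm.toContinuousLinearMap ∘L
    (((1 / 2 : ℝ) • (WithLp.fstL 2 ℝ D D + WithLp.sndL 2 ℝ D D)).prod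
      ((1 / 2 : ℝ) • (WithLp.fstL 2 ℝ D D + WithLp.sndL 2 ℝ D D)))

theorem diagonalProj_apply (x : WithLp 2 (D × D)) : diagonalProj D x =
    WithLp.toLp 2 ((1 / 2 : ℝ) • (x.fst + x.snd), (1 / 2 : ℝ) • (x.fst + x.snd)) := rfl

theorem firmlyNonexpansive_diagonalProj : FirmlyNonexpansive (diagonalProj D) := by
  intro x y
  rw [← map_sub, diagonalProj_apply, WithLp.prod_norm_sq_eq_of_L2, WithLp.prod_inner_apply]
  set a := (x - y).fst
  set b := (x - y).snd
  change ‖(1 / 2 : ℝ) • (a + b)‖ ^ 2 + ‖(1 / 2 : ℝ) • (a + b)‖ ^ 2 ≤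
    inner ℝ ((1 / 2 : ℝ) • (a + b)) a + inner ℝ ((1 / 2 : ℝ) • (a + b)) b
  rw [← inner_add_right, real_inner_smul_left, real_inner_self_eq_norm_sq, norm_smul, mul_pow]
  norm_num
  linarith

end Averaging

/-! ### Second algorithm: averaging in the product of two copies of `H ⊕ G` -/

section SecondAlgorithm
variable {Ω : Type*} [mΩ : MeasurableSpace Ω] {P : Measure Ω}
  {p : ℕ} {H : Type*} [NormedAddCommGroup H] [InnerProductSpace ℝ H] [CompleteSpace H]
  [SecondCountableTopology H] [MeasurableSpace H] [BorelSpace H]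
  {G : Fin p → Type*} [∀ k, NormedAddCommGroup (G k)] [∀ k, InnerProductSpace ℝ (G k)]
  [∀ k, CompleteSpace (G k)] [∀ k, SecondCountableTopology (G k)] [∀ k, MeasurableSpace (G k)]
  [∀ k, BorelSpace (G k)] {f : H → EReal} {g : ∀ k, G k → EReal} {L : ∀ k, H →L[ℝ] G k}
  {γ : ℝ} {lam : ℕ → ℝ} {x z u v c : ℕ → Ω → DirectSumHG H G} {s e : ℕ → Ω → H}
  {ε : ℕ → Ω → Activation (p + 2)}

-- The copy `v` is a single block driven by the last activation index, where `J` acts as the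
-- consensus projector. The averaging is exact, so `e` joins `c` as an error on the value of `J`.
omit [SecondCountableTopology H] [BorelSpace H] [∀ k, SecondCountableTopology (G k)]
  [∀ k, BorelSpace (G k)] in
theorem Framework2.isBlockDouglasRachford (h : Framework2 P f g L γ lam x z u v c s e ε) :
    IsBlockDouglasRachford (A := DirectSumHG H G) (B := DirectSumHG H G)
      (prodBlock directSumBlock fun _ : Unit => ContinuousLinearMap.id ℝ (DirectSumHG H G))
      (Sum.elim (Sum.elim (fun _ => (0 : Fin (p + 2))) fun k => k.succ.castSucc)
        fun _ => Fin.last (p + 1)) ε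
      (prodOp (blockProx f g γ) (consensusProj L)) (diagonalProj (DirectSumHG H G)) lam z v
      (fun _ _ => 0)
      (fun n ω => WithLp.toLp 2 (c n ω, WithLp.toLp 2 (e n ω, stackedOp L (e n ω)))) := by
  intro n ω
  rw [blockScale_prodBlock, add_zero, diagonalProj_apply]
  set b := (1 / 2 : ℝ) • (z n ω + v n ω) with hb
  have hz : z (n + 1) ω = z n ω + blockScale directSumBlock
      (fun i => (ε n ω).coeff (Sum.elim (fun _ => (0 : Fin (p + 2))) (fun k => k.succ.castSucc) i) *
        lam n) (blockProx f g γ ((2 : ℝ) • b - z n ω) + c n ω - b) := by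
    refine DirectSumHG.ext ?_ fun k => ?_
    · rw [WithLp.add_fst, blockScale_directSumBlock_fst, h.step_z_fst, h.step_x_fst]
      change _ = (z n ω).fst + ((ε n ω).coeff 0 * lam n) • (prox (scaled γ f)
        ((2 : ℝ) • ((1 / 2 : ℝ) • ((z n ω).fst + (v n ω).fst)) - (z n ω).fst) + (c n ω).fst -
          (1 / 2 : ℝ) • ((z n ω).fst + (v n ω).fst))
      rcases (ε n ω).coeff_eq_zero_or_one 0 with h0 | h0
      · rw [h0, zero_mul, zero_smul, zero_smul]
      · rw [h0, one_smul, add_sub_cancel]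
    · rw [WithLp.add_snd, PiLp.add_apply, blockScale_directSumBlock_snd, h.step_z_snd,
        h.step_x_snd]
      change _ = (z n ω).snd k + ((ε n ω).coeff k.succ.castSucc * lam n) • (prox (scaled γ (g k))
        ((2 : ℝ) • ((1 / 2 : ℝ) • ((z n ω).snd k + (v n ω).snd k)) - (z n ω).snd k) +
          (c n ω).snd k - (1 / 2 : ℝ) • ((z n ω).snd k + (v n ω).snd k))
      rcases (ε n ω).coeff_eq_zero_or_one k.succ.castSucc with h0 | h0
      · rw [h0, zero_mul, zero_smul, zero_smul]
      · rw [h0, one_smul, add_sub_cancel]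
  have hv : v (n + 1) ω = v n ω + ((ε n ω).coeff (Fin.last (p + 1)) * lam n) •
      (consensusProj L ((2 : ℝ) • b - v n ω) + WithLp.toLp 2 (e n ω, stackedOp L (e n ω)) - b) := by
    rcases (ε n ω).coeff_eq_zero_or_one (Fin.last (p + 1)) with h0 | h0
    · refine DirectSumHG.ext ?_ fun k => ?_
      · rw [h.step_v_fst, h0, zero_mul, zero_smul, zero_smul, add_zero, add_zero]
      · rw [h.step_v_snd, h0, zero_mul, zero_smul, zero_smul, add_zero, add_zero]
    · have hu : u (n + 1) ω = b := by rw [h.step_u, h0, one_smul, add_sub_cancel]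
      have hs : s n ω = (consensusProj L ((2 : ℝ) • b - v n ω)).fst + e n ω := by
        rw [h.step_s, h0, one_smul, hu, fst_consensusProj]
        rfl
      have hsL : ∀ k, L k (s n ω) = ((consensusProj L ((2 : ℝ) • b - v n ω)).snd +
          stackedOp L (e n ω)) k := by
        intro k
        rw [hs, map_add, snd_consensusProj]
        rfl
      refine DirectSumHG.ext ?_ fun k => ?_
      · rw [h.step_v_fst, hu, hs]
        rfl
      · rw [h.step_v_snd, hu, hsL]
        rfl
  rw [hz, hv]
  have hid : ∀ (τ : Unit → ℝ) (t : DirectSumHG H G),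
      blockScale (fun _ : Unit => ContinuousLinearMap.id ℝ (DirectSumHG H G)) τ t = τ () • t := by
    intro τ t
    simp [blockScale_apply]
  rw [hid]
  rfl

theorem Framework2.convergesWeaklyAsTo [IsProbabilityMeasure P] [P.IsComplete]
    (h : Framework2 P f g L γ lam x z u v c s e ε) (hf : IsGammaZero f)
    (hg : ∀ k, IsGammaZero (g k)) (hzer : (zerComposite f g L).Nonempty) (hγ : 0 < γ)
    (hlam : RelaxationSeq lam) :
    ConvergesWeaklyAsTo P (fun n ω => (x n ω).fst)
      (argminSet fun h => f h + ∑ k, g k (L k h)) := by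
  have hJ := (firmlyNonexpansive_blockProx L hf hg hzer hγ).prod
    (firmlyNonexpansive_consensusProj L)
  have hmk : Measurable fun v : H × PiLp 2 G => WithLp.toLp 2 v := WithLp.measurable_toLp 2 _
  have hmk2 : Measurable fun v : DirectSumHG H G × DirectSumHG H G => WithLp.toLp 2 v :=
    WithLp.measurable_toLp 2 _
  have hfst : Measurable fun v : DirectSumHG H G => v.fst :=
    (WithLp.fstL 2 ℝ H (PiLp 2 G)).continuous.measurable
  have hem : ∀ n, Measurable fun ω => stackedOp L (e n ω) := fun n =>
    (stackedOp L).continuous.measurable.comp (h.meas_e n)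
  have hc : ∀ n, Measurable fun ω =>
      WithLp.toLp 2 (c n ω, WithLp.toLp 2 (e n ω, stackedOp L (e n ω))) := fun n =>
    hmk2.comp ((h.meas_c n).prodMk (hmk.comp ((h.meas_e n).prodMk (hem n))))
  have hDR := h.isBlockDouglasRachford
  have hzv := hDR.measurable hJ.continuous h.activation.measurable h.meas_z h.meas_v
    (fun _ => measurable_const) hc
  have hle := historySigma_le (fun n => (hzv n).1) fun n => (hzv n).2
  have hesum := h.err_e.condSummable hle h.meas_e
  -- The pair `(q - t, q + t)` has average `q`. Its two reflections are `q + t`, which the proximity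
  -- operator maps to `q`, and `q - t`, which projects onto `q`.
  have hzero : ∃ t, drDisplacement (prodOp (blockProx f g γ) (consensusProj L))
      (diagonalProj (DirectSumHG H G)) t = 0 := by
    obtain ⟨q, t, hq, ht, hqt⟩ := exists_blockProx_eq L hf hg hzer hγ
    have hproj : consensusProj L (q - t) = q := by
      refine starProjection_graphSubspace_eq _ hq fun h => ?_
      rw [sub_sub_cancel_left, inner_neg_left, ht, neg_zero]
    refine ⟨WithLp.toLp 2 (q - t, q + t), sub_eq_zero.2 ?_⟩
    have hdiag : (1 / 2 : ℝ) • ((q - t) + (q + t)) = q := by module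
    rw [diagonalProj_apply]
    change WithLp.toLp 2 (blockProx f g γ
      ((2 : ℝ) • ((1 / 2 : ℝ) • ((q - t) + (q + t))) - (q - t)), consensusProj L
      ((2 : ℝ) • ((1 / 2 : ℝ) • ((q - t) + (q + t))) - (q + t))) =
      WithLp.toLp 2 ((1 / 2 : ℝ) • ((q - t) + (q + t)), (1 / 2 : ℝ) • ((q - t) + (q + t)))
    rw [hdiag, show (2 : ℝ) • q - (q - t) = q + t by module,
      show (2 : ℝ) • q - (q + t) = q - t by module, hqt, hproj]
  have hconv := hDR.ae_convergesWeakly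
    (isBlockDecomposition_directSumBlock.prod isBlockDecomposition_id) hJ
    firmlyNonexpansive_diagonalProj hzero hlam
    h.activation (fun n => (hzv n).1) (fun n => (hzv n).2) (fun _ => measurable_const) hc
    condSummable_enorm_zero
    ((h.err_c.condSummable hle h.meas_c).enorm_toLp hle h.meas_c
      (hesum.enorm_toLp hle h.meas_e (hesum.enorm_clm _)))
  refine convergesWeaklyAsTo_of_memory h.activation 0 (hfst.comp h.meas_x)
    (s := fun n ω => (1 / 2 : ℝ) • ((z n ω).fst + (v n ω).fst)) (fun n => ?_) h.step_x_fst
    (argminSet_nonempty L hf hg hzer hγ) ?_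
  · exact ((hfst.comp (hzv n).1).add (hfst.comp (hzv n).2)).const_smul (1 / 2 : ℝ)
  · filter_upwards [hconv] with ω h1
    obtain ⟨t, ht, hlim⟩ := h1
    set b := (1 / 2 : ℝ) • (t.fst + t.snd) with hb
    have ht' := sub_eq_zero.1 ht
    have ht1 : blockProx f g γ ((2 : ℝ) • b - t.fst) = b := congrArg (fun r => r.fst) ht'
    have ht2 : consensusProj L ((2 : ℝ) • b - t.snd) = b := congrArg (fun r => r.snd) ht'
    refine ⟨b.fst, ?_, ?_⟩
    · refine fst_mem_argminSet L hf hg hzer hγ ?_ ht1 fun h => ?_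
      · rw [← ht2]
        exact snd_consensusProj L _
      · have h2 := inner_sub_starProjection_graphSubspace (stackedOp L) ((2 : ℝ) • b - t.snd) h
        change inner ℝ ((2 : ℝ) • b - t.snd - consensusProj L ((2 : ℝ) • b - t.snd)) _ = 0 at h2
        rw [ht2] at h2
        -- As `b` is the average of the two components, the residual at the proximity operator is
        -- opposite to the one at the projector, which is orthogonal to the subspace.
        have h3 : (2 : ℝ) • b - t.fst - b = -((2 : ℝ) • b - t.snd - b) := by
          rw [hb]; module
        rw [h3, inner_neg_left, h2, neg_zero]
    · exact hlim.map (WithLp.fstL 2 ℝ H (PiLp 2 G) ∘L WithLp.fstL 2 ℝ _ _ ∘L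
        diagonalProj (DirectSumHG H G))

end SecondAlgorithm

/-! ### Third algorithm: projection onto the graph of `E` -/

section ThirdAlgorithm
variable {Ω : Type*} [mΩ : MeasurableSpace Ω] {P : Measure Ω}
  {p : ℕ} {H : Type*} [NormedAddCommGroup H] [InnerProductSpace ℝ H] [CompleteSpace H]
  [SecondCountableTopology H] [MeasurableSpace H] [BorelSpace H]
  {G : Fin p → Type*} [∀ k, NormedAddCommGroup (G k)] [∀ k, InnerProductSpace ℝ (G k)]
  [∀ k, CompleteSpace (G k)] [∀ k, SecondCountableTopology (G k)] [∀ k, MeasurableSpace (G k)]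
  [∀ k, BorelSpace (G k)] {f : H → EReal} {g : ∀ k, G k → EReal} {L : ∀ k, H →L[ℝ] G k}
  {r : ℕ} {K : Fin r → Type*} [∀ j, NormedAddCommGroup (K j)] [∀ j, InnerProductSpace ℝ (K j)]
  [∀ j, CompleteSpace (K j)] [∀ j, SecondCountableTopology (K j)] [∀ j, MeasurableSpace (K j)]
  [∀ j, BorelSpace (K j)] {E : DirectSumHG H G →L[ℝ] PiLp 2 K}
  {γ : ℝ} {lam : ℕ → ℝ} {x z a c : ℕ → Ω → DirectSumHG H G} {y w b : ℕ → Ω → PiLp 2 K}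
  {ε : ℕ → Ω → Activation (p + 1 + r)}

-- On `K`, `J` is the projector onto `{0}`, which enforces `E x = 0`. This is why the update of `w`
-- merely subtracts a multiple of `y`.
omit [SecondCountableTopology H] [BorelSpace H] [∀ k, SecondCountableTopology (G k)]
  [∀ k, BorelSpace (G k)] [∀ j, SecondCountableTopology (K j)] in
theorem Framework3.isBlockDouglasRachford (h : Framework3 P f g L E γ lam x z a c y w b ε) :
    IsBlockDouglasRachford (A := DirectSumHG H G) (B := PiLp 2 K)
      (prodBlock directSumBlock piBlock)
      (Sum.elim (Sum.elim (fun _ => Fin.castAdd r (0 : Fin (p + 1))) fun k => Fin.castAdd r k.succ)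
        fun j => Fin.natAdd (p + 1) j) ε
      (prodOp (blockProx f g γ) fun _ => 0) (graphSubspace E).starProjection lam z w
      (fun n ω => WithLp.toLp 2 (a n ω, b n ω)) (fun n ω => WithLp.toLp 2 (c n ω, 0)) := by
  intro n ω
  rw [blockScale_prodBlock]
  set R := (graphSubspace E).starProjection (WithLp.toLp 2 (z n ω, w n ω)) with hR
  have hproj : projGraph E (z n ω) (w n ω) = R := rfl
  have hz : z (n + 1) ω = z n ω + blockScale directSumBlock
      (fun i => (ε n ω).coeff (Sum.elim (fun _ => Fin.castAdd r (0 : Fin (p + 1)))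
        (fun k => Fin.castAdd r k.succ) i) * lam n)
      (blockProx f g γ ((2 : ℝ) • (R.fst + a n ω) - z n ω) + c n ω - (R.fst + a n ω)) := by
    refine DirectSumHG.ext ?_ fun k => ?_
    · rw [WithLp.add_fst, blockScale_directSumBlock_fst, h.step_z_fst, h.step_x_fst, hproj]
      change _ = (z n ω).fst + ((ε n ω).coeff (Fin.castAdd r 0) * lam n) • (prox (scaled γ f)
        ((2 : ℝ) • (R.fst.fst + (a n ω).fst) - (z n ω).fst) + (c n ω).fst -
          (R.fst.fst + (a n ω).fst))
      rcases (ε n ω).coeff_eq_zero_or_one (Fin.castAdd r 0) with h0 | h0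
      · rw [h0, zero_mul, zero_smul, zero_smul]
      · rw [h0, one_smul, add_sub_cancel]
    · rw [WithLp.add_snd, PiLp.add_apply, blockScale_directSumBlock_snd, h.step_z_snd,
        h.step_x_snd, hproj]
      change _ = (z n ω).snd k + ((ε n ω).coeff (Fin.castAdd r k.succ) * lam n) •
        (prox (scaled γ (g k)) ((2 : ℝ) • (R.fst.snd k + (a n ω).snd k) - (z n ω).snd k) +
          (c n ω).snd k - (R.fst.snd k + (a n ω).snd k))
      rcases (ε n ω).coeff_eq_zero_or_one (Fin.castAdd r k.succ) with h0 | h0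
      · rw [h0, zero_mul, zero_smul, zero_smul]
      · rw [h0, one_smul, add_sub_cancel]
  have hw : w (n + 1) ω = w n ω + blockScale piBlock
      (fun j => (ε n ω).coeff (Fin.natAdd (p + 1) j) * lam n) (0 + 0 - (R.snd + b n ω)) := by
    ext j
    rw [PiLp.add_apply, blockScale_piBlock_apply, h.step_w, h.step_y, hproj, zero_add, zero_sub,
      PiLp.neg_apply, PiLp.add_apply, smul_neg, ← sub_eq_add_neg]
    rcases (ε n ω).coeff_eq_zero_or_one (Fin.natAdd (p + 1) j) with h0 | h0
    · rw [h0, zero_mul, zero_smul, zero_smul]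
    · rw [h0, one_smul, add_sub_cancel]
  rw [hz, hw]
  rfl

theorem Framework3.convergesWeaklyAsTo [IsProbabilityMeasure P] [P.IsComplete]
    (h : Framework3 P f g L E γ lam x z a c y w b ε) (hf : IsGammaZero f)
    (hg : ∀ k, IsGammaZero (g k)) (hzer : (zerComposite f g L).Nonempty) (hγ : 0 < γ)
    (hlam : RelaxationSeq lam) :
    ConvergesWeaklyAsTo P (fun n ω => (x n ω).fst)
      (argminSet fun h => f h + ∑ k, g k (L k h)) := by
  have hJ : FirmlyNonexpansive (prodOp (blockProx f g γ) fun _ : PiLp 2 K => 0) :=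
    (firmlyNonexpansive_blockProx L hf hg hzer hγ).prod fun _ _ => by simp
  have hmk : Measurable fun v : DirectSumHG H G × PiLp 2 K => WithLp.toLp 2 v :=
    WithLp.measurable_toLp 2 _
  have hfst : Measurable fun v : DirectSumHG H G => v.fst :=
    (WithLp.fstL 2 ℝ H (PiLp 2 G)).continuous.measurable
  have hker : ∀ v, E v = 0 ↔ v.snd = stackedOp L v.fst := fun v => by
    rw [← mem_consensus_iff, ← h.ker_E]
    rfl
  have ha : ∀ n, Measurable fun ω => WithLp.toLp 2 (a n ω, b n ω) := fun n =>
    hmk.comp ((h.meas_a n).prodMk (h.meas_b n))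
  have hc : ∀ n, Measurable fun ω => WithLp.toLp 2 (c n ω, (0 : PiLp 2 K)) := fun n =>
    hmk.comp ((h.meas_c n).prodMk measurable_const)
  have hDR := h.isBlockDouglasRachford
  have hzw := hDR.measurable hJ.continuous h.activation.measurable h.meas_z h.meas_w ha hc
  have hle := historySigma_le (fun n => (hzw n).1) fun n => (hzw n).2
  have hzero : ∃ t, drDisplacement (prodOp (blockProx f g γ) fun _ : PiLp 2 K => 0)
      (graphSubspace E).starProjection t = 0 := by
    obtain ⟨q, t, hq, ht, hqt⟩ := exists_blockProx_eq L hf hg hzer hγ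
    -- Since `t` is orthogonal to the kernel of `E` and the range is closed, `t` is the adjoint of
    -- `E` applied to `w'`. Then `(-t, w')` is orthogonal to the graph, so `(q - t, w')` projects
    -- onto `(q, 0)`.
    obtain ⟨w', hw'⟩ := exists_inner_eq_of_isClosed_range E h.closed_range_E (u := t)
      fun v hv => by
        have h2 : v = WithLp.toLp 2 (v.fst, stackedOp L v.fst) := by
          rw [← (hker v).1 hv]
          rfl
        rw [h2]
        exact ht _
    have hproj : (graphSubspace E).starProjection (WithLp.toLp 2 (q - t, w')) =
        WithLp.toLp 2 (q, 0) := by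
      refine starProjection_graphSubspace_eq E ((hker q).2 hq).symm fun v => ?_
      rw [WithLp.prod_inner_apply]
      change inner ℝ (q - t - q) v + inner ℝ (w' - 0) (E v) = 0
      rw [sub_sub_cancel_left, sub_zero, inner_neg_left, hw', neg_add_cancel]
    refine ⟨WithLp.toLp 2 (q - t, w'), sub_eq_zero.2 ?_⟩
    rw [hproj]
    change WithLp.toLp 2 (blockProx f g γ ((2 : ℝ) • q - (q - t)), 0) = _
    rw [show (2 : ℝ) • q - (q - t) = q + t by module, hqt]
  have hconv := hDR.ae_convergesWeakly
    (isBlockDecomposition_directSumBlock.prod isBlockDecomposition_piBlock) hJ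
    (firmlyNonexpansive_starProjection _) hzero hlam
    h.activation (fun n => (hzw n).1) (fun n => (hzw n).2) ha hc
    ((h.err_a.condSummable hle h.meas_a).enorm_toLp hle h.meas_a
      (h.err_b.condSummable hle h.meas_b))
    ((h.err_c.condSummable hle h.meas_c).enorm_toLp hle h.meas_c condSummable_enorm_zero)
  refine convergesWeaklyAsTo_of_memory h.activation (Fin.castAdd r 0) (hfst.comp h.meas_x)
    (s := fun n ω => (projGraph E (z n ω) (w n ω)).fst.fst + (a n ω).fst) (fun n => ?_)
    h.step_x_fst (argminSet_nonempty L hf hg hzer hγ) ?_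
  · exact ((WithLp.fstL 2 ℝ H (PiLp 2 G) ∘L WithLp.fstL 2 ℝ _ _ ∘L
      (graphSubspace E).starProjection).continuous.measurable.comp
        (hmk.comp ((hzw n).1.prodMk (hzw n).2))).add (hfst.comp (h.meas_a n))
  · filter_upwards [hconv, h.weak_a] with ω h1 h2
    obtain ⟨t, ht, hlim⟩ := h1
    set R := (graphSubspace E).starProjection t with hR
    have ht' := sub_eq_zero.1 ht
    have ht1 : blockProx f g γ ((2 : ℝ) • R.fst - t.fst) = R.fst := congrArg (fun r => r.fst) ht'
    have ht2 : 0 = R.snd := congrArg (fun r => r.snd) ht'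
    have ht3 : E R.fst = 0 := by
      rw [ht2]
      exact (snd_starProjection_graphSubspace E t).symm
    refine ⟨R.fst.fst, ?_, ?_⟩
    · refine fst_mem_argminSet L hf hg hzer hγ ((hker _).1 ht3) ht1 fun v => ?_
      -- Orthogonality to the graph is tested only on vectors of the kernel of `E`, so the component
      -- in `K` drops out.
      have h3 := inner_sub_starProjection_graphSubspace E t (WithLp.toLp 2 (v, stackedOp L v))
      rw [(hker (WithLp.toLp 2 (v, stackedOp L v))).2 rfl, WithLp.prod_inner_apply] at h3
      change inner ℝ (t.fst - R.fst) (WithLp.toLp 2 (v, stackedOp L v)) +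
        inner ℝ (t.snd - R.snd) 0 = 0 at h3
      rw [inner_zero_right, add_zero] at h3
      rw [show (2 : ℝ) • R.fst - t.fst - R.fst = -(t.fst - R.fst) by module, inner_neg_left, h3,
        neg_zero]
    · have h3 := (hlim.map (WithLp.fstL 2 ℝ H (PiLp 2 G) ∘L WithLp.fstL 2 ℝ _ _ ∘L
        (graphSubspace E).starProjection)).add (h2.map (WithLp.fstL 2 ℝ H (PiLp 2 G)))
      rw [map_zero, add_zero] at h3
      exact h3

end ThirdAlgorithm

end

theorem corollary4p3
    {Ω : Type*} [MeasurableSpace Ω] (P : Measure Ω) [IsProbabilityMeasure P] [P.IsComplete]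
    {p : ℕ} {H : Type*} [NormedAddCommGroup H] [InnerProductSpace ℝ H] [CompleteSpace H]
    [SecondCountableTopology H] [MeasurableSpace H] [BorelSpace H]
    {G : Fin p → Type*} [∀ k, NormedAddCommGroup (G k)] [∀ k, InnerProductSpace ℝ (G k)]
    [∀ k, CompleteSpace (G k)] [∀ k, SecondCountableTopology (G k)]
    [∀ k, MeasurableSpace (G k)] [∀ k, BorelSpace (G k)]
    (f : H → EReal) (hf : IsGammaZero f)
    (g : ∀ k, G k → EReal) (hg : ∀ k, IsGammaZero (g k))
    (L : ∀ k, H →L[ℝ] G k) (hL : ∀ k, L k ≠ 0)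
    (hzer : (zerComposite f g L).Nonempty)
    (γ : ℝ) (hγ : 0 < γ) (lam : ℕ → ℝ) (hlam : RelaxationSeq lam) :
    -- first algorithm
    (∀ (x z s c e : ℕ → Ω → H) (y w d : ℕ → Ω → PiLp 2 G)
        (ε : ℕ → Ω → Activation (p + 1)),
      Framework1 P f g L γ lam x z s c e y w d ε →
      ConvergesWeaklyAsTo P x (argminSet fun h => f h + ∑ k, g k (L k h))) ∧
    -- second algorithm
    (∀ (x z u v c : ℕ → Ω → DirectSumHG H G) (s e : ℕ → Ω → H)
        (ε : ℕ → Ω → Activation (p + 2)),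
      Framework2 P f g L γ lam x z u v c s e ε →
      ConvergesWeaklyAsTo P (fun n ω => (x n ω).fst)
        (argminSet fun h => f h + ∑ k, g k (L k h))) ∧
    -- third algorithm
    (∀ {r : ℕ} {K : Fin r → Type*} [∀ j, NormedAddCommGroup (K j)]
        [∀ j, InnerProductSpace ℝ (K j)] [∀ j, CompleteSpace (K j)]
        [∀ j, SecondCountableTopology (K j)] [∀ j, MeasurableSpace (K j)]
        [∀ j, BorelSpace (K j)]
        (E : DirectSumHG H G →L[ℝ] PiLp 2 K)
        (x z a c : ℕ → Ω → DirectSumHG H G) (y w b : ℕ → Ω → PiLp 2 K)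
        (ε : ℕ → Ω → Activation (p + 1 + r)),
      Framework3 P f g L E γ lam x z a c y w b ε →
      ConvergesWeaklyAsTo P (fun n ω => (x n ω).fst)
        (argminSet fun h => f h + ∑ k, g k (L k h))) := by
  refine ⟨?_, ?_, ?_⟩
  · intro x z s c e y w d ε h
    exact h.convergesWeaklyAsTo hf hg hzer hγ hlam
  · intro x z u v c s e ε h
    exact h.convergesWeaklyAsTo hf hg hzer hγ hlam
  · intro r K _ _ _ _ _ _ E x z a c y w b ε h
    exact h.convergesWeaklyAsTo hf hg hzer hγ hlam
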